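/- Theorem. All graphs are finite and simple. A graph is hamiltonian if it has a cycle through all of its vertices; it is hypohamiltonian if it is not hamiltonian but all of its vertex-deleted subgraphs are hamiltonian; it is $K_2$-hamiltonian if the removal of any two adjacent vertices yields a hamiltonian graph. Let $p(n)$ be the number of pairwise non-isomorphic planar graphs of order $n$ that are both hypohamiltonian and $K_2$-hamiltonian, and let $h(n)$ be the number of pairwise non-isomorphic hypohamiltonian graphs of order $n$. Then $p(n)$ grows at least exponentially: there is a constant $c > 1$ such that $p(n) \ge c^n$ for all sufficiently large integers $n$. In particular (Collier and Schmeichel), $h(n) \ge c^n$ for all sufficiently large $n$. -/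

import Mathlib

open Filter

/-- `A` is an arc in the Euclidean plane with end-points `x` and `y`: the image of an injective
continuous path from `x` to `y`. -/
def IsArcBetween (A : Set (EuclideanSpace ℝ (Fin 2))) (x y : EuclideanSpace ℝ (Fin 2)) : Prop :=
  ∃ γ : Path x y, Function.Injective γ ∧ Set.range γ = A

/-- A graph is planar if it can be drawn in the Euclidean plane without crossings: the vertices are
distinct points, every edge is an arc joining its two ends, an edge contains no vertex other than
its ends, and two different edges meet at most in a common end. -/
def IsPlanarGraph {V : Type*} (G : SimpleGraph V) : Prop :=
  ∃ (p : V → EuclideanSpace ℝ (Fin 2)) (A : Sym2 V → Set (EuclideanSpace ℝ (Fin 2))),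
    Function.Injective p ∧
    (∀ u v, G.Adj u v → IsArcBetween (A s(u, v)) (p u) (p v)) ∧
    (∀ e ∈ G.edgeSet, ∀ w, p w ∈ A e → w ∈ e) ∧
    (∀ e ∈ G.edgeSet, ∀ f ∈ G.edgeSet, e ≠ f →
      ∀ x ∈ A e ∩ A f, ∃ w, w ∈ e ∧ w ∈ f ∧ x = p w)

section Hamiltonicity

variable {V : Type*} [Fintype V] [DecidableEq V]

/-- `G` is `K₁`-hamiltonian: every vertex-deleted subgraph is hamiltonian. -/
def IsK1Hamiltonian (G : SimpleGraph V) : Prop :=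
  ∀ v, (G.induce ({v}ᶜ : Set V)).IsHamiltonian

/-- `G` is `K₂`-hamiltonian: deleting any two adjacent vertices leaves a hamiltonian graph. -/
def IsK2Hamiltonian (G : SimpleGraph V) : Prop :=
  ∀ u v, G.Adj u v → (G.induce ({u, v}ᶜ : Set V)).IsHamiltonian

/-- `G` is hypohamiltonian: non-hamiltonian and `K₁`-hamiltonian. -/
def IsHypohamiltonian (G : SimpleGraph V) : Prop :=
  ¬ G.IsHamiltonian ∧ IsK1Hamiltonian G

end Hamiltonicity

/-- Isomorphism as an equivalence relation on the graphs with vertex set `Fin n`. -/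
def graphIsoSetoid (n : ℕ) : Setoid (SimpleGraph (Fin n)) where
  r G H := Nonempty (G ≃g H)
  iseqv :=
    ⟨fun _ => ⟨SimpleGraph.Iso.refl⟩, fun ⟨f⟩ => ⟨f.symm⟩, fun ⟨f⟩ ⟨g⟩ => ⟨f.trans g⟩⟩

/-- The number of isomorphism classes of graphs of order `n` that contain a graph with the
property `P`; for an isomorphism-invariant `P` this is the number of pairwise non-isomorphic graphs
of order `n` that have the property `P`. -/
noncomputable def numGraphsUpToIso (n : ℕ) (P : SimpleGraph (Fin n) → Prop) : ℕ :=
  Set.ncard (Quotient.mk (graphIsoSetoid n) '' {G | P G})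

/-!
The graphs are built from two base graphs `A` and `B` of orders 93 and 96, which are planar,
hypohamiltonian and `K₂`-hamiltonian, by gluing at cubic vertices: a vertex `y` of one graph and a
vertex `x` of another one are deleted and their neighbours are identified in pairs. Cutting a
hamiltonian cycle at the three identified vertices shows that the result is not hamiltonian if
neither graph is, and cycles that avoid one vertex or two adjacent ones can be extended into the
other graph (`IsGluing.isGood`). Each base graph has two marked cubic vertices, so the operation can
be iterated, and every word over `A` and `B` gives a graph, `chainGraph`.

That the base graphs are not hamiltonian follows from a two-sided form of Grinberg's criterion,
`PlaneMap.TwoSided.not_isHamCycle`. Suppose that a plane graph is divided by a cut of six edges and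
that the faces not met by the cut have lengths congruent to 2 modulo 3. A hamiltonian cycle divides
the faces into two classes, each of which is a tree through the edges off the cycle. Counting these
edges on either side of the cut, modulo 3, relates the sum of the signs of the six faces met by the
cut, weighted with the number of edges that they have on this side, to the number of components into
which the side decomposes the two trees; this number is governed by the sign changes around the cut.
For the weights at hand none of the 64 sign patterns is consistent. The hamiltonian cycles of the
subgraphs obtained by deleting a vertex, or two adjacent ones, are listed explicitly.

For planarity, a base graph is drawn with straight edges in a triangle, with a triangular hole in
place of `y`. An affine image of any other such drawing fits into the hole
(`HoledDrawing.glue`, `isPlanarGraph_chainGraph`). Only the outermost drawing has to contain the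
last remaining marked vertex, and a separate drawing of `A` serves for this.

An isomorphism that respects the last marked vertex preserves the numbers of vertices at given
distances from it. As `A` and `B` have seven and six vertices at distance two, and the three
neighbours of `y` all have distance eight, these numbers determine the word
(`eq_of_levelCard_eq`). Hence an isomorphism class of order `n` contains the graphs of at most `n`
words of a given length, one for each position of the marked vertex, and there are exponentially
many words with prescribed order and length.
-/

/-! ### Paths and cycles with a prescribed vertex set -/

/-- `SpanPath G a b S`: the graph `G` has a path from `a` to `b` whose vertex set is exactly `S`. -/
inductive SpanPath {V : Type*} (G : SimpleGraph V) : V → V → Set V → Prop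
  | single (a : V) : SpanPath G a a {a}
  | cons {a c b : V} {S : Set V} :
      G.Adj a c → a ∉ S → SpanPath G c b S → SpanPath G a b (insert a S)

/-- `SpanCycle G S`: the graph `G` has a cycle whose vertex set is exactly `S`. The third vertex `c`
excludes a single edge traversed in both directions. -/
def SpanCycle {V : Type*} (G : SimpleGraph V) (S : Set V) : Prop :=
  ∃ a b, SpanPath G a b S ∧ G.Adj b a ∧ ∃ c ∈ S, c ≠ a ∧ c ≠ b

namespace SpanPath

variable {V : Type*} {G : SimpleGraph V} {a b c d : V} {S T : Set V}

lemma left_mem (h : SpanPath G a b S) : a ∈ S := by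
  cases h <;> simp

lemma right_mem (h : SpanPath G a b S) : b ∈ S := by
  induction h with
  | single a => simp
  | cons _ _ _ ih => exact Set.mem_insert_of_mem _ ih

lemma append (h : SpanPath G a b S) (hbc : G.Adj b c) (h' : SpanPath G c d T)
    (hST : Disjoint S T) : SpanPath G a d (S ∪ T) := by
  induction h with
  | single a =>
    rw [Set.singleton_union]
    exact cons hbc (by simpa using hST) h'
  | @cons a e b S hae haS _ ih =>
    rw [Set.insert_union]
    rw [Set.disjoint_insert_left] at hST
    exact cons hae (by simp [haS, hST.1]) (ih hbc hST.2)

lemma snoc (h : SpanPath G a b S) (hbc : G.Adj b c) (hc : c ∉ S) :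
    SpanPath G a c (insert c S) := by
  have := h.append hbc (single c) (by simpa using hc)
  rwa [Set.union_singleton] at this

lemma reverse (h : SpanPath G a b S) : SpanPath G b a S := by
  induction h with
  | single a => exact single a
  | cons hae haS _ ih => exact ih.snoc hae.symm haS

lemma split (h : SpanPath G a b S) {v : V} (hv : v ∈ S) (hva : v ≠ a) :
    ∃ c S₁ S₂, SpanPath G a c S₁ ∧ G.Adj c v ∧ SpanPath G v b S₂ ∧ Disjoint S₁ S₂ ∧
      S₁ ∪ S₂ = S := by
  induction h with
  | single a => exact absurd (by simpa using hv) hva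
  | @cons a e b S hae haS h ih =>
    rcases eq_or_ne v e with rfl | hve
    · exact ⟨a, {a}, S, single a, hae, h, by simpa using haS, by simp⟩
    · obtain ⟨c, S₁, S₂, h₁, hc, h₂, hd, hu⟩ :=
        ih ((Set.mem_insert_iff.1 hv).resolve_left hva) hve
      refine ⟨c, insert a S₁, S₂, cons hae (fun h => haS (hu ▸ Or.inl h)) h₁, hc, h₂, ?_, ?_⟩
      · rw [Set.disjoint_insert_left]
        exact ⟨fun h => haS (hu ▸ Or.inr h), hd⟩
      · rw [Set.insert_union, hu]

/-- The path obtained by deleting the first vertex. -/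
lemma tail (h : SpanPath G a b S) (hab : a ≠ b) :
    ∃ c, G.Adj a c ∧ SpanPath G c b (S \ {a}) := by
  cases h with
  | single => exact absurd rfl hab
  | @cons _ c _ S hac haS h => exact ⟨c, hac, by simpa [haS] using h⟩

lemma map {W : Type*} {H : SimpleGraph W} (f : V → W) (h : SpanPath G a b S)
    (hadj : ∀ u ∈ S, ∀ v ∈ S, G.Adj u v → H.Adj (f u) (f v)) (hinj : Set.InjOn f S) :
    SpanPath H (f a) (f b) (f '' S) := by
  induction h with
  | single a => simpa using single (G := H) (f a)
  | @cons a c b S hac haS h ih =>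
    rw [Set.image_insert_eq]
    refine cons (hadj _ (by simp) _ (by simp [h.left_mem]) hac) ?_
      (ih (fun u hu v hv => hadj u (by simp [hu]) v (by simp [hv]))
        (hinj.mono (Set.subset_insert _ _)))
    rintro ⟨u, hu, hua⟩
    have := hinj (Set.mem_insert_of_mem _ hu) (Set.mem_insert _ _) hua
    exact haS (this ▸ hu)

/-- A path inside the injective image of a set of vertices can be pulled back. -/
lemma comap {W : Type*} {H : SimpleGraph W} {f : W → V} {R : Set W} (h : SpanPath G a b S)
    (hS : S ⊆ f '' R) (hadj : ∀ u ∈ R, ∀ v ∈ R, G.Adj (f u) (f v) → H.Adj u v)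
    (hinj : Set.InjOn f R) :
    ∃ u ∈ R, ∃ v ∈ R, f u = a ∧ f v = b ∧ SpanPath H u v (R ∩ f ⁻¹' S) := by
  induction h with
  | single a =>
    obtain ⟨u, hu, rfl⟩ := hS rfl
    refine ⟨u, hu, u, hu, rfl, rfl, ?_⟩
    convert single (G := H) u
    ext w
    simp only [Set.mem_inter_iff, Set.mem_preimage, Set.mem_singleton_iff]
    exact ⟨fun h => hinj h.1 hu h.2, by rintro rfl; exact ⟨hu, rfl⟩⟩
  | @cons a c b S hac haS h ih =>
    obtain ⟨u, hu, rfl⟩ := hS (Set.mem_insert _ _)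
    obtain ⟨w, hw, v, hv, rfl, rfl, hp⟩ := ih ((Set.subset_insert _ _).trans hS)
    refine ⟨u, hu, v, hv, rfl, rfl, ?_⟩
    convert cons (hadj _ hu _ hw hac) (fun h => haS h.2) hp
    ext z
    simp only [Set.mem_inter_iff, Set.mem_preimage, Set.mem_insert_iff]
    constructor
    · rintro ⟨hz, h | h⟩
      · exact Or.inl (hinj hz hu h)
      · exact Or.inr ⟨hz, h⟩
    · rintro (rfl | ⟨hz, h⟩)
      · exact ⟨hu, Or.inl rfl⟩
      · exact ⟨hz, Or.inr h⟩

/-- A path that stays in `A ∪ C`, two sets without edges between them, stays in one of them. -/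
lemma subset_or_subset (h : SpanPath G a b S) {A C : Set V} (hS : S ⊆ A ∪ C)
    (hAC : ∀ u ∈ A, ∀ v ∈ C, ¬ G.Adj u v) : S ⊆ A ∨ S ⊆ C := by
  induction h with
  | single a => simpa using hS
  | @cons a c b S hac haS h ih =>
    rcases ih ((Set.subset_insert _ _).trans hS) with h1 | h1
    · refine Or.inl (Set.insert_subset ?_ h1)
      rcases hS (Set.mem_insert _ _) with ha | ha
      · exact ha
      · exact absurd hac.symm (hAC _ (h1 h.left_mem) _ ha)
    · refine Or.inr (Set.insert_subset ?_ h1)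
      rcases hS (Set.mem_insert _ _) with ha | ha
      · exact absurd hac (hAC _ ha _ (h1 h.left_mem))
      · exact ha

lemma exists_walk (h : SpanPath G a b S) :
    ∃ p : G.Walk a b, p.IsPath ∧ ∀ v, v ∈ p.support ↔ v ∈ S := by
  induction h with
  | single a => exact ⟨.nil, by simp, by simp⟩
  | @cons a c b S hac haS h ih =>
    obtain ⟨p, hp, hs⟩ := ih
    exact ⟨.cons hac p, by simp [hp, hs, haS], by simp [hs]⟩

lemma of_walk (p : G.Walk a b) (hp : p.IsPath) : SpanPath G a b {v | v ∈ p.support} := by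
  induction p with
  | nil => simpa using single _
  | cons hac p ih =>
    rw [SimpleGraph.Walk.cons_isPath_iff] at hp
    convert cons hac (by simpa using hp.2) (ih hp.1)
    ext v; simp

end SpanPath

namespace SpanCycle

variable {V : Type*} {G : SimpleGraph V} {S : Set V}

/-- A cycle can be traversed starting from any of its vertices. -/
lemma exists_path (h : SpanCycle G S) {v : V} (hv : v ∈ S) :
    ∃ b, SpanPath G v b S ∧ G.Adj b v := by
  obtain ⟨a, b, hp, hba, -⟩ := h
  rcases eq_or_ne v a with rfl | hva
  · exact ⟨b, hp, hba⟩
  · obtain ⟨c, S₁, S₂, h₁, hc, h₂, hd, rfl⟩ := hp.split hv hva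
    exact ⟨c, by rw [Set.union_comm]; exact h₂.append hba h₁ hd.symm, hc⟩

lemma map {W : Type*} {H : SimpleGraph W} (f : V → W) (h : SpanCycle G S)
    (hadj : ∀ u ∈ S, ∀ v ∈ S, G.Adj u v → H.Adj (f u) (f v)) (hinj : Set.InjOn f S) :
    SpanCycle H (f '' S) := by
  obtain ⟨a, b, hp, hba, c, hc, hca, hcb⟩ := h
  have ha := hp.left_mem
  have hb := hp.right_mem
  exact ⟨f a, f b, hp.map f hadj hinj, hadj _ hb _ ha hba, f c, ⟨c, hc, rfl⟩,
    fun h => hca (hinj hc ha h), fun h => hcb (hinj hc hb h)⟩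

lemma comap {W : Type*} {H : SimpleGraph W} {f : W → V} {R : Set W} (h : SpanCycle G S)
    (hS : S = f '' R) (hadj : ∀ u ∈ R, ∀ v ∈ R, G.Adj (f u) (f v) → H.Adj u v)
    (hinj : Set.InjOn f R) : SpanCycle H R := by
  obtain ⟨a, b, hp, hba, c, hc, hca, hcb⟩ := h
  obtain ⟨u, hu, v, hv, rfl, rfl, hp'⟩ := hp.comap hS.le hadj hinj
  obtain ⟨w, hw, rfl⟩ := hS ▸ hc
  refine ⟨u, v, ?_, hadj _ hv _ hu hba, w, hw, fun h => hca (h ▸ rfl), fun h => hcb (h ▸ rfl)⟩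
  convert hp'
  rw [hS]
  exact (Set.inter_eq_left.2 (Set.subset_preimage_image f R)).symm

/-- A graph with a cycle through all vertices is hamiltonian in the sense of Mathlib. -/
lemma isHamiltonian [Fintype V] [DecidableEq V] (h : SpanCycle G Set.univ) : G.IsHamiltonian := by
  intro _
  obtain ⟨a, b, hp, hba, c, -, hca, hcb⟩ := h
  obtain ⟨p, hp, hs⟩ := hp.reverse.exists_walk
  refine ⟨a, .cons hba.symm p, ?_⟩
  rw [SimpleGraph.Walk.isHamiltonianCycle_iff_isCycle_and_support_count_tail_eq_one]
  refine ⟨?_, fun v => ?_⟩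
  · rw [SimpleGraph.Walk.cons_isCycle_iff]
    refine ⟨hp, fun he => ?_⟩
    -- otherwise the path would be the single edge `ba`, leaving no room for `c`
    have h1 := (hs c).2 trivial
    cases p with
    | nil => exact hba.ne rfl
    | @cons _ d _ hbd q =>
      rw [SimpleGraph.Walk.cons_isPath_iff] at hp
      simp only [SimpleGraph.Walk.edges_cons, List.mem_cons] at he
      rcases he with he | he
      · have hda : d = a := by
          rcases Sym2.eq_iff.1 he with ⟨h, -⟩ | ⟨h, -⟩
          · exact absurd h hba.ne'
          · exact h.symm
        subst hda
        have hq := SimpleGraph.Walk.isPath_iff_nil.1 hp.1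
        cases q with
        | nil => simp [hca, hcb] at h1
        | cons => simp at hq
      · exact hp.2 (q.snd_mem_support_of_mem_edges he)
  · simp only [SimpleGraph.Walk.support_cons, List.tail_cons]
    exact List.count_eq_one_of_mem hp.support_nodup ((hs v).2 trivial)

end SpanCycle

/-- A hamiltonian graph with at least two vertices has a cycle through all vertices. -/
lemma SimpleGraph.IsHamiltonian.spanCycle {V : Type*} [Fintype V] [DecidableEq V]
    {G : SimpleGraph V} (h : G.IsHamiltonian) (hV : Fintype.card V ≠ 1) :
    SpanCycle G Set.univ := by
  obtain ⟨a, p, hp⟩ := h hV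
  rw [SimpleGraph.Walk.isHamiltonianCycle_iff_isCycle_and_support_count_tail_eq_one] at hp
  obtain ⟨hc, hs⟩ := hp
  cases p with
  | nil => exact absurd hc SimpleGraph.Walk.not_isCycle_nil
  | @cons _ b _ hab q =>
    have h3 := hc.three_le_length
    rw [SimpleGraph.Walk.cons_isCycle_iff] at hc
    have hq := SpanPath.of_walk q hc.1
    have huniv : {v | v ∈ q.support} = Set.univ := by
      refine Set.eq_univ_of_forall fun v => ?_
      have := hs v
      simp only [SimpleGraph.Walk.support_cons, List.tail_cons] at this
      exact List.count_pos_iff.1 (by omega)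
    rw [huniv] at hq
    refine ⟨b, a, hq, hab, ?_⟩
    cases q with
    | nil => simp at h3
    | @cons _ d _ hbd r =>
      refine ⟨d, trivial, hbd.ne', ?_⟩
      rintro rfl
      exact hc.2 (by simp [Sym2.eq_swap])

/-- A cycle through a set `S` of vertices makes the subgraph induced by `S` hamiltonian. -/
lemma SpanCycle.isHamiltonian_induce {V : Type*} {G : SimpleGraph V} {S : Set V} [Fintype S]
    [DecidableEq S] (h : SpanCycle G S) : (G.induce S).IsHamiltonian :=
  SpanCycle.isHamiltonian <| h.comap (f := Subtype.val) (by simp) (fun _ _ _ _ h => h)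
    Subtype.val_injective.injOn

/-! ### Gluing two graphs at cubic vertices -/

/-- A graph that is both hypohamiltonian and `K₂`-hamiltonian, in terms of cycles with prescribed
vertex sets. -/
structure IsGood {V : Type*} (G : SimpleGraph V) : Prop where
  not_univ : ¬ SpanCycle G Set.univ
  compl_vertex : ∀ u, SpanCycle G {u}ᶜ
  compl_edge : ∀ u v, G.Adj u v → SpanCycle G {u, v}ᶜ

lemma IsGood.isHypohamiltonian {V : Type*} [Fintype V] [DecidableEq V] {G : SimpleGraph V}
    (h : IsGood G) : IsHypohamiltonian G := by
  refine ⟨fun hG => ?_, fun v => (h.compl_vertex v).isHamiltonian_induce⟩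
  by_cases hV : Fintype.card V = 1
  · obtain ⟨v, hv⟩ := Fintype.card_eq_one_iff.1 hV
    obtain ⟨a, b, -, -, c, -, hca, -⟩ := h.compl_vertex v
    exact hca ((hv c).trans (hv a).symm)
  · exact h.not_univ (hG.spanCycle hV)

lemma IsGood.isK2Hamiltonian {V : Type*} [Fintype V] [DecidableEq V] {G : SimpleGraph V}
    (h : IsGood G) : IsK2Hamiltonian G :=
  fun u v huv => (h.compl_edge u v huv).isHamiltonian_induce

lemma IsGood.of_iso {V W : Type*} {G : SimpleGraph V} {H : SimpleGraph W} (e : G ≃g H)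
    (h : IsGood G) : IsGood H where
  not_univ hH := h.not_univ <| hH.comap (f := e) (by simp) (fun _ _ _ _ h => e.map_adj_iff.1 h)
    e.injective.injOn
  compl_vertex u := by
    have := (h.compl_vertex (e.symm u)).map (H := H) e (fun _ _ _ _ h => e.map_adj_iff.2 h)
      e.injective.injOn
    rwa [Set.image_compl_eq e.bijective, Set.image_singleton, e.apply_symm_apply] at this
  compl_edge u v huv := by
    have := (h.compl_edge (e.symm u) (e.symm v) (e.symm.map_adj_iff.2 huv)).map (H := H) e
      (fun _ _ _ _ h => e.map_adj_iff.2 h) e.injective.injOn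
    rwa [Set.image_compl_eq e.bijective, Set.image_pair, e.apply_symm_apply,
      e.apply_symm_apply] at this

/-- `Link G u v S`: the graph `G` has a path from `u` to `v` whose set of inner vertices is `S`;
there is at least one inner vertex. -/
def Link {V : Type*} (G : SimpleGraph V) (u v : V) (S : Set V) : Prop :=
  ∃ c d, G.Adj u c ∧ SpanPath G c d S ∧ G.Adj d v

lemma Link.symm {V : Type*} {G : SimpleGraph V} {u v : V} {S : Set V} (h : Link G u v S) :
    Link G v u S := by
  obtain ⟨c, d, h1, h2, h3⟩ := h
  exact ⟨d, c, h3.symm, h2.reverse, h1.symm⟩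

/-- Removing the two ends of a path whose ends are distinct and not adjacent. -/
lemma SpanPath.link {V : Type*} {G : SimpleGraph V} {u v : V} {S : Set V} (h : SpanPath G u v S)
    (huv : u ≠ v) (hadj : ¬ G.Adj u v) : Link G u v ((S \ {u}) \ {v}) := by
  obtain ⟨c, huc, hc⟩ := h.tail huv
  obtain ⟨d, hvd, hd⟩ := hc.reverse.tail (by rintro rfl; exact hadj huc)
  exact ⟨c, d, huc, hd.reverse, hvd.symm⟩

namespace SpanCycle

variable {V : Type*} {G : SimpleGraph V} {S : Set V}

lemma exists_path_sdiff (h : SpanCycle G S) {v : V} (hv : v ∈ S) :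
    ∃ p q, p ≠ q ∧ G.Adj v p ∧ G.Adj v q ∧ SpanPath G p q (S \ {v}) := by
  obtain ⟨q, hp, hqv⟩ := h.exists_path hv
  obtain ⟨p, hvp, hp'⟩ := hp.tail hqv.ne'
  refine ⟨p, q, ?_, hvp, hqv.symm, hp'⟩
  rintro rfl
  have hS : S ⊆ {v, p} := by
    have : S \ {v} = {p} := by
      generalize S \ {v} = T at hp'
      cases hp' with
      | single => rfl
      | cons _ h1 h2 => exact absurd h2.right_mem h1
    intro z hz
    by_cases hzv : z = v
    · simp [hzv]
    · have : z ∈ S \ {v} := ⟨hz, hzv⟩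
      simp_all
  obtain ⟨a, b, hab, hba, c, hc, hca, hcb⟩ := h
  have h1 := hS hab.left_mem
  have h2 := hS hab.right_mem
  have h3 := hS hc
  have h4 := hba.ne
  simp only [Set.mem_insert_iff, Set.mem_singleton_iff] at h1 h2 h3
  grind

/-- Three pairwise non-adjacent vertices cut a cycle into three links. -/
lemma three_links (h : SpanCycle G S) {u v w : V} (hu : u ∈ S) (hv : v ∈ S) (hw : w ∈ S)
    (huv : u ≠ v) (huw : u ≠ w) (hvw : v ≠ w) (auv : ¬ G.Adj u v) (auw : ¬ G.Adj u w)
    (avw : ¬ G.Adj v w) :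
    ∃ S₁ S₂ S₃, Link G u v S₁ ∧ Link G v w S₂ ∧ Link G w u S₃ ∧ Disjoint S₁ S₂ ∧
      Disjoint S₁ S₃ ∧ Disjoint S₂ S₃ ∧ S₁ ∪ S₂ ∪ S₃ = S \ {u, v, w} := by
  obtain ⟨p, q, -, hup, huq, hpq⟩ := h.exists_path_sdiff hu
  obtain ⟨c, S₁, T, h₁, hcv, h₂, hd, hS⟩ :=
    hpq.split (v := v) ⟨hv, huv.symm⟩ (by rintro rfl; exact auv hup)
  obtain ⟨d, hvd, h₂'⟩ := h₂.tail (by rintro rfl; exact auv huq)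
  have hS' : ∀ z, z ∈ S₁ ∨ z ∈ T ↔ z ∈ S ∧ z ≠ u := fun z => by
    have := Set.ext_iff.1 hS z
    simpa using this
  have hvT := h₂.left_mem
  have hd' := Set.disjoint_left.1 hd
  rcases (hS' w).2 ⟨hw, huw.symm⟩ with hwS | hwT
  · obtain ⟨e, S₂, S₃, h₃, hew, h₄, hd2, rfl⟩ :=
      h₁.split hwS (by rintro rfl; exact auw hup)
    obtain ⟨f, hwf, h₄'⟩ := h₄.tail (by rintro rfl; exact avw hcv.symm)
    have hw4 := h₄.left_mem
    have hd2' := Set.disjoint_left.1 hd2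
    refine ⟨T \ {v}, S₃ \ {w}, S₂, Link.symm ⟨d, q, hvd, h₂', huq.symm⟩,
      Link.symm ⟨f, c, hwf, h₄', hcv⟩, Link.symm ⟨p, e, hup, h₃, hew⟩, ?_, ?_, ?_, ?_⟩
    · rw [Set.disjoint_left]; grind
    · rw [Set.disjoint_left]; grind
    · rw [Set.disjoint_left]; grind
    · ext z; have := hS' z; simp only [Set.mem_union, Set.mem_sdiff, Set.mem_insert_iff,
        Set.mem_singleton_iff] at *; grind
  · have hdw : w ≠ d := by rintro rfl; exact avw hvd
    obtain ⟨e, S₂, S₃, h₃, hew, h₄, hd2, hT⟩ := h₂'.split (v := w) ⟨hwT, hvw.symm⟩ hdw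
    obtain ⟨f, hwf, h₄'⟩ := h₄.tail (by rintro rfl; exact auw huq)
    have hw4 := h₄.left_mem
    have hd2' := Set.disjoint_left.1 hd2
    have hT' : ∀ z, z ∈ S₂ ∨ z ∈ S₃ ↔ z ∈ T ∧ z ≠ v := fun z => by
      have := Set.ext_iff.1 hT z
      simpa using this
    refine ⟨S₁, S₂, S₃ \ {w}, ⟨p, c, hup, h₁, hcv⟩, ⟨d, e, hvd, h₃, hew⟩,
      ⟨f, q, hwf, h₄', huq.symm⟩, ?_, ?_, ?_, ?_⟩
    · rw [Set.disjoint_left]; grind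
    · rw [Set.disjoint_left]; grind
    · rw [Set.disjoint_left]; grind
    · ext z; have := hS' z; have := hT' z; simp only [Set.mem_union, Set.mem_sdiff,
        Set.mem_insert_iff, Set.mem_singleton_iff] at *; grind

end SpanCycle

/-- The graph `Z` arises from `B` and `H` by deleting the cubic vertices `y` of `B` and `x` of `H`,
whose neighbours `b k` and `t k` are pairwise non-adjacent, and identifying `b k` with `t k`. The
maps `φ` and `ψ` embed what remains of `B` and `H` into `Z`; their values at `y` and `x` are
irrelevant. -/
structure IsGluing {U W V : Type*} (B : SimpleGraph U) (y : U) (b : Fin 3 → U)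
    (H : SimpleGraph W) (x : W) (t : Fin 3 → W) (Z : SimpleGraph V) (φ : U → V) (ψ : W → V) :
    Prop where
  b_inj : Function.Injective b
  t_inj : Function.Injective t
  adj_y : ∀ u, B.Adj y u ↔ ∃ k, u = b k
  adj_x : ∀ w, H.Adj x w ↔ ∃ k, w = t k
  b_indep : ∀ i j, ¬ B.Adj (b i) (b j)
  t_indep : ∀ i j, ¬ H.Adj (t i) (t j)
  φ_inj : Set.InjOn φ {y}ᶜ
  ψ_inj : Set.InjOn ψ {x}ᶜ
  glue : ∀ k, φ (b k) = ψ (t k)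
  meet : ∀ u, u ≠ y → ∀ w, w ≠ x → φ u = ψ w → ∃ k, u = b k ∧ w = t k
  cover : ∀ v, (∃ u, u ≠ y ∧ φ u = v) ∨ ∃ w, w ≠ x ∧ ψ w = v
  adj_φ : ∀ u, u ≠ y → ∀ u', u' ≠ y → (Z.Adj (φ u) (φ u') ↔ B.Adj u u')
  adj_ψ : ∀ w, w ≠ x → ∀ w', w' ≠ x → (Z.Adj (ψ w) (ψ w') ↔ H.Adj w w')
  adj_cases : ∀ v v', Z.Adj v v' → (∃ u u', u ≠ y ∧ u' ≠ y ∧ φ u = v ∧ φ u' = v') ∨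
    ∃ w w', w ≠ x ∧ w' ≠ x ∧ ψ w = v ∧ ψ w' = v'

namespace IsGluing

variable {U W V : Type*} {B : SimpleGraph U} {y : U} {b : Fin 3 → U} {H : SimpleGraph W} {x : W}
  {t : Fin 3 → W} {Z : SimpleGraph V} {φ : U → V} {ψ : W → V}

lemma symm (h : IsGluing B y b H x t Z φ ψ) : IsGluing H x t B y b Z ψ φ where
  b_inj := h.t_inj
  t_inj := h.b_inj
  adj_y := h.adj_x
  adj_x := h.adj_y
  b_indep := h.t_indep
  t_indep := h.b_indep
  φ_inj := h.ψ_inj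
  ψ_inj := h.φ_inj
  glue k := (h.glue k).symm
  meet w hw u hu e := by
    obtain ⟨k, h1, h2⟩ := h.meet u hu w hw e.symm
    exact ⟨k, h2, h1⟩
  cover v := (h.cover v).symm
  adj_φ := h.adj_ψ
  adj_ψ := h.adj_φ
  adj_cases v v' hv := (h.adj_cases v v' hv).symm

lemma b_ne (h : IsGluing B y b H x t Z φ ψ) (k : Fin 3) : b k ≠ y :=
  ((h.adj_y _).2 ⟨k, rfl⟩).ne'

/-- Inside `H` minus a neighbour of `x`, a cycle through all vertices supplies a link between the
other two neighbours of `x` through all the remaining vertices. -/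
lemma link (h : IsGluing B y b H x t Z φ ψ) (hH : ∀ k, SpanCycle H {t k}ᶜ) {i j : Fin 3}
    (hij : i ≠ j) : Link Z (φ (b i)) (φ (b j)) (ψ '' {w | w ≠ x ∧ ∀ k, w ≠ t k}) := by
  obtain ⟨k, hki, hkj, hk⟩ : ∃ k : Fin 3, k ≠ i ∧ k ≠ j ∧ ∀ l, l = i ∨ l = j ∨ l = k := by
    revert i j; decide
  obtain ⟨p, q, hpq, hp, hq, hP⟩ := (hH k).exists_path_sdiff (v := x) (h.symm.b_ne k).symm
  have hL : Link H (t i) (t j) {w | w ≠ x ∧ ∀ k, w ≠ t k} := by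
    obtain ⟨i', rfl⟩ := (h.adj_x p).1 hp
    obtain ⟨j', rfl⟩ := (h.adj_x q).1 hq
    have hi' : i' ≠ k := by rintro rfl; exact hP.left_mem.1 rfl
    have hj' : j' ≠ k := by rintro rfl; exact hP.right_mem.1 rfl
    have hL := hP.link hpq (h.t_indep _ _)
    have hne : i' ≠ j' := fun e => hpq (e ▸ rfl)
    have hset : ((({t k}ᶜ \ {x}) \ {t i'}) \ {t j'}) = {w | w ≠ x ∧ ∀ k, w ≠ t k} := by
      have hall : ∀ l, l = i' ∨ l = j' ∨ l = k := by
        have := hk i'; have := hk j'; intro l; have := hk l; grind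
      ext w
      simp only [Set.mem_sdiff, Set.mem_compl_iff, Set.mem_singleton_iff, Set.mem_ofPred_eq]
      constructor
      · rintro ⟨⟨⟨h1, h2⟩, h3⟩, h4⟩
        exact ⟨h2, fun l => by rcases hall l with rfl | rfl | rfl <;> assumption⟩
      · exact fun hw => ⟨⟨⟨hw.2 _, hw.1⟩, hw.2 _⟩, hw.2 _⟩
    rw [hset] at hL
    rcases hk i' with e | e | e
    · have : j' = j := by have := hk j'; grind
      exact e ▸ this ▸ hL
    · have : j' = i := by have := hk j'; grind
      exact (e ▸ this ▸ hL).symm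
    · exact absurd e hi'
  obtain ⟨c, d, hc, hcd, hd⟩ := hL
  rw [h.glue, h.glue]
  exact ⟨ψ c, ψ d, (h.adj_ψ _ (h.symm.b_ne i) _ hcd.left_mem.1).2 hc,
    hcd.map ψ (fun u hu v hv => (h.adj_ψ u hu.1 v hv.1).2) (h.ψ_inj.mono fun w hw => hw.1),
    (h.adj_ψ _ hcd.right_mem.1 _ (h.symm.b_ne j)).2 hd⟩

/-- A cycle of `B` that avoids only a set `R` not containing `y` extends to a cycle of `Z` that
avoids only the image of `R`: its passage through `y` is replaced by a link through `H`. -/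
lemma spanCycle_compl (h : IsGluing B y b H x t Z φ ψ) (hH : ∀ k, SpanCycle H {t k}ᶜ)
    {R : Set U} (hy : y ∉ R) (hB : SpanCycle B Rᶜ) : SpanCycle Z (φ '' R)ᶜ := by
  obtain ⟨p, q, hpq, hp, hq, hP⟩ := hB.exists_path_sdiff hy
  obtain ⟨i, rfl⟩ := (h.adj_y p).1 hp
  obtain ⟨j, rfl⟩ := (h.adj_y q).1 hq
  have hij : i ≠ j := fun e => hpq (e ▸ rfl)
  obtain ⟨c, d, hc, hcd, hd⟩ := h.link hH hij.symm
  have hQ := hP.map (H := Z) φ (fun u hu v hv => (h.adj_φ u hu.2 v hv.2).2)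
    (h.φ_inj.mono fun w hw => hw.2)
  have hsep : ∀ u, u ≠ y → ∀ w ∈ {w | w ≠ x ∧ ∀ k, w ≠ t k}, φ u ≠ ψ w := by
    intro u hu w hw e
    obtain ⟨k, -, h2⟩ := h.meet u hu w hw.1 e
    exact hw.2 k h2
  have hdisj : Disjoint (φ '' (Rᶜ \ {y})) (ψ '' {w | w ≠ x ∧ ∀ k, w ≠ t k}) := by
    rw [Set.disjoint_left]
    rintro _ ⟨u, hu, rfl⟩ ⟨w, hw, e⟩
    exact hsep u hu.2 w hw e.symm
  have hset : φ '' (Rᶜ \ {y}) ∪ ψ '' {w | w ≠ x ∧ ∀ k, w ≠ t k} = (φ '' R)ᶜ := by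
    ext v
    constructor
    · rintro (⟨u, hu, rfl⟩ | ⟨w, hw, rfl⟩)
      · rintro ⟨u', hu', e⟩
        exact hu.1 (h.φ_inj (show u' ≠ y from fun e => hy (e ▸ hu')) hu.2 e ▸ hu')
      · rintro ⟨u', hu', e⟩
        exact hsep u' (fun e => hy (e ▸ hu')) w hw e
    · intro hv
      have hφ : ∀ u, u ≠ y → φ u = v → v ∈ φ '' (Rᶜ \ {y}) := fun u hu e =>
        ⟨u, ⟨fun hR => hv ⟨u, hR, e⟩, hu⟩, e⟩
      rcases h.cover v with ⟨u, hu, e⟩ | ⟨w, hw, e⟩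
      · exact Or.inl (hφ u hu e)
      · by_cases hk : ∃ k, w = t k
        · obtain ⟨k, rfl⟩ := hk
          exact Or.inl (hφ _ (h.b_ne k) ((h.glue k).trans e))
        · exact Or.inr ⟨w, ⟨hw, fun k hk' => hk ⟨k, hk'⟩⟩, e⟩
  have hC := hQ.append hc hcd hdisj
  rw [hset] at hC
  refine ⟨_, _, hC, hd, φ (b j), hset ▸ Or.inl hQ.right_mem, ?_, ?_⟩
  · exact fun e => hpq (h.φ_inj (h.b_ne j) (h.b_ne i) e).symm
  · intro e
    exact Set.disjoint_left.1 hdisj hQ.right_mem (e ▸ hcd.right_mem)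

/-- If a hamiltonian cycle of `Z` is cut by the three identified vertices into links of which two
lie in the `B`-part and the third in the `H`-part, then the first two and `y` form a hamiltonian
cycle of `B`. -/
lemma spanCycle_univ_of_links (h : IsGluing B y b H x t Z φ ψ) {i j k : Fin 3}
    (hijk : ∀ l, l = i ∨ l = j ∨ l = k) (hij : i ≠ j) (hik : i ≠ k) (hjk : j ≠ k)
    {S₁ S₂ : Set V} (h₁ : Link Z (φ (b i)) (φ (b j)) S₁) (h₂ : Link Z (φ (b j)) (φ (b k)) S₂)
    (hd : Disjoint S₁ S₂) (hS : S₁ ∪ S₂ = φ '' {u | u ≠ y ∧ ∀ k, u ≠ b k}) :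
    SpanCycle B Set.univ := by
  obtain ⟨c, d, hc, hcd, hd1⟩ := h₁
  obtain ⟨e, f, he, hef, hf⟩ := h₂
  have hnot : ∀ l, φ (b l) ∉ S₁ ∪ S₂ := by
    rw [hS]
    rintro l ⟨u, hu, hul⟩
    exact hu.2 l (h.φ_inj hu.1 (h.b_ne l) hul)
  have hne : ∀ {l m}, l ≠ m → φ (b l) ≠ φ (b m) := fun hlm e =>
    hlm (h.b_inj (h.φ_inj (h.b_ne _) (h.b_ne _) e))
  have hP := ((hcd.snoc hd1 (fun hm => hnot j (Or.inl hm))).append he hef (by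
    rw [Set.disjoint_insert_left]; exact ⟨fun hm => hnot j (Or.inr hm), hd⟩)).snoc hf (by
      rintro ((hm | hm) | hm)
      · exact hne hjk.symm hm
      · exact hnot k (Or.inl hm)
      · exact hnot k (Or.inr hm))
  have hP := SpanPath.cons hc (by
    rintro (hm | (hm | hm) | hm)
    · exact hne hik hm
    · exact hne hij hm
    · exact hnot i (Or.inl hm)
    · exact hnot i (Or.inr hm)) hP
  have hset : insert (φ (b i)) (insert (φ (b k)) (insert (φ (b j)) S₁ ∪ S₂)) = φ '' {y}ᶜ := by
    rw [Set.insert_union, hS]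
    ext v
    constructor
    · rintro (rfl | rfl | rfl | ⟨u, hu, rfl⟩)
      exacts [⟨_, h.b_ne i, rfl⟩, ⟨_, h.b_ne k, rfl⟩, ⟨_, h.b_ne j, rfl⟩, ⟨u, hu.1, rfl⟩]
    · rintro ⟨u, hu, rfl⟩
      by_cases hk : ∃ l, u = b l
      · obtain ⟨l, rfl⟩ := hk
        rcases hijk l with rfl | rfl | rfl <;> simp
      · exact Or.inr (Or.inr (Or.inr ⟨u, ⟨hu, fun l hl => hk ⟨l, hl⟩⟩, rfl⟩))
  rw [hset] at hP
  obtain ⟨u, hu, v, hv, hui, hvk, hQ⟩ := hP.comap (H := B) (f := φ) le_rfl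
    (fun u hu v hv => (h.adj_φ u hu v hv).1) h.φ_inj
  obtain rfl := h.φ_inj hu (h.b_ne i) hui
  obtain rfl := h.φ_inj hv (h.b_ne k) hvk
  rw [Set.inter_eq_left.2 (Set.subset_preimage_image φ _)] at hQ
  have hy := SpanPath.cons ((h.adj_y _).2 ⟨i, rfl⟩) (by simp) hQ
  rw [Set.insert_eq, Set.union_compl_self] at hy
  exact ⟨_, _, hy, ((h.adj_y _).2 ⟨k, rfl⟩).symm, b j, trivial, h.b_ne j,
    fun e => hjk (h.b_inj e)⟩

/-- The three identified vertices cut a hamiltonian cycle of `Z` into three links, each of which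
stays in one of the two parts. Both parts occur, so two links lie in one part, which yields a
hamiltonian cycle of `B` or of `H`. -/
lemma not_spanCycle_univ (h : IsGluing B y b H x t Z φ ψ) (hB : IsGood B) (hH : IsGood H) :
    ¬ SpanCycle Z Set.univ := by
  intro hZ
  have hne : ∀ {l m}, l ≠ m → φ (b l) ≠ φ (b m) := fun hlm e =>
    hlm (h.b_inj (h.φ_inj (h.b_ne _) (h.b_ne _) e))
  have hind : ∀ l m, ¬ Z.Adj (φ (b l)) (φ (b m)) := fun l m e =>
    h.b_indep l m ((h.adj_φ _ (h.b_ne l) _ (h.b_ne m)).1 e)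
  set A : Set V := φ '' {u | u ≠ y ∧ ∀ k, u ≠ b k} with hA
  set C : Set V := ψ '' {w | w ≠ x ∧ ∀ k, w ≠ t k} with hC
  have hdAC : Disjoint A C := by
    rw [Set.disjoint_left]
    rintro _ ⟨u, hu, rfl⟩ ⟨w, hw, e⟩
    obtain ⟨k, h1, -⟩ := h.meet u hu.1 w hw.1 e.symm
    exact hu.2 k h1
  have hnAC : ∀ u ∈ A, ∀ v ∈ C, ¬ Z.Adj u v := by
    rintro _ ⟨u, hu, rfl⟩ _ ⟨w, hw, rfl⟩ huw
    rcases h.adj_cases _ _ huw with ⟨u₁, u₂, hu₁, hu₂, -, e⟩ | ⟨w₁, w₂, hw₁, hw₂, e, -⟩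
    · obtain ⟨k, -, h2⟩ := h.meet _ hu₂ _ hw.1 e
      exact hw.2 k h2
    · obtain ⟨k, h1, -⟩ := h.meet _ hu.1 _ hw₁ e.symm
      exact hu.2 k h1
  have hAC : A ∪ C = Set.univ \ {φ (b 0), φ (b 1), φ (b 2)} := by
    ext v
    simp only [Set.mem_sdiff, Set.mem_univ, true_and, Set.mem_insert_iff, Set.mem_singleton_iff]
    constructor
    · rintro (⟨u, hu, rfl⟩ | ⟨w, hw, rfl⟩)
      · have : ∀ l, φ u ≠ φ (b l) := fun l e => hu.2 l (h.φ_inj hu.1 (h.b_ne l) e)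
        have h0 := this 0
        have h1 := this 1
        have h2 := this 2
        tauto
      · have : ∀ l, ψ w ≠ φ (b l) := fun l e => hw.2 l
          (h.ψ_inj hw.1 (h.symm.b_ne l) (e.trans (h.glue l)))
        have h0 := this 0
        have h1 := this 1
        have h2 := this 2
        tauto
    · intro hv
      have hv' : ∀ l, v ≠ φ (b l) := by intro l; fin_cases l <;> simp <;> tauto
      rcases h.cover v with ⟨u, hu, rfl⟩ | ⟨w, hw, rfl⟩
      · exact Or.inl ⟨u, ⟨hu, fun l e => hv' l (e ▸ rfl)⟩, rfl⟩
      · exact Or.inr ⟨w, ⟨hw, fun l e => hv' l (by rw [h.glue, e])⟩, rfl⟩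
  have hAne : A.Nonempty := by
    obtain ⟨c, d, -, hcd, -⟩ :=
      h.symm.link (i := 0) (j := 1) (fun k => hB.compl_vertex _) (by decide)
    exact ⟨c, hcd.left_mem⟩
  have hCne : C.Nonempty := by
    obtain ⟨c, d, -, hcd, -⟩ := h.link (i := 0) (j := 1) (fun k => hH.compl_vertex _) (by decide)
    exact ⟨c, hcd.left_mem⟩
  obtain ⟨S₁, S₂, S₃, h₁, h₂, h₃, d₁₂, d₁₃, d₂₃, hS⟩ := hZ.three_links (u := φ (b 0))
    (v := φ (b 1)) (w := φ (b 2)) trivial trivial trivial (hne (by decide)) (hne (by decide))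
    (hne (by decide)) (hind _ _) (hind _ _) (hind _ _)
  rw [← hAC] at hS
  have side : ∀ {u v S}, Link Z u v S → S ⊆ A ∪ C → S ⊆ A ∨ S ⊆ C := by
    rintro u v S ⟨c, d, -, hcd, -⟩ hSS
    exact hcd.subset_or_subset hSS hnAC
  have s₁ := side h₁ (hS ▸ fun z hz => Or.inl (Or.inl hz))
  have s₂ := side h₂ (hS ▸ fun z hz => Or.inl (Or.inr hz))
  have s₃ := side h₃ (hS ▸ fun z hz => Or.inr hz)
  -- two links in one part and one in the other make one of the two graphs hamiltonian
  have key : ∀ {i j k : Fin 3}, (∀ l, l = i ∨ l = j ∨ l = k) → i ≠ j → i ≠ k → j ≠ k →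
      ∀ {S S' S'' : Set V}, Link Z (φ (b i)) (φ (b j)) S → Link Z (φ (b j)) (φ (b k)) S' →
      Disjoint S S' → S ∪ S' ∪ S'' = A ∪ C →
      ¬ (S ⊆ A ∧ S' ⊆ A ∧ S'' ⊆ C) ∧ ¬ (S ⊆ C ∧ S' ⊆ C ∧ S'' ⊆ A) := by
    intro i j k hijk hij hik hjk S S' S'' l l' hd hu
    have hu' : ∀ z, (z ∈ S ∨ z ∈ S') ∨ z ∈ S'' ↔ z ∈ A ∨ z ∈ C := fun z => by
      have := Set.ext_iff.1 hu z; simpa using this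
    have hdis := Set.disjoint_left.1 hdAC
    constructor
    · rintro ⟨i1, i2, i3⟩
      refine hB.not_univ (h.spanCycle_univ_of_links hijk hij hik hjk l l' hd ?_)
      rw [← hA]
      ext z
      exact ⟨fun hz => hz.elim (fun hz => i1 hz) (fun hz => i2 hz),
        fun hz => ((hu' z).2 (Or.inl hz)).resolve_right fun hz' => hdis hz (i3 hz')⟩
    · rintro ⟨i1, i2, i3⟩
      rw [h.glue, h.glue] at l l'
      refine hH.not_univ (h.symm.spanCycle_univ_of_links hijk hij hik hjk l l' hd ?_)
      rw [← hC]
      ext z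
      exact ⟨fun hz => hz.elim (fun hz => i1 hz) (fun hz => i2 hz),
        fun hz => ((hu' z).2 (Or.inr hz)).resolve_right fun hz' => hdis (i3 hz') hz⟩
  have k₁ := key (by decide) (by decide) (by decide) (by decide) h₁ h₂ d₁₂ hS
  have k₂ := key (by decide) (by decide) (by decide) (by decide) h₂ h₃ d₂₃
    (S'' := S₁) (by rw [← hS]; ac_rfl)
  have k₃ := key (by decide) (by decide) (by decide) (by decide) h₃ h₁ d₁₃.symm
    (S'' := S₂) (by rw [← hS]; ac_rfl)
  have hnotA : ¬ (S₁ ⊆ A ∧ S₂ ⊆ A ∧ S₃ ⊆ A) := by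
    rintro ⟨i1, i2, i3⟩
    obtain ⟨z, hz⟩ := hCne
    refine Set.disjoint_left.1 hdAC ?_ hz
    rcases hS.ge (Or.inr hz) with (hz | hz) | hz
    exacts [i1 hz, i2 hz, i3 hz]
  have hnotC : ¬ (S₁ ⊆ C ∧ S₂ ⊆ C ∧ S₃ ⊆ C) := by
    rintro ⟨i1, i2, i3⟩
    obtain ⟨z, hz⟩ := hAne
    refine Set.disjoint_left.1 hdAC hz ?_
    rcases hS.ge (Or.inl hz) with (hz | hz) | hz
    exacts [i1 hz, i2 hz, i3 hz]
  rcases s₁ with a₁ | a₁ <;> rcases s₂ with a₂ | a₂ <;> rcases s₃ with a₃ | a₃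
  exacts [hnotA ⟨a₁, a₂, a₃⟩, k₁.1 ⟨a₁, a₂, a₃⟩, k₃.1 ⟨a₃, a₁, a₂⟩, k₂.2 ⟨a₂, a₃, a₁⟩,
    k₂.1 ⟨a₂, a₃, a₁⟩, k₃.2 ⟨a₃, a₁, a₂⟩, k₁.2 ⟨a₁, a₂, a₃⟩, hnotC ⟨a₁, a₂, a₃⟩]

/-- Gluing at cubic vertices preserves the property of being both hypohamiltonian and
`K₂`-hamiltonian. -/
theorem isGood (h : IsGluing B y b H x t Z φ ψ) (hB : IsGood B) (hH : IsGood H) : IsGood Z where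
  not_univ := h.not_spanCycle_univ hB hH
  compl_vertex v := by
    rcases h.cover v with ⟨u, hu, rfl⟩ | ⟨w, hw, rfl⟩
    · simpa using h.spanCycle_compl (fun k => hH.compl_vertex _) (R := {u}) hu.symm
        (hB.compl_vertex u)
    · simpa using h.symm.spanCycle_compl (fun k => hB.compl_vertex _) (R := {w}) hw.symm
        (hH.compl_vertex w)
  compl_edge v v' hv := by
    rcases h.adj_cases v v' hv with ⟨u, u', hu, hu', rfl, rfl⟩ | ⟨w, w', hw, hw', rfl, rfl⟩
    · have := h.spanCycle_compl (fun k => hH.compl_vertex _) (R := {u, u'})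
        (by simp [hu.symm, hu'.symm]) (hB.compl_edge u u' ((h.adj_φ u hu u' hu').1 hv))
      rwa [Set.image_pair] at this
    · have := h.symm.spanCycle_compl (fun k => hB.compl_vertex _) (R := {w, w'})
        (by simp [hw.symm, hw'.symm]) (hH.compl_edge w w' ((h.adj_ψ w hw w' hw').1 hv))
      rwa [Set.image_pair] at this

end IsGluing

/-! ### A two-sided form of Grinberg's criterion -/

/-- The incidence number modulo 2 of `x` with the pair `p`, `q`. -/
def bd (p q x : ℕ) : ZMod 2 := (if p = x then 1 else 0) + (if q = x then 1 else 0)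

/-- A connected plane graph with vertices `0, …, n - 1`, faces `0, …, N - 1` and edges in `E`, in
purely combinatorial terms. Every edge has two ends and two faces. The boundary of a face is even
at each vertex, and the edges split into a spanning tree of the graph (`treeEdge v` joins `v` to a
smaller vertex) and a spanning tree of the dual (`dualEdge f` joins `f` to a smaller face). -/
structure PlaneMap (n N : ℕ) (E : Type*) [Fintype E] where
  src : E → ℕ
  tgt : E → ℕ
  lf : E → ℕ
  rt : E → ℕ
  treeEdge : ℕ → E
  dualEdge : ℕ → E
  src_lt : ∀ e, src e < n
  tgt_lt : ∀ e, tgt e < n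
  lf_lt : ∀ e, lf e < N
  rt_lt : ∀ e, rt e < N
  treeEdge_spec : ∀ v, 0 < v → v < n → tgt (treeEdge v) = v ∧ src (treeEdge v) < v
  dualEdge_spec : ∀ f, 0 < f → f < N → rt (dualEdge f) = f ∧ lf (dualEdge f) < f
  tree_or_dual : ∀ e, (∃ v, 0 < v ∧ v < n ∧ e = treeEdge v) ∨ ∃ f, 0 < f ∧ f < N ∧ e = dualEdge f
  face_even : ∀ f v, ∑ e, bd (lf e) (rt e) f * bd (src e) (tgt e) v = 0

namespace PlaneMap

variable {n N : ℕ} {E : Type*} [Fintype E] (M : PlaneMap n N E)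

lemma dual_connected {α : Type*} (χ : ℕ → α) (h : ∀ e, χ (M.lf e) = χ (M.rt e)) {f : ℕ}
    (hf : f < N) : χ f = χ 0 := by
  induction f using Nat.strong_induction_on with
  | _ f ih =>
    rcases Nat.eq_zero_or_pos f with rfl | h0
    · rfl
    · obtain ⟨h1, h2⟩ := M.dualEdge_spec f h0 hf
      rw [← h1, ← h, ih _ h2 (h2.trans hf)]

/-- Sums of face boundaries are even. -/
lemma even_coboundary (χ : ℕ → ZMod 2) (v : ℕ) :
    ∑ e, (χ (M.lf e) + χ (M.rt e)) * bd (M.src e) (M.tgt e) v = 0 := by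
  have h : ∀ e, (χ (M.lf e) + χ (M.rt e)) =
      ∑ f ∈ Finset.range N, χ f * bd (M.lf e) (M.rt e) f := by
    intro e
    simp [bd, mul_add, Finset.sum_add_distrib, M.lf_lt e, M.rt_lt e]
  simp_rw [h, Finset.sum_mul]
  rw [Finset.sum_comm]
  refine Finset.sum_eq_zero fun f _ => ?_
  simp_rw [mul_assoc]
  rw [← Finset.mul_sum, M.face_even, mul_zero]

/-- The potential on the faces obtained by integrating `g` along the dual tree. -/
noncomputable def potential (g : E → ZMod 2) (f : ℕ) : ZMod 2 :=
  if _h : 0 < f ∧ f < N then potential g (M.lf (M.dualEdge f)) + g (M.dualEdge f) else 0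
termination_by f
decreasing_by exact (M.dualEdge_spec f _h.1 _h.2).2

/-- Planarity in the form of Jordan's curve theorem: an even set of edges separates two classes of
faces. -/
lemma exists_coloring (g : E → ZMod 2)
    (hg : ∀ v, ∑ e, g e * bd (M.src e) (M.tgt e) v = 0) :
    ∃ χ : ℕ → ZMod 2, ∀ e, g e = χ (M.lf e) + χ (M.rt e) := by
  classical
  refine ⟨M.potential g, ?_⟩
  set χ := M.potential g
  set h : E → ZMod 2 := fun e => g e + (χ (M.lf e) + χ (M.rt e)) with hh
  have hev : ∀ v, ∑ e, h e * bd (M.src e) (M.tgt e) v = 0 := by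
    intro v
    simp_rw [hh, add_mul (g _), Finset.sum_add_distrib, hg, M.even_coboundary, add_zero]
  have hdual : ∀ f, 0 < f → f < N → h (M.dualEdge f) = 0 := by
    intro f h0 hf
    have h1 : χ f = χ (M.lf (M.dualEdge f)) + g (M.dualEdge f) := by
      simp only [χ]
      rw [potential, dif_pos ⟨h0, hf⟩]
    simp only [hh]
    rw [(M.dualEdge_spec f h0 hf).1, h1]
    generalize g _ = a
    generalize χ _ = b
    revert a b; decide
  -- an even set of edges inside the spanning tree is empty: peel off the largest vertex
  have htree : ∀ k v, 0 < v → v < n → n - v ≤ k → h (M.treeEdge v) = 0 := by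
    intro k
    induction k with
    | zero => intro v _ h1 h2; omega
    | succ k ih =>
      intro v h0 hv hk
      have := hev v
      rw [Finset.sum_eq_single (M.treeEdge v)] at this
      · obtain ⟨h1, h2⟩ := M.treeEdge_spec v h0 hv
        simpa [bd, h1, h2.ne] using this
      · intro e _ hne
        rcases M.tree_or_dual e with ⟨w, hw0, hw, rfl⟩ | ⟨f, hf0, hf, rfl⟩
        · obtain ⟨h1, h2⟩ := M.treeEdge_spec w hw0 hw
          by_cases hwv : v < w
          · rw [ih w hw0 hw (by omega), zero_mul]
          · have hwv' : w ≠ v := fun e => hne (e ▸ rfl)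
            simp [bd, h1, hwv', show M.src (M.treeEdge w) ≠ v by omega]
        · rw [hdual f hf0 hf, zero_mul]
      · simp
  intro e
  have he : h e = 0 := by
    rcases M.tree_or_dual e with ⟨w, hw0, hw, rfl⟩ | ⟨f, hf0, hf, rfl⟩
    · exact htree _ w hw0 hw le_rfl
    · exact hdual f hf0 hf
  simp only [hh] at he
  generalize g e = a at *
  generalize χ _ = b at *
  generalize χ _ = c at *
  revert a b c; decide

/-- The edge set `C` of a hamiltonian cycle: all degrees are 2, and the only even subsets are the
empty set and `C` itself. -/
structure IsHamCycle (C : Finset E) : Prop where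
  degree : ∀ v < n, (C.filter fun e => M.src e = v).card + (C.filter fun e => M.tgt e = v).card = 2
  minimal : ∀ g : E → ZMod 2, (∀ e ∉ C, g e = 0) →
    (∀ v, ∑ e, g e * bd (M.src e) (M.tgt e) v = 0) → (∀ e, g e = 0) ∨ ∀ e ∈ C, g e = 1

variable {M} {C : Finset E}

/-- A colouring of the faces by the two sides of the cycle `C`. -/
def IsColoring (M : PlaneMap n N E) (C : Finset E) (χ : ℕ → ZMod 2) : Prop :=
  ∀ e, e ∈ C ↔ χ (M.lf e) ≠ χ (M.rt e)

lemma IsHamCycle.exists_isColoring (hC : M.IsHamCycle C) : ∃ χ, M.IsColoring C χ := by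
  classical
  obtain ⟨χ, hχ⟩ := M.exists_coloring (fun e => if e ∈ C then 1 else 0) fun v => by
    by_cases hv : v < n
    · have h2 := congrArg (Nat.cast : ℕ → ZMod 2) (hC.degree v hv)
      simp_rw [ite_mul, one_mul, zero_mul]
      rw [Finset.sum_ite_mem, Finset.univ_inter]
      simp only [bd, Finset.sum_add_distrib, Finset.sum_boole]
      push_cast at h2
      exact h2.trans (by decide)
    · refine Finset.sum_eq_zero fun e _ => ?_
      have h1 := M.src_lt e
      have h2 := M.tgt_lt e
      simp [bd, show M.src e ≠ v by omega, show M.tgt e ≠ v by omega]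
  refine ⟨χ, fun e => ?_⟩
  have := hχ e
  by_cases he : e ∈ C <;> simp only [he, if_true, if_false, true_iff, false_iff] at this ⊢
  all_goals
    generalize χ _ = b at *
    generalize χ _ = c at *
    revert b c; decide

/-- The faces of one colour are connected through the edges off the cycle. -/
lemma IsHamCycle.exists_crossing (hC : M.IsHamCycle C) {χ : ℕ → ZMod 2} (hχ : M.IsColoring C χ)
    {c : ZMod 2} {X : Finset ℕ} (hX : X ⊆ (Finset.range N).filter fun f => χ f = c)
    (hne : X.Nonempty) {f₀ : ℕ} (hf₀ : f₀ < N) (hf₀c : χ f₀ = c) (hf₀X : f₀ ∉ X) :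
    ∃ e ∉ C, (M.lf e ∈ X ∧ M.rt e ∉ X) ∨ (M.lf e ∉ X ∧ M.rt e ∈ X) := by
  classical
  by_contra! hcon
  obtain ⟨f₁, hf₁⟩ := hne
  have hf₁' := Finset.mem_filter.1 (hX hf₁)
  have hcol : ∀ f ∈ X, χ f = c := fun f hf => (Finset.mem_filter.1 (hX hf)).2
  let ind : Finset ℕ → ℕ → ZMod 2 := fun Y f => if f ∈ Y then 1 else 0
  have hind : ∀ Y : Finset ℕ, (∀ e, ind Y (M.lf e) = ind Y (M.rt e)) → ∀ f < N, ∀ f' < N,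
      f ∈ Y → f' ∈ Y := by
    intro Y hY f hf f' hf' hfY
    have h1 := M.dual_connected (ind Y) hY hf
    have h2 := M.dual_connected (ind Y) hY hf'
    by_contra h3
    have h4 := h1.trans h2.symm
    simp [ind, hfY, h3] at h4
  have hcon' : ∀ e ∉ C, (M.lf e ∈ X ↔ M.rt e ∈ X) := by
    intro e he
    have := hcon e he
    tauto
  rcases hC.minimal (fun e => ind X (M.lf e) + ind X (M.rt e))
    (fun e he => by
      have := hcon' e he
      by_cases h1 : M.lf e ∈ X
      · simp [ind, h1, this.1 h1]; decide
      · simp [ind, h1, show M.rt e ∉ X from fun h => h1 (this.2 h)])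
    (M.even_coboundary _) with h0 | h1
  · refine hf₀X (hind X (fun e => ?_) f₁ (Finset.mem_range.1 hf₁'.1) f₀ hf₀ hf₁)
    have := h0 e
    generalize ind X _ = a at *
    generalize ind X _ = b at *
    revert a b; decide
  -- now the complement of `X` in its colour class has empty boundary
  · set Y := ((Finset.range N).filter fun f => χ f = c) \ X with hY
    have hmemY : ∀ f < N, f ∈ Y ↔ χ f = c ∧ f ∉ X := by
      intro f hf; simp [hY, hf]
    have := hind Y (fun e => ?_) f₀ hf₀ f₁ (Finset.mem_range.1 hf₁'.1)
      ((hmemY _ hf₀).2 ⟨hf₀c, hf₀X⟩)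
    · exact ((hmemY _ (Finset.mem_range.1 hf₁'.1)).1 this).2 hf₁
    · have hl := hmemY _ (M.lf_lt e)
      have hr := hmemY _ (M.rt_lt e)
      have hcl := hcol (M.lf e)
      have hcr := hcol (M.rt e)
      suffices M.lf e ∈ Y ↔ M.rt e ∈ Y by simp [ind, this]
      rw [hl, hr]
      by_cases he : e ∈ C
      · have h2 := h1 e he
        have h3 := (hχ e).1 he
        by_cases hlX : M.lf e ∈ X
        · have h4 := hcl hlX
          rw [h4] at h3
          simp [hlX, h3.symm]
        · by_cases hrX : M.rt e ∈ X
          · have h4 := hcr hrX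
            rw [h4] at h3
            simp [hrX, h3]
          · simp [ind, hlX, hrX] at h2
      · have h3 : χ (M.lf e) = χ (M.rt e) := not_not.1 fun h => he ((hχ e).2 h)
        rw [h3, hcon' e he]

/-- A proper set `X` of faces of one colour meets at least `|X|` edges off the cycle. -/
lemma IsHamCycle.card_le (hC : M.IsHamCycle C) [DecidableEq E] {χ : ℕ → ZMod 2}
    (hχ : M.IsColoring C χ)
    {c : ZMod 2} {X : Finset ℕ} (hX : X ⊆ (Finset.range N).filter fun f => χ f = c)
    {f₀ : ℕ} (hf₀ : f₀ < N) (hf₀c : χ f₀ = c) (hf₀X : f₀ ∉ X) :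
    X.card ≤ ((Finset.univ \ C).filter fun e => M.lf e ∈ X ∨ M.rt e ∈ X).card := by
  induction hk : X.card generalizing X with
  | zero => exact Nat.zero_le _
  | succ k ih =>
    obtain ⟨e, heC, he⟩ := hC.exists_crossing hχ hX (Finset.card_pos.1 (by omega)) hf₀ hf₀c hf₀X
    obtain ⟨f, hfX, hf⟩ : ∃ f ∈ X, M.lf e ∉ X.erase f ∧ M.rt e ∉ X.erase f := by
      rcases he with ⟨h1, h2⟩ | ⟨h1, h2⟩
      · exact ⟨_, h1, by simp, by simp [h2]⟩
      · exact ⟨_, h2, by simp [h1], by simp⟩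
    have h1 := ih (X := X.erase f) ((Finset.erase_subset _ _).trans hX)
      (fun h => hf₀X (Finset.mem_of_mem_erase h)) (by rw [Finset.card_erase_of_mem hfX]; omega)
    have h2 : ((Finset.univ \ C).filter fun e => M.lf e ∈ X.erase f ∨ M.rt e ∈ X.erase f) ⊂
        (Finset.univ \ C).filter fun e => M.lf e ∈ X ∨ M.rt e ∈ X := by
      rw [Finset.ssubset_iff_of_subset]
      · refine ⟨e, ?_, ?_⟩
        · simp only [Finset.mem_filter, Finset.mem_sdiff, Finset.mem_univ, true_and]
          exact ⟨heC, he.elim (fun h => Or.inl h.1) (fun h => Or.inr h.2)⟩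
        · simp only [Finset.mem_filter, not_and, not_or]
          exact fun _ => hf
      · intro e he
        rw [Finset.mem_filter] at he ⊢
        exact ⟨he.1, he.2.imp Finset.mem_of_mem_erase Finset.mem_of_mem_erase⟩
    have := Finset.card_lt_card h2
    omega

end PlaneMap

namespace PlaneMap

variable {n N : ℕ} {E : Type*} [Fintype E]

/-- A splitting of a plane graph along a cut of six edges `cut i`. The vertices are divided by
`vside`; the six faces `ring i` are those met by the cut, `cut i` lying between `ring i` and
`ring (i + 1)`, and every other face lies on one side and has length 2 modulo 3. The residue
`weight s i` counts the edges that the face `ring i` has on the side `s`. -/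
structure TwoSided (M : PlaneMap n N E) where
  vside : ℕ → Bool
  fside : ℕ → Option Bool
  cut : Fin 6 → E
  ring : Fin 6 → ℕ
  weight : Bool → Fin 6 → ZMod 3
  cut_inj : Function.Injective cut
  ring_inj : Function.Injective ring
  ring_lt : ∀ i, ring i < N
  mem_cut : ∀ e, vside (M.src e) ≠ vside (M.tgt e) ↔ ∃ i, e = cut i
  mem_ring : ∀ f < N, fside f = none ↔ ∃ i, f = ring i
  cut_faces : ∀ i, (M.lf (cut i) = ring i ∧ M.rt (cut i) = ring (i + 1)) ∨
    (M.lf (cut i) = ring (i + 1) ∧ M.rt (cut i) = ring i)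
  lf_inner : ∀ e s, fside (M.lf e) = some s → vside (M.src e) = s ∧ vside (M.tgt e) = s
  rt_inner : ∀ e s, fside (M.rt e) = some s → vside (M.src e) = s ∧ vside (M.tgt e) = s
  length_inner : ∀ f < N, fside f ≠ none →
    ∑ e, ((if M.lf e = f then 1 else 0) + (if M.rt e = f then 1 else 0) : ZMod 3) = 2
  length_ring : ∀ s i, ∑ e with vside (M.src e) = s ∧ vside (M.tgt e) = s,
    ((if M.lf e = ring i then 1 else 0) + (if M.rt e = ring i then 1 else 0) : ZMod 3) = weight s i
  euler : n + N = Fintype.card E + 2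
  euler_side : (Finset.univ.filter fun e => vside (M.src e) = false ∧ vside (M.tgt e) = false).card
    + 1 = ((Finset.range n).filter fun v => vside v = false).card +
      ((Finset.range N).filter fun f => fside f = some false).card

/-- The sign of a face colour. -/
def colorSign (c : ZMod 2) : ZMod 3 := if c = 0 then 1 else -1

lemma sum_colorSign {ι : Type*} (S : Finset ι) (h : ι → ZMod 2) :
    ∑ a ∈ S, colorSign (h a) =
      ((S.filter fun a => h a = 0).card : ZMod 3) - (S.filter fun a => h a = 1).card := by
  rw [Finset.card_filter, Finset.card_filter]
  push_cast
  rw [← Finset.sum_sub_distrib]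
  refine Finset.sum_congr rfl fun a _ => ?_
  generalize h a = c
  revert c; decide

variable {M : PlaneMap n N E} {C : Finset E}

namespace TwoSided

variable (T : M.TwoSided)

lemma filter_ring : ((Finset.range N).filter fun f => T.fside f = none) =
    Finset.univ.image T.ring := by
  ext f
  simp only [Finset.mem_filter, Finset.mem_range, Finset.mem_image, Finset.mem_univ, true_and]
  constructor
  · rintro ⟨h1, h2⟩
    obtain ⟨i, rfl⟩ := (T.mem_ring f h1).1 h2
    exact ⟨i, rfl⟩
  · rintro ⟨i, rfl⟩
    exact ⟨T.ring_lt i, (T.mem_ring _ (T.ring_lt i)).2 ⟨i, rfl⟩⟩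

lemma card_cycle_vertices (hC : M.IsHamCycle C) (p : ℕ → Prop) [DecidablePred p] :
    2 * ((Finset.range n).filter p).card =
      ∑ e ∈ C, ((if p (M.src e) then 1 else 0) + if p (M.tgt e) then 1 else 0) := by
  have h : ∀ v ∈ (Finset.range n).filter p,
      ∑ e ∈ C, ((if M.src e = v then 1 else 0) + if M.tgt e = v then 1 else 0) = 2 := by
    intro v hv
    rw [← hC.degree v (Finset.mem_range.1 (Finset.mem_filter.1 hv).1), Finset.card_filter,
      Finset.card_filter, Finset.sum_add_distrib]
  rw [mul_comm, ← smul_eq_mul, ← Finset.sum_const, ← Finset.sum_congr rfl h, Finset.sum_comm]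
  refine Finset.sum_congr rfl fun e _ => ?_
  simp [Finset.sum_add_distrib, M.src_lt e, M.tgt_lt e]

lemma card_ring (p : ℕ → Prop) [DecidablePred p] :
    ((Finset.range N).filter fun f => T.fside f = none ∧ p f).card =
      (Finset.univ.filter fun i => p (T.ring i)).card := by
  rw [← Finset.filter_filter, T.filter_ring, Finset.filter_image,
    Finset.card_image_of_injective _ T.ring_inj]

/-- The number of faces of colour `c` strictly on side `s`. -/
def numFaces (χ : ℕ → ZMod 2) (s : Bool) (c : ZMod 2) : ℕ :=
  ((Finset.range N).filter fun f => T.fside f = some s ∧ χ f = c).card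

lemma card_class (χ : ℕ → ZMod 2) (c : ZMod 2) :
    ((Finset.range N).filter fun f => χ f = c).card = T.numFaces χ false c + T.numFaces χ true c +
      (Finset.univ.filter fun i => χ (T.ring i) = c).card := by
  rw [← T.card_ring (fun f => χ f = c)]
  simp only [numFaces, Finset.card_filter, ← Finset.sum_add_distrib]
  refine Finset.sum_congr rfl fun f _ => ?_
  rcases T.fside f with _ | _ | _ <;> simp

variable [DecidableEq E]

/-- The edges with both ends on the side `s`. -/
def edgesOf (s : Bool) : Finset E :=
  Finset.univ.filter fun e => T.vside (M.src e) = s ∧ T.vside (M.tgt e) = s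

/-- The number of edges on side `s`, off the cycle, between two faces of colour `c`. -/
def numEdges (C : Finset E) (χ : ℕ → ZMod 2) (s : Bool) (c : ZMod 2) : ℕ :=
  ((T.edgesOf s \ C).filter fun e => χ (M.lf e) = c).card

lemma card_cut (p : E → Prop) [DecidablePred p] :
    (Finset.univ.filter fun e => T.vside (M.src e) ≠ T.vside (M.tgt e) ∧ p e).card =
      (Finset.univ.filter fun i => p (T.cut i)).card := by
  rw [← Finset.card_image_of_injective _ T.cut_inj]
  congr 1
  ext e
  simp only [Finset.mem_filter, Finset.mem_univ, true_and, Finset.mem_image, T.mem_cut]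
  constructor
  · rintro ⟨⟨i, rfl⟩, h⟩; exact ⟨i, h, rfl⟩
  · rintro ⟨i, h, rfl⟩; exact ⟨⟨i, rfl⟩, h⟩

lemma card_edges_color (C : Finset E) (χ : ℕ → ZMod 2) (c : ZMod 2) :
    ((Finset.univ \ C).filter fun e => χ (M.lf e) = c).card =
      T.numEdges C χ false c + T.numEdges C χ true c +
      (Finset.univ.filter fun i => T.cut i ∉ C ∧ χ (M.lf (T.cut i)) = c).card := by
  rw [← T.card_cut (fun e => e ∉ C ∧ χ (M.lf e) = c)]
  have h : ∀ S : Finset E, S \ C = S.filter (· ∉ C) := fun S => by ext; simp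
  simp only [numEdges, edgesOf, h, Finset.filter_filter]
  simp only [Finset.card_filter, ← Finset.sum_add_distrib]
  refine Finset.sum_congr rfl fun e _ => ?_
  by_cases h1 : e ∈ C <;> rcases T.vside (M.src e) <;> rcases T.vside (M.tgt e) <;> simp [h1]

lemma numFaces_le (hC : M.IsHamCycle C) {χ : ℕ → ZMod 2} (hχ : M.IsColoring C χ) (s : Bool)
    {c : ZMod 2} (hc : ∃ i, χ (T.ring i) = c) : T.numFaces χ s c ≤ T.numEdges C χ s c := by
  obtain ⟨i, hi⟩ := hc
  have hin : ∀ f, f ∈ ((Finset.range N).filter fun f => T.fside f = some s ∧ χ f = c) ↔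
      f < N ∧ T.fside f = some s ∧ χ f = c := by simp
  refine (hC.card_le hχ (X := (Finset.range N).filter fun f => T.fside f = some s ∧ χ f = c)
    (fun f hf => ?_) (T.ring_lt i) hi ?_).trans (Finset.card_le_card ?_)
  · have := (hin f).1 hf
    simp [this]
  · intro h
    have h1 := ((hin _).1 h).2.1
    rw [(T.mem_ring _ (T.ring_lt i)).2 ⟨i, rfl⟩] at h1
    simp at h1
  · intro e he
    simp only [Finset.mem_filter, Finset.mem_sdiff, Finset.mem_univ, true_and, Finset.mem_range]
      at he
    have hcol : χ (M.lf e) = χ (M.rt e) := not_not.1 fun h => he.1 ((hχ e).2 h)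
    simp only [edgesOf, Finset.mem_filter, Finset.mem_sdiff, Finset.mem_univ, true_and]
    rcases he.2 with h | h
    · exact ⟨⟨T.lf_inner e s h.2.1, he.1⟩, h.2.2⟩
    · exact ⟨⟨T.rt_inner e s h.2.1, he.1⟩, hcol.trans h.2.2⟩

/-- Grinberg's count on one side of the cut. -/
lemma sum_weight {χ : ℕ → ZMod 2} (hχ : M.IsColoring C χ) (s : Bool) :
    ∑ i, colorSign (χ (T.ring i)) * T.weight s i =
      2 * ((T.numEdges C χ s 0 : ZMod 3) - T.numEdges C χ s 1) -
      2 * ((T.numFaces χ s 0 : ZMod 3) - T.numFaces χ s 1) := by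
  set w : ℕ → ZMod 3 := fun f => ∑ e ∈ T.edgesOf s,
    ((if M.lf e = f then 1 else 0) + (if M.rt e = f then 1 else 0) : ZMod 3) with hw
  have h1 : ∑ f ∈ Finset.range N, colorSign (χ f) * w f =
      2 * ((T.numEdges C χ s 0 : ZMod 3) - T.numEdges C χ s 1) := by
    simp_rw [hw, Finset.mul_sum]
    rw [Finset.sum_comm, numEdges, numEdges, ← sum_colorSign, Finset.mul_sum]
    have h2 : ∀ e, ∑ f ∈ Finset.range N, colorSign (χ f) *
        ((if M.lf e = f then 1 else 0) + (if M.rt e = f then 1 else 0) : ZMod 3) =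
        colorSign (χ (M.lf e)) + colorSign (χ (M.rt e)) := by
      intro e
      simp [mul_add, Finset.sum_add_distrib, M.lf_lt e, M.rt_lt e]
    simp_rw [h2]
    rw [← Finset.sum_subset (Finset.sdiff_subset (s := T.edgesOf s) (t := C))]
    · refine Finset.sum_congr rfl fun e he => ?_
      have : χ (M.lf e) = χ (M.rt e) :=
        not_not.1 fun h => (Finset.mem_sdiff.1 he).2 ((hχ e).2 h)
      rw [this, two_mul]
    · intro e he he'
      have := (hχ e).1 (by simpa [he] using he')
      generalize χ _ = a at *
      generalize χ _ = b at *
      revert a b; decide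
  have h3 : ∀ f ∈ Finset.range N, colorSign (χ f) * w f =
      (if T.fside f = some s then 2 * colorSign (χ f) else 0) +
      (if T.fside f = none then colorSign (χ f) * w f else 0) := by
    intro f hf
    have hf := Finset.mem_range.1 hf
    rcases hfs : T.fside f with _ | s'
    · simp
    · have hout : ∀ e, e ∉ T.edgesOf s' → M.lf e ≠ f ∧ M.rt e ≠ f := by
        intro e he
        constructor
        · rintro rfl; exact he (by simpa [edgesOf] using T.lf_inner e s' hfs)
        · rintro rfl; exact he (by simpa [edgesOf] using T.rt_inner e s' hfs)
      rcases eq_or_ne s' s with rfl | hs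
      · have h4 := T.length_inner f hf (by simp [hfs])
        have h5 : w f = 2 := by
          rw [← h4, hw]
          refine Finset.sum_subset (Finset.subset_univ _) fun e _ he => ?_
          simp [hout e he]
        simp [h5, mul_comm]
      · have h5 : w f = 0 := by
          rw [hw]
          refine Finset.sum_eq_zero fun e he => ?_
          have : e ∉ T.edgesOf s' := by
            simp only [edgesOf, Finset.mem_filter, Finset.mem_univ, true_and] at he ⊢
            rw [he.1]
            exact fun h => hs h.1.symm
          simp [hout e this]
        simp [h5, hs]
  rw [Finset.sum_congr rfl h3, Finset.sum_add_distrib, ← Finset.sum_filter, ← Finset.sum_filter,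
    T.filter_ring, Finset.sum_image (fun _ _ _ _ h => T.ring_inj h), ← Finset.mul_sum,
    sum_colorSign, Finset.filter_filter, Finset.filter_filter] at h1
  rw [← h1, numFaces, numFaces, add_sub_cancel_left]
  exact Finset.sum_congr rfl fun i _ => by rw [← T.length_ring s i, hw]; rfl

/-- The number of vertices on the side `false` in terms of the edges of the cycle. -/
lemma two_mul_card_side (hC : M.IsHamCycle C) {χ : ℕ → ZMod 2} (hχ : M.IsColoring C χ) :
    2 * ((Finset.range n).filter fun v => T.vside v = false).card =
      2 * (T.edgesOf false ∩ C).card +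
        (Finset.univ.filter fun i => χ (T.ring i) ≠ χ (T.ring (i + 1))).card := by
  have h : ∀ i, T.cut i ∈ C ↔ χ (T.ring i) ≠ χ (T.ring (i + 1)) := by
    intro i
    rw [hχ]
    rcases T.cut_faces i with ⟨h1, h2⟩ | ⟨h1, h2⟩ <;> rw [h1, h2]
    exact ne_comm
  rw [card_cycle_vertices hC]
  simp_rw [← h]
  rw [← T.card_cut (fun e => e ∈ C)]
  have h1 : T.edgesOf false ∩ C = C.filter fun e => T.vside (M.src e) = false ∧
      T.vside (M.tgt e) = false := by
    ext e; simp [edgesOf, and_comm]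
  have h2 : (Finset.univ.filter fun e => T.vside (M.src e) ≠ T.vside (M.tgt e) ∧ e ∈ C) =
      C.filter fun e => T.vside (M.src e) ≠ T.vside (M.tgt e) := by
    ext e; simp [and_comm]
  rw [h1, h2, Finset.card_filter, Finset.card_filter, Finset.mul_sum, ← Finset.sum_add_distrib]
  refine Finset.sum_congr rfl fun e _ => ?_
  rcases T.vside (M.src e) <;> rcases T.vside (M.tgt e) <;> simp

/-- The numbers `x`, `x'` of superfluous edges of either colour on the two sides: they are
complementary, and they determine both weighted sums of the face colours around the cut. -/
lemma exists_excess (hC : M.IsHamCycle C) {χ : ℕ → ZMod 2} (hχ : M.IsColoring C χ) :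
    ∃ x x' : ℕ,
      2 * (x + x' + 1) = (Finset.univ.filter fun i => χ (T.ring i) ≠ χ (T.ring (i + 1))).card ∧
      ∑ i, colorSign (χ (T.ring i)) * T.weight false i = 2 * ((x : ZMod 3) - x') ∧
      ∑ i, colorSign (χ (T.ring i)) * T.weight true i = 2 * ((x' : ZMod 3) - x) := by
  classical
  set K := (Finset.univ.filter fun i => χ (T.ring i) ≠ χ (T.ring (i + 1))).card with hK
  have h01 : ∀ c : ZMod 2, c ≠ 0 ↔ c = 1 := by decide
  -- the edges off the cycle form a spanning tree of each colour class
  have hcard : C.card = n := by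
    have h := card_cycle_vertices hC (fun _ => True)
    simp at h
    omega
  have hcls : ∀ c : ZMod 2, ((Finset.range N).filter fun f => χ f = c).card ≤
      ((Finset.univ \ C).filter fun e => χ (M.lf e) = c).card + 1 := by
    intro c
    rcases Finset.eq_empty_or_nonempty ((Finset.range N).filter fun f => χ f = c) with h | ⟨f, hf⟩
    · simp [h]
    · have hf' := Finset.mem_filter.1 hf
      have h1 := hC.card_le hχ (X := ((Finset.range N).filter fun f => χ f = c).erase f)
        (Finset.erase_subset _ _) (Finset.mem_range.1 hf'.1) hf'.2 (by simp)
      rw [Finset.card_erase_of_mem hf] at h1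
      refine Nat.sub_le_iff_le_add.1 (h1.trans (Finset.card_le_card ?_))
      intro e he
      simp only [Finset.mem_filter, Finset.mem_sdiff, Finset.mem_univ, true_and,
        Finset.mem_erase, Finset.mem_range] at he ⊢
      have hcol : χ (M.lf e) = χ (M.rt e) := not_not.1 fun h => he.1 ((hχ e).2 h)
      exact ⟨he.1, he.2.elim (fun h => h.2.2) (fun h => hcol.trans h.2.2)⟩
  have hN : ((Finset.range N).filter fun f => χ f = 0).card +
      ((Finset.range N).filter fun f => χ f = 1).card = N := by
    simp_rw [← h01]
    rw [Finset.card_filter_add_card_filter_not, Finset.card_range]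
  have hE : ((Finset.univ \ C).filter fun e => χ (M.lf e) = 0).card +
      ((Finset.univ \ C).filter fun e => χ (M.lf e) = 1).card + n = Fintype.card E := by
    simp_rw [← h01]
    rw [Finset.card_filter_add_card_filter_not, ← hcard, Finset.card_sdiff_add_card_eq_card
      (Finset.subset_univ _), Finset.card_univ]
  have heuler := T.euler
  have e0 := hcls 0
  have e1 := hcls 1
  -- the edges and faces of side `false`
  have hside := T.two_mul_card_side hC hχ
  have hE0 : (T.edgesOf false).card = (T.edgesOf false ∩ C).card +
      (T.numEdges C χ false 0 + T.numEdges C χ false 1) := by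
    simp_rw [numEdges, ← h01]
    rw [Finset.card_filter_add_card_filter_not, Finset.card_inter_add_card_sdiff]
  have hF0 : ((Finset.range N).filter fun f => T.fside f = some false).card =
      T.numFaces χ false 0 + T.numFaces χ false 1 := by
    simp_rw [numFaces, ← h01, ← Finset.filter_filter]
    rw [Finset.card_filter_add_card_filter_not]
  have hs := T.euler_side
  rw [hF0, show (Finset.univ.filter fun e => T.vside (M.src e) = false ∧
    T.vside (M.tgt e) = false) = T.edgesOf false from rfl, hE0] at hs
  -- the colours around the cut
  have hring : ∀ ε : Fin 6 → ZMod 2, ∀ c,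
      2 * (Finset.univ.filter fun i => ε i = c).card =
        2 * (Finset.univ.filter fun i => ε i = c ∧ ε (i + 1) = c).card +
        (Finset.univ.filter fun i => ε i ≠ ε (i + 1)).card := by
    decide +kernel
  have hcutc : ∀ c, (Finset.univ.filter fun i => T.cut i ∉ C ∧ χ (M.lf (T.cut i)) = c).card =
      (Finset.univ.filter fun i => χ (T.ring i) = c ∧ χ (T.ring (i + 1)) = c).card := by
    intro c
    congr 1
    ext i
    simp only [Finset.mem_filter, Finset.mem_univ, true_and, hχ (T.cut i), not_not]
    rcases T.cut_faces i with ⟨h1, h2⟩ | ⟨h1, h2⟩ <;> rw [h1, h2] <;>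
      constructor <;> rintro ⟨h3, h4⟩ <;> simp_all
  have hk : ∀ c, T.numFaces χ false c + T.numFaces χ true c + K / 2 =
      T.numEdges C χ false c + T.numEdges C χ true c + 1 ∧ 2 * (K / 2) = K := by
    intro c
    have g1 := T.card_class χ c
    have g2 := T.card_edges_color C χ c
    rw [hcutc] at g2
    have g3 := hring (fun i => χ (T.ring i)) c
    rw [← hK] at g3
    have : ((Finset.range N).filter fun f => χ f = c).card =
        ((Finset.univ \ C).filter fun e => χ (M.lf e) = c).card + 1 := by
      rcases (show ∀ c : ZMod 2, c = 0 ∨ c = 1 by decide) c with rfl | rfl <;> omega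
    omega
  have hle : ∀ s c, T.numFaces χ s c ≤ T.numEdges C χ s c := by
    intro s c
    by_cases hc : ∃ i, χ (T.ring i) = c
    · exact T.numFaces_le hC hχ s hc
    -- a cut that avoids the cycle is impossible
    · exfalso
      have hc' : ∀ i, χ (T.ring i) = χ (T.ring 0) := by
        intro i
        have h1 := not_exists.1 hc i
        have h2 := not_exists.1 hc 0
        generalize χ _ = a at *
        generalize χ _ = b at *
        clear hc
        revert a b c; decide
      have hK0 : K = 0 := Finset.card_eq_zero.2 <| Finset.filter_eq_empty_iff.2
        fun i _ h => h ((hc' i).trans (hc' (i + 1)).symm)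
      have g1 := (hk (χ (T.ring 0))).1
      have g2 := T.numFaces_le hC hχ false (c := χ (T.ring 0)) ⟨0, rfl⟩
      have g3 := T.numFaces_le hC hχ true (c := χ (T.ring 0)) ⟨0, rfl⟩
      omega
  obtain ⟨x, hx⟩ := Nat.exists_eq_add_of_le (hle false 0)
  obtain ⟨x', hx'⟩ := Nat.exists_eq_add_of_le (hle false 1)
  obtain ⟨z, hz⟩ := Nat.exists_eq_add_of_le (hle true 0)
  obtain ⟨z', hz'⟩ := Nat.exists_eq_add_of_le (hle true 1)
  have k0 := hk 0
  have k1 := hk 1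
  have q1 : x + x' + 1 = K / 2 := by omega
  have q2 : z = x' := by omega
  have q3 : z' = x := by omega
  subst q2 q3
  refine ⟨z', z, by omega, ?_, ?_⟩
  · rw [T.sum_weight hχ, hx, hx']; push_cast; ring
  · rw [T.sum_weight hχ, hz, hz']; push_cast; ring

/-- For a suitable pattern of weights the conditions on the colours around the cut cannot be met:
there is no hamiltonian cycle. -/
theorem not_isHamCycle (h0 : T.weight false = ![0, 0, 1, 2, 1, 0])
    (h1 : T.weight true = ![1, 1, 0, 1, 0, 1]) : ¬ M.IsHamCycle C := by
  intro hC
  obtain ⟨χ, hχ⟩ := hC.exists_isColoring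
  obtain ⟨x, x', hK, hs0, hs1⟩ := T.exists_excess hC hχ
  have hK6 : (Finset.univ.filter fun i => χ (T.ring i) ≠ χ (T.ring (i + 1))).card ≤ 6 :=
    (Finset.card_le_univ _).trans (by simp)
  have key : ∀ ε : Fin 6 → ZMod 2, ∀ x < 3, ∀ x' < 3,
      2 * (x + x' + 1) = (Finset.univ.filter fun i => ε i ≠ ε (i + 1)).card →
      ∑ i, colorSign (ε i) * ![0, 0, 1, 2, 1, 0] i = 2 * ((x : ZMod 3) - x') →
      ¬ ∑ i, colorSign (ε i) * ![1, 1, 0, 1, 0, 1] i = 2 * ((x' : ZMod 3) - x) := by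
    decide +kernel
  rw [h0] at hs0
  rw [h1] at hs1
  exact key (fun i => χ (T.ring i)) x (by omega) x' (by omega) hK hs0 hs1

end TwoSided

end PlaneMap

namespace PlaneMap

variable {n N : ℕ} {E : Type*} [Fintype E] {M : PlaneMap n N E} {G : SimpleGraph ℕ}

/-- The edges of a path: the degrees, and the fact that a function on these edges that is even at
each inner vertex is constant. -/
lemma exists_path_edges [DecidableEq E]
    (hG : ∀ u v, G.Adj u v → ∃ e, (M.src e = u ∧ M.tgt e = v) ∨ (M.src e = v ∧ M.tgt e = u))
    {a b : ℕ} {S : Set ℕ} (h : SpanPath G a b S) :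
    ∃ C : Finset E,
      (∀ v, ∑ e ∈ C, ((if M.src e = v then 1 else 0) + if M.tgt e = v then 1 else 0) +
        ((if a = v then 1 else 0) + if b = v then 1 else 0) = 2 * Set.indicator S 1 v) ∧
      ∀ g : E → ZMod 2, (∀ v ∈ S, v ≠ a → v ≠ b →
        ∑ e ∈ C, g e * bd (M.src e) (M.tgt e) v = 0) → ∃ c, ∀ e ∈ C, g e = c := by
  induction h with
  | single a =>
    refine ⟨∅, fun v => ?_, fun g _ => ⟨0, by simp⟩⟩
    by_cases h : a = v
    · simp [h]
    · simp [h, Ne.symm h]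
  | @cons a c b S hac haS h ih =>
    obtain ⟨C, hdeg, hC⟩ := ih
    obtain ⟨e₀, he₀⟩ := hG _ _ hac
    have hab : a ≠ b := by rintro rfl; exact haS h.right_mem
    have hinc : ∀ v, ((if M.src e₀ = v then 1 else 0) + if M.tgt e₀ = v then 1 else 0) =
        (if a = v then 1 else 0) + if c = v then 1 else 0 := by
      intro v
      rcases he₀ with ⟨h1, h2⟩ | ⟨h1, h2⟩ <;> rw [h1, h2]
      rw [add_comm]
    have hbd : ∀ v, bd (M.src e₀) (M.tgt e₀) v = bd a c v := by
      intro v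
      have := congrArg (Nat.cast : ℕ → ZMod 2) (hinc v)
      simpa [bd] using this
    -- no edge of the old path meets `a`
    have hza : ∀ e ∈ C, M.src e ≠ a ∧ M.tgt e ≠ a := by
      intro e he
      have h1 := hdeg a
      rw [Set.indicator_of_notMem haS] at h1
      have h2 : ∑ e ∈ C, ((if M.src e = a then 1 else 0) + if M.tgt e = a then 1 else 0) = 0 := by
        omega
      have h3 := (Finset.sum_eq_zero_iff.1 h2) e he
      constructor <;> intro h4 <;> simp [h4] at h3
    have he₀C : e₀ ∉ C := fun he => by
      have := hza e₀ he
      tauto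
    refine ⟨insert e₀ C, fun v => ?_, fun g hg => ?_⟩
    · rw [Finset.sum_insert he₀C, hinc]
      have := hdeg v
      have h1 : (insert a S).indicator 1 v = (if a = v then 1 else 0) + S.indicator 1 v := by
        by_cases hav : a = v
        · subst hav; simp [haS]
        · by_cases hv : v ∈ S <;> simp [hav, Ne.symm hav, hv]
      rw [h1]
      omega
    · obtain ⟨c₀, hc₀⟩ := hC g fun v hv hvc hvb => by
        have hva : v ≠ a := by rintro rfl; exact haS hv
        have := hg v (Set.mem_insert_of_mem _ hv) hva hvb
        rw [Finset.sum_insert he₀C, hbd] at this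
        simpa [bd, hva.symm, hvc.symm] using this
      by_cases hcb : c = b
      -- the old path has no edges
      · have hempty : C = ∅ := by
          subst hcb
          have hS : S = {c} := by
            cases h with
            | single => rfl
            | cons _ h1 h2 => exact absurd h2.right_mem h1
          by_contra hne
          obtain ⟨e, he⟩ := Finset.nonempty_iff_ne_empty.2 hne
          have key : ∀ v, ∑ e ∈ C, ((if M.src e = v then 1 else 0) +
              if M.tgt e = v then 1 else 0) = 0 := by
            intro v
            have := hdeg v
            rw [hS] at this
            by_cases hv : c = v
            · subst hv
              simp only [Set.indicator_of_mem (Set.mem_singleton c), Pi.one_apply, if_true] at this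
              omega
            · rw [Set.indicator_of_notMem (by simpa using Ne.symm hv)] at this
              omega
          have := (Finset.sum_eq_zero_iff.1 (key (M.src e))) e he
          simp at this
        exact ⟨g e₀, by simp [hempty]⟩
      · refine ⟨c₀, fun e he => ?_⟩
        rcases Finset.mem_insert.1 he with rfl | he
        · have h1 := hg c (Set.mem_insert_of_mem _ h.left_mem) hac.ne' hcb
          rw [Finset.sum_insert he₀C, hbd,
            Finset.sum_congr rfl (fun x hx => by rw [hc₀ x hx]), ← Finset.mul_sum] at h1
          have h2 := congrArg (Nat.cast : ℕ → ZMod 2) (hdeg c)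
          have h3 : ∑ e ∈ C, bd (M.src e) (M.tgt e) c = 1 := by
            rw [Set.indicator_of_mem h.left_mem] at h2
            push_cast at h2
            simp only [if_true, Ne.symm hcb, if_false, add_zero, Pi.one_apply] at h2
            simp only [bd]
            linear_combination h2
          rw [h3] at h1
          simp [bd, hac.ne] at h1
          generalize g e = x at *
          clear hc₀
          revert x c₀; decide
        · exact hc₀ e he

/-- The edges of a cycle through all vertices. -/
lemma exists_isHamCycle
    (hG : ∀ u v, G.Adj u v → ∃ e, (M.src e = u ∧ M.tgt e = v) ∨ (M.src e = v ∧ M.tgt e = u))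
    (h : SpanCycle G {v | v < n}) : ∃ C, M.IsHamCycle C := by
  classical
  obtain ⟨a, b, hP, hba, w, hw, hwa, hwb⟩ := h
  obtain ⟨C, hdeg, hC⟩ := exists_path_edges hG hP
  obtain ⟨e₁, he₁⟩ := hG _ _ hba
  have hinc : ∀ v, ((if M.src e₁ = v then 1 else 0) + if M.tgt e₁ = v then 1 else 0) =
      (if a = v then 1 else 0) + if b = v then 1 else 0 := by
    intro v
    rcases he₁ with ⟨h1, h2⟩ | ⟨h1, h2⟩ <;> rw [h1, h2]
    rw [add_comm]
  have hbd : ∀ v, bd (M.src e₁) (M.tgt e₁) v = bd a b v := by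
    intro v
    have := congrArg (Nat.cast : ℕ → ZMod 2) (hinc v)
    simpa [bd] using this
  have he₁C : e₁ ∉ C := by
    intro he
    obtain ⟨c, hc⟩ := hC (fun e => if e = e₁ then 1 else 0) fun v _ hva hvb => by
      simp only [ite_mul, one_mul, zero_mul, Finset.sum_ite_eq', he, if_true, hbd]
      simp [bd, hva.symm, hvb.symm]
    have hc1 := hc e₁ he
    simp only [if_true] at hc1
    have h1 : ∀ e ∈ C, e = e₁ := by
      intro e he
      have := hc e he
      rw [← hc1] at this
      by_contra hne
      simp [hne] at this
    have h2 := hdeg w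
    rw [Set.indicator_of_mem hw, Finset.sum_congr rfl (fun x hx => by rw [h1 x hx, hinc])] at h2
    simp [hwa.symm, hwb.symm] at h2
  refine ⟨insert e₁ C, ⟨fun v hv => ?_, fun g hg0 hg => ?_⟩⟩
  · rw [Finset.card_filter, Finset.card_filter, ← Finset.sum_add_distrib,
      Finset.sum_insert he₁C, hinc]
    have := hdeg v
    rw [Set.indicator_of_mem (show v ∈ {v | v < n} from hv), Pi.one_apply] at this
    omega
  · have hg' : ∀ v, ∑ e ∈ insert e₁ C, g e * bd (M.src e) (M.tgt e) v = 0 := by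
      intro v
      rw [← hg v]
      refine Finset.sum_subset (Finset.subset_univ _) fun e _ he => ?_
      rw [hg0 e he, zero_mul]
    obtain ⟨c, hc⟩ := hC g fun v _ hva hvb => by
      have := hg' v
      rw [Finset.sum_insert he₁C, hbd] at this
      simpa [bd, hva.symm, hvb.symm] using this
    have hc₁ : g e₁ = c := by
      have h1 := hg' a
      rw [Finset.sum_insert he₁C, hbd, Finset.sum_congr rfl (fun x hx => by rw [hc x hx]),
        ← Finset.mul_sum] at h1
      have h2 := congrArg (Nat.cast : ℕ → ZMod 2) (hdeg a)
      have h3 : ∑ e ∈ C, bd (M.src e) (M.tgt e) a = 1 := by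
        rw [Set.indicator_of_mem hP.left_mem] at h2
        push_cast at h2
        simp only [if_true, hba.ne, if_false, add_zero, Pi.one_apply] at h2
        simp only [bd]
        linear_combination h2
      rw [h3] at h1
      simp [bd, hba.ne] at h1
      generalize g e₁ = x at *
      clear hc
      revert x c; decide
    rcases (show ∀ c : ZMod 2, c = 0 ∨ c = 1 by decide) c with rfl | rfl
    · left
      intro e
      by_cases he : e ∈ insert e₁ C
      · rcases Finset.mem_insert.1 he with rfl | he
        exacts [hc₁, hc e he]
      · exact hg0 e he
    · right
      intro e he
      rcases Finset.mem_insert.1 he with rfl | he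
      exacts [hc₁, hc e he]

end PlaneMap

/-! ### Plane graphs given by tables -/

/-- An edge of a plane graph given by a table: its ends `u`, `v` and its faces `l`, `r`. -/
structure EdgeRec where
  u : ℕ
  v : ℕ
  l : ℕ
  r : ℕ

instance : Inhabited EdgeRec := ⟨⟨0, 0, 0, 0⟩⟩

/-- The graph on `ℕ` whose edges are listed in `D`. -/
def edgeGraph (D : List EdgeRec) : SimpleGraph ℕ :=
  SimpleGraph.fromRel fun u v => ∃ e ∈ D, e.u = u ∧ e.v = v

/-- The graph on `Fin n` whose edges are listed in `D`. -/
def baseGraph (n : ℕ) (D : List EdgeRec) : SimpleGraph (Fin n) := (edgeGraph D).comap Fin.val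

lemma edgeGraph_adj {D : List EdgeRec} {u v : ℕ} : (edgeGraph D).Adj u v ↔
    u ≠ v ∧ ∃ e ∈ D, (e.u = u ∧ e.v = v) ∨ (e.u = v ∧ e.v = u) := by
  rw [edgeGraph, SimpleGraph.fromRel_adj]
  grind

lemma sum_get {α : Type*} [AddCommMonoid α] (D : List EdgeRec) (F : EdgeRec → α) :
    ∑ i : Fin D.length, F (D.get i) = (D.map F).sum := by
  rw [← List.sum_ofFn]
  congr 1
  apply List.ext_getElem <;> simp

/-- The set of ends, coded in binary, of odd incidence with the boundary of the face `f`. -/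
def faceMask (D : List EdgeRec) (f : ℕ) : ℕ :=
  D.foldr (fun e m => bif decide (e.l = f) ^^ decide (e.r = f)
    then m ^^^ (2 ^ e.u ^^^ 2 ^ e.v) else m) 0

lemma testBit_faceMask (D : List EdgeRec) (f v : ℕ) :
    (if (faceMask D f).testBit v then 1 else 0 : ZMod 2) =
      (D.map fun e => bd e.l e.r f * bd e.u e.v v).sum := by
  induction D with
  | nil => simp [faceMask]
  | cons e D ih =>
    rw [List.map_cons, List.sum_cons, ← ih]
    have key : ∀ m : ℕ, (if (bif decide (e.l = f) ^^ decide (e.r = f)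
        then m ^^^ (2 ^ e.u ^^^ 2 ^ e.v) else m).testBit v then 1 else 0 : ZMod 2) =
        bd e.l e.r f * bd e.u e.v v + if m.testBit v then 1 else 0 := by
      intro m
      simp only [bd]
      by_cases h1 : e.l = f <;> by_cases h2 : e.r = f <;> by_cases h3 : e.u = v <;>
        by_cases h4 : e.v = v <;> cases h5 : m.testBit v <;>
        simp [h1, h2, h3, h4, h5, Nat.testBit_xor] <;> decide
    exact key (faceMask D f)

/-- The conditions on a table under which it describes a plane graph: the first `n - 1` edges form a
spanning tree of the graph and the others a spanning tree of the dual. -/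
structure IsPlaneTable (n N : ℕ) (D : List EdgeRec) : Prop where
  pos : 0 < n ∧ 0 < N
  length : n + N = D.length + 2
  bound : ∀ e ∈ D, e.u < n ∧ e.v < n ∧ e.l < N ∧ e.r < N
  tree : ∀ i < n - 1, (D.getD i default).v = i + 1 ∧ (D.getD i default).u < i + 1
  dual : ∀ i < N - 1, (D.getD (n - 1 + i) default).r = i + 1 ∧
    (D.getD (n - 1 + i) default).l < i + 1
  face : ∀ f < N, faceMask D f = 0

/-- The plane graph described by a table. -/
def IsPlaneTable.planeMap {n N : ℕ} {D : List EdgeRec} (h : IsPlaneTable n N D)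
    (hD : 0 < D.length) : PlaneMap n N (Fin D.length) where
  src i := (D.get i).u
  tgt i := (D.get i).v
  lf i := (D.get i).l
  rt i := (D.get i).r
  treeEdge v := ⟨(v - 1) % D.length, Nat.mod_lt _ hD⟩
  dualEdge f := ⟨(n - 1 + (f - 1)) % D.length, Nat.mod_lt _ hD⟩
  src_lt i := (h.bound _ (D.get_mem i)).1
  tgt_lt i := (h.bound _ (D.get_mem i)).2.1
  lf_lt i := (h.bound _ (D.get_mem i)).2.2.1
  rt_lt i := (h.bound _ (D.get_mem i)).2.2.2
  treeEdge_spec v h0 hv := by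
    have h1 := h.tree (v - 1) (by omega)
    have h2 := h.length
    have h3 := h.pos
    have h4 : v - 1 < D.length := by omega
    rw [List.getD_eq_getElem _ _ h4] at h1
    simp only [List.get_eq_getElem, Nat.mod_eq_of_lt h4]
    omega
  dualEdge_spec f h0 hf := by
    have h1 := h.dual (f - 1) (by omega)
    have h2 := h.length
    have h3 := h.pos
    have h4 : n - 1 + (f - 1) < D.length := by omega
    rw [List.getD_eq_getElem _ _ h4] at h1
    simp only [List.get_eq_getElem, Nat.mod_eq_of_lt h4]
    omega
  tree_or_dual e := by
    have h2 := h.length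
    have h3 := h.pos
    by_cases he : e.1 < n - 1
    · refine Or.inl ⟨e.1 + 1, by omega, by omega, Fin.ext ?_⟩
      simp [Nat.mod_eq_of_lt e.2]
    · have h4 : n - 1 + (e.1 - (n - 1) + 1 - 1) = e.1 := by omega
      refine Or.inr ⟨e.1 - (n - 1) + 1, by omega, by have := e.2; omega, Fin.ext ?_⟩
      simp only [h4, Nat.mod_eq_of_lt e.2]
  face_even f v := by
    rw [sum_get D (fun e => bd e.l e.r f * bd e.u e.v v), ← testBit_faceMask]
    by_cases hf : f < N
    · simp [h.face f hf]
    · rw [testBit_faceMask]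
      refine List.sum_eq_zero fun x hx => ?_
      obtain ⟨e, he, rfl⟩ := List.mem_map.1 hx
      have := h.bound e he
      simp [bd, show e.l ≠ f by omega, show e.r ≠ f by omega]

/-- The weight patterns for which a two-sided plane graph has no hamiltonian cycle. -/
def cutWeight : Bool → Fin 6 → ZMod 3
  | false => ![0, 0, 1, 2, 1, 0]
  | true => ![1, 1, 0, 1, 0, 1]

/-- A face lies on the side `false` or `true` if its bit is set in `F₀` or `F₁`; otherwise it is
crossed by the cut. -/
def maskSide (F₀ F₁ f : ℕ) : Option Bool :=
  bif F₀.testBit f then some false else bif F₁.testBit f then some true else none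

/-- The conditions on a table, with vertex sides given by the binary mask `W`, face sides by `F₀`
and `F₁`, edges of the cut by `cut` and faces met by the cut by `ring`, under which it describes a
two-sided plane graph. -/
structure IsTwoSidedTable (n N : ℕ) (D : List EdgeRec) (W F₀ F₁ : ℕ) (cut ring : Fin 6 → ℕ) :
    Prop where
  cut_inj : ∀ i j, cut i = cut j → i = j
  ring_inj : ∀ i j, ring i = ring j → i = j
  cut_lt : ∀ i, cut i < D.length
  ring_lt : ∀ i, ring i < N
  mem_cut : ∀ i < D.length, W.testBit (D.getD i default).u ≠ W.testBit (D.getD i default).v ↔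
    ∃ j, i = cut j
  mem_ring : ∀ f < N, maskSide F₀ F₁ f = none ↔ ∃ i, f = ring i
  cut_faces : ∀ i, ((D.getD (cut i) default).l = ring i ∧
      (D.getD (cut i) default).r = ring (i + 1)) ∨
    ((D.getD (cut i) default).l = ring (i + 1) ∧ (D.getD (cut i) default).r = ring i)
  inner : ∀ e ∈ D, ∀ s, maskSide F₀ F₁ e.l = some s ∨ maskSide F₀ F₁ e.r = some s →
    W.testBit e.u = s ∧ W.testBit e.v = s
  length_inner : ∀ f < N, maskSide F₀ F₁ f ≠ none →
    (D.map fun e => (if e.l = f then 1 else 0) + if e.r = f then 1 else 0).sum % 3 = 2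
  length_ring : ∀ s i, (((D.map fun e => if W.testBit e.u = s ∧ W.testBit e.v = s then
    (if e.l = ring i then 1 else 0) + (if e.r = ring i then 1 else 0) else 0).sum : ℕ) : ZMod 3) =
      cutWeight s i
  euler_side : (D.map fun e => if W.testBit e.u = false ∧ W.testBit e.v = false then 1 else 0).sum
    + 1 = ((Finset.range n).filter fun v => W.testBit v = false).card +
      ((Finset.range N).filter fun f => maskSide F₀ F₁ f = some false).card

/-- The two-sided plane graph described by a table. -/
def IsTwoSidedTable.twoSided {n N : ℕ} {D : List EdgeRec} {W F₀ F₁ : ℕ} {cut ring : Fin 6 → ℕ}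
    (h : IsTwoSidedTable n N D W F₀ F₁ cut ring) (h' : IsPlaneTable n N D) (hD : 0 < D.length) :
    (h'.planeMap hD).TwoSided where
  vside := W.testBit
  fside := maskSide F₀ F₁
  cut i := ⟨cut i, h.cut_lt i⟩
  ring := ring
  weight := cutWeight
  cut_inj i j e := h.cut_inj i j (Fin.ext_iff.1 e)
  ring_inj := h.ring_inj
  ring_lt := h.ring_lt
  mem_cut e := by
    have := h.mem_cut e e.2
    rw [List.getD_eq_getElem _ _ e.2] at this
    simp only [Fin.ext_iff]
    exact this
  mem_ring := h.mem_ring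
  cut_faces i := by
    have := h.cut_faces i
    rw [List.getD_eq_getElem _ _ (h.cut_lt i)] at this
    exact this
  lf_inner e s hs := h.inner _ (D.get_mem e) s (Or.inl hs)
  rt_inner e s hs := h.inner _ (D.get_mem e) s (Or.inr hs)
  length_inner f hf hfs := by
    have h1 := h.length_inner f hf hfs
    have h2 := sum_get D (fun e => (if e.l = f then 1 else 0) + if e.r = f then 1 else 0)
    rw [← h2] at h1
    have h3 := congrArg (Nat.cast : ℕ → ZMod 3) h1
    rw [ZMod.natCast_mod] at h3
    push_cast at h3
    exact h3
  length_ring s i := by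
    rw [← h.length_ring s i, ← sum_get]
    push_cast
    rw [Finset.sum_filter]
    rfl
  euler := by rw [h'.length, Fintype.card_fin]
  euler_side := by
    rw [← h.euler_side, ← sum_get, Finset.card_filter]
    rfl

/-- Grinberg's criterion for tables. -/
theorem IsTwoSidedTable.not_spanCycle {n N : ℕ} {D : List EdgeRec} {W F₀ F₁ : ℕ}
    {cut ring : Fin 6 → ℕ} (h : IsTwoSidedTable n N D W F₀ F₁ cut ring)
    (h' : IsPlaneTable n N D) : ¬ SpanCycle (edgeGraph D) {v | v < n} := by
  intro hc
  have hD : 0 < D.length := (Nat.zero_le _).trans_lt (h.cut_lt 0)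
  obtain ⟨C, hC⟩ := (h'.planeMap hD).exists_isHamCycle (fun u v huv => by
    obtain ⟨-, e, he, h1⟩ := edgeGraph_adj.1 huv
    obtain ⟨i, rfl⟩ := List.get_of_mem he
    exact ⟨i, h1⟩) hc
  exact (h.twoSided h' hD).not_isHamCycle rfl rfl hC

/-! ### Cycles given by codes -/

/-- The neighbour number `d` of the vertex `v` according to the table `T`, a numeral to base 128
with four digits for each vertex. Here and in `walk`, arithmetic is spelled out, without type class
instances, for the sake of evaluation by the kernel. -/
def nbr (T v d : ℕ) : ℕ := (Nat.shiftRight T (Nat.mul 7 (Nat.add (Nat.mul 4 v) d))).mod 128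

/-- Apply a function to the value of a number; the case distinction makes the kernel evaluate the
number before it is substituted. -/
def withValue (f : ℕ → Bool) : ℕ → Bool
  | 0 => f 0
  | k + 1 => f (k + 1)

lemma withValue_eq (f : ℕ → Bool) (k : ℕ) : withValue f k = f k := by cases k <;> rfl

/-- Follow the code `c`, whose digits to base 4 number the neighbours to which to proceed, from the
vertex `v`, for `k` steps and one further step back to `s`. The set of vertices visited, coded in
binary, is `m` at the start and has to be `target` at the end, and no vertex may be visited twice.
-/
def walk (T target s : ℕ) : ℕ → ℕ → ℕ → ℕ → Bool
  | 0, c, v, m => Nat.beq (nbr T v (Nat.mod c 4)) s && Nat.beq m target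
  | k + 1, c, v, m => withValue (fun w => Nat.beq (Nat.land (Nat.shiftRight m w) 1) 0 &&
      walk T target s k (Nat.div c 4) w (Nat.lor m (Nat.pow 2 w))) (nbr T v (Nat.mod c 4))

lemma walk_zero {T target s c v m : ℕ} (h : walk T target s 0 c v m = true) :
    nbr T v (c % 4) = s ∧ m = target := by
  simp only [walk, Bool.and_eq_true, Nat.beq_eq] at h
  exact h

lemma walk_succ {T target s k c v m : ℕ} (h : walk T target s (k + 1) c v m = true) :
    m.testBit (nbr T v (c % 4)) = false ∧
      walk T target s k (c / 4) (nbr T v (c % 4)) (m ||| 2 ^ nbr T v (c % 4)) = true := by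
  simp only [walk, withValue_eq, Bool.and_eq_true, Nat.beq_eq] at h
  refine ⟨?_, h.2⟩
  have h1 : (m >>> nbr T v (c % 4)) &&& 1 = 0 := h.1
  rw [Nat.testBit, Nat.and_comm, h1]
  rfl

/-- The code `c` describes a cycle with the vertex set `target`, of size `k + 1`. -/
def checkCycle (T target k c : ℕ) : Bool :=
  walk T target (c % 128) k (c / 128) (c % 128) (2 ^ (c % 128))

lemma walk_subset {T target s k c v m : ℕ} (h : walk T target s k c v m = true) {w : ℕ}
    (hw : m.testBit w = true) : target.testBit w = true := by
  induction k generalizing c v m with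
  | zero =>
    exact (walk_zero h).2 ▸ hw
  | succ k ih =>
    exact ih (walk_succ h).2 (by simp [Nat.testBit_or, hw])

lemma walk_sound {G : SimpleGraph ℕ} {T n target s k c v m : ℕ}
    (hT : ∀ v < n, ∀ d < 4, G.Adj v (nbr T v d)) (hn : ∀ v, target.testBit v = true → v < n)
    (h3 : ∀ a b, ∃ c, target.testBit c = true ∧ c ≠ a ∧ c ≠ b)
    (hp : SpanPath G s v {w | m.testBit w = true}) (h : walk T target s k c v m = true) :
    SpanCycle G {w | target.testBit w = true} := by
  have hv : v < n := hn v (walk_subset h hp.right_mem)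
  have hadj := hT v hv (c % 4) (Nat.mod_lt _ (by norm_num))
  induction k generalizing c v m with
  | zero =>
    have h := walk_zero h
    rw [h.1] at hadj
    rw [h.2] at hp
    exact ⟨s, v, hp, hadj, h3 s v⟩
  | succ k ih =>
    have h := walk_succ h
    have hset : {z | (m ||| 2 ^ nbr T v (c % 4)).testBit z = true} =
        insert (nbr T v (c % 4)) {z | m.testBit z = true} := by
      ext z
      simp only [Set.mem_ofPred_eq, Nat.testBit_or, Nat.testBit_two_pow, Bool.or_eq_true,
        decide_eq_true_eq, Set.mem_insert_iff]
      rw [or_comm, eq_comm]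
    have hp' := hp.snoc hadj (by simp [h.1])
    rw [← hset] at hp'
    have hv' := hn _ (walk_subset h.2 hp'.right_mem)
    exact ih hp' h.2 hv' (hT _ hv' _ (Nat.mod_lt _ (by norm_num)))

lemma checkCycle_sound {G : SimpleGraph ℕ} {T n target k c : ℕ}
    (hT : ∀ v < n, ∀ d < 4, G.Adj v (nbr T v d)) (hn : ∀ v, target.testBit v = true → v < n)
    (h3 : ∀ a b, ∃ c, target.testBit c = true ∧ c ≠ a ∧ c ≠ b)
    (h : checkCycle T target k c = true) : SpanCycle G {w | target.testBit w = true} := by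
  refine walk_sound hT hn h3 ?_ h
  convert SpanPath.single (G := G) (c % 128)
  ext z
  simp only [Set.mem_ofPred_eq, Nat.testBit_two_pow, decide_eq_true_eq, Set.mem_singleton_iff]
  exact eq_comm

lemma exists_lt_five_ne (u v a b : ℕ) : ∃ c < 5, c ≠ u ∧ c ≠ v ∧ c ≠ a ∧ c ≠ b := by
  obtain ⟨c, hc, hc'⟩ := Finset.exists_mem_notMem_of_card_lt_card
    (s := ({u, v, a, b} : Finset ℕ)) (t := Finset.range 5)
    (Finset.card_le_four.trans_lt (by simp))
  simp only [Finset.mem_insert, Finset.mem_singleton, not_or] at hc'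
  exact ⟨c, by simpa using hc, hc'⟩

/-- The table `D` contains an edge between `u` and `v`. -/
def hasEdge (D : List EdgeRec) (u v : ℕ) : Bool :=
  D.any fun e => Nat.beq e.u u && Nat.beq e.v v || Nat.beq e.u v && Nat.beq e.v u

/-- Tables of cycle codes witness that all vertex-deleted subgraphs are hamiltonian, and so are all
subgraphs obtained by deleting the ends of an edge. -/
structure IsCycleTable (n : ℕ) (D : List EdgeRec) (T : ℕ) (K₁ K₂ : List ℕ) : Prop where
  five_le : 5 ≤ n
  nbr_adj : ∀ v < n, ∀ d < 4, withValue (hasEdge D v) (nbr T v d) = true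
  ne : ∀ e ∈ D, e.u ≠ e.v
  lt : ∀ e ∈ D, e.u < n ∧ e.v < n
  vertex : ∀ v < n, checkCycle T ((2 ^ n - 1) ^^^ 2 ^ v) (n - 2) (K₁.getD v 0) = true
  edge : ∀ i < D.length, checkCycle T
    ((2 ^ n - 1) ^^^ (2 ^ (D.getD i default).u ^^^ 2 ^ (D.getD i default).v)) (n - 3)
    (K₂.getD i 0) = true

namespace IsCycleTable

variable {n : ℕ} {D : List EdgeRec} {T : ℕ} {K₁ K₂ : List ℕ}

lemma adj (h : IsCycleTable n D T K₁ K₂) :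
    ∀ v < n, ∀ d < 4, (edgeGraph D).Adj v (nbr T v d) := by
  intro v hv d hd
  obtain ⟨e, he, h1⟩ : ∃ e ∈ D, (e.u = v ∧ e.v = nbr T v d) ∨ (e.u = nbr T v d ∧ e.v = v) := by
    simpa only [withValue_eq, hasEdge, List.any_eq_true, Bool.or_eq_true, Bool.and_eq_true,
      Nat.beq_eq] using h.nbr_adj v hv d hd
  have := h.ne e he
  rw [edgeGraph_adj]
  refine ⟨?_, e, he, by tauto⟩
  rcases h1 with ⟨h1, h2⟩ | ⟨h1, h2⟩
  exacts [fun h => this (h1.trans (h.trans h2.symm)),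
    fun h => this (h1.trans (h.symm.trans h2.symm))]

lemma compl_vertex (h : IsCycleTable n D T K₁ K₂) {v : ℕ} (hv : v < n) :
    SpanCycle (edgeGraph D) {w | w < n ∧ w ≠ v} := by
  have hbit : ∀ w, ((2 ^ n - 1) ^^^ 2 ^ v).testBit w = true ↔ w < n ∧ w ≠ v := by
    intro w
    rw [Nat.testBit_xor, Nat.testBit_two_pow_sub_one, Nat.testBit_two_pow]
    by_cases h1 : v = w
    · subst h1; simp [hv]
    · simp [h1, Ne.symm h1]
  have := checkCycle_sound h.adj (fun w hw => ((hbit w).1 hw).1) (fun a b => by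
    obtain ⟨c, hc, h1, h2, h3, h4⟩ := exists_lt_five_ne v v a b
    exact ⟨c, (hbit c).2 ⟨hc.trans_le h.five_le, h1⟩, h3, h4⟩) (h.vertex v hv)
  simpa only [hbit] using this

lemma compl_edge (h : IsCycleTable n D T K₁ K₂) {u v : ℕ} (huv : (edgeGraph D).Adj u v) :
    SpanCycle (edgeGraph D) {w | w < n ∧ w ≠ u ∧ w ≠ v} := by
  have key : ∀ e ∈ D, SpanCycle (edgeGraph D) {w | w < n ∧ w ≠ e.u ∧ w ≠ e.v} := by
    intro e he
    have hne := h.ne e he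
    obtain ⟨hu, hv⟩ := h.lt e he
    obtain ⟨i, hi⟩ := List.get_of_mem he
    have hD : D.getD i default = e := by
      rw [List.getD_eq_getElem _ _ i.2]; exact hi
    have hbit : ∀ w, ((2 ^ n - 1) ^^^ (2 ^ e.u ^^^ 2 ^ e.v)).testBit w = true ↔
        w < n ∧ w ≠ e.u ∧ w ≠ e.v := by
      intro w
      rw [Nat.testBit_xor, Nat.testBit_two_pow_sub_one, Nat.testBit_xor, Nat.testBit_two_pow,
        Nat.testBit_two_pow]
      by_cases h1 : e.u = w
      · subst h1; simp [hu, hne.symm]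
      · by_cases h2 : e.v = w
        · subst h2; simp [hv, hne]
        · simp [h1, h2, Ne.symm h1, Ne.symm h2]
    have := checkCycle_sound h.adj (fun w hw => ((hbit w).1 hw).1) (fun a b => by
      obtain ⟨c, hc, h1, h2, h3, h4⟩ := exists_lt_five_ne e.u e.v a b
      exact ⟨c, (hbit c).2 ⟨hc.trans_le h.five_le, h1, h2⟩, h3, h4⟩) (hD ▸ h.edge i i.2)
    simpa only [hbit] using this
  obtain ⟨-, e, he, ⟨rfl, rfl⟩ | ⟨rfl, rfl⟩⟩ := edgeGraph_adj.1 huv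
  · exact key e he
  · convert key e he using 4
    exact and_comm

end IsCycleTable

/-- A table with certificates yields a graph that is hypohamiltonian and `K₂`-hamiltonian. -/
theorem isGood_baseGraph {n N : ℕ} {D : List EdgeRec} {W F₀ F₁ T : ℕ} {cut ring : Fin 6 → ℕ}
    {K₁ K₂ : List ℕ} (h₁ : IsPlaneTable n N D) (h₂ : IsTwoSidedTable n N D W F₀ F₁ cut ring)
    (h₃ : IsCycleTable n D T K₁ K₂) : IsGood (baseGraph n D) where
  not_univ h := by
    refine h₂.not_spanCycle h₁ ?_
    have := h.map (H := edgeGraph D) Fin.val (fun _ _ _ _ h => h) Fin.val_injective.injOn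
    convert this
    ext v
    simp only [Set.mem_ofPred_eq, Set.image_univ, Set.mem_range]
    exact ⟨fun hv => ⟨⟨v, hv⟩, rfl⟩, by rintro ⟨w, rfl⟩; exact w.2⟩
  compl_vertex u := by
    refine (h₃.compl_vertex u.2).comap (f := Fin.val) ?_ (fun _ _ _ _ h => h)
      Fin.val_injective.injOn
    ext v
    simp only [Set.mem_ofPred_eq, Set.mem_image, Set.mem_compl_iff, Set.mem_singleton_iff]
    constructor
    · rintro ⟨h1, h2⟩
      exact ⟨⟨v, h1⟩, fun h => h2 (Fin.ext_iff.1 h), rfl⟩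
    · rintro ⟨w, hw, rfl⟩
      exact ⟨w.2, fun h => hw (Fin.ext h)⟩
  compl_edge u u' huu' := by
    refine (h₃.compl_edge huu').comap (f := Fin.val) ?_ (fun _ _ _ _ h => h)
      Fin.val_injective.injOn
    ext v
    simp only [Set.mem_ofPred_eq, Set.mem_image, Set.mem_compl_iff, Set.mem_insert_iff,
      Set.mem_singleton_iff, not_or]
    constructor
    · rintro ⟨h1, h2, h3⟩
      exact ⟨⟨v, h1⟩, ⟨fun h => h2 (Fin.ext_iff.1 h), fun h => h3 (Fin.ext_iff.1 h)⟩, rfl⟩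
    · rintro ⟨w, ⟨hw, hw'⟩, rfl⟩
      exact ⟨w.2, fun h => hw (Fin.ext h), fun h => hw' (Fin.ext h)⟩

/-! ### Chains of pieces -/

instance (D : List EdgeRec) : DecidableRel (edgeGraph D).Adj :=
  fun _ _ => decidable_of_iff _ edgeGraph_adj.symm

/-- A base graph with two marked cubic vertices, prepared for gluing. Its vertices are numbered
`0, …, p + 4`: the marked vertex `p + 4` has the neighbours `a k`, all below `p`, and the marked
vertex `p + 3` has the neighbours `p`, `p + 1`, `p + 2`. The function `level` gives the distances
from the vertex `p + 4`; the vertices `p + k` have distance 8. -/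
structure Piece where
  p : ℕ
  edges : List EdgeRec
  a : Fin 3 → Fin p
  a_inj : Function.Injective a
  a_indep : ∀ i j, ¬ (edgeGraph edges).Adj (a i) (a j)
  b_indep : ∀ i j : Fin 3, ¬ (edgeGraph edges).Adj (p + i) (p + j)
  adj_y : ∀ u < p + 5, (edgeGraph edges).Adj (p + 3) u ↔ ∃ k : Fin 3, u = p + k
  adj_x : ∀ u < p + 5, (edgeGraph edges).Adj (p + 4) u ↔ ∃ k, u = a k
  isGood : IsGood (baseGraph (p + 5) edges)
  level : ℕ → ℕ
  level_a : ∀ k, level (a k) = 1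
  level_b : ∀ k : Fin 3, level (p + k) = 8
  eq_a : ∀ i : Fin p, level i = 1 → ∃ k, i = a k
  level_le : ∀ e ∈ edges, e.u < p + 3 → e.v < p + 3 →
    level e.u ≤ level e.v + 1 ∧ level e.v ≤ level e.u + 1
  level_desc : ∀ u < p + 3, level u ≠ 1 → ∃ e ∈ edges,
    (e.u = u ∧ e.v < p + 3 ∧ level u = level e.v + 1) ∨
    (e.v = u ∧ e.u < p + 3 ∧ level u = level e.u + 1)

/-- The graph obtained by joining a new vertex `none` to the vertices `t k`. -/
def closeGraph {W : Type*} (G : SimpleGraph W) (t : Fin 3 → W) : SimpleGraph (Option W) where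
  Adj
    | none, none => False
    | none, some w => ∃ k, w = t k
    | some w, none => ∃ k, w = t k
    | some w, some w' => G.Adj w w'
  symm := ⟨by
    rintro (_ | w) (_ | w') h
    exacts [h, h, h, SimpleGraph.Adj.symm h]⟩
  loopless := ⟨by
    rintro (_ | w) h
    exacts [h, G.loopless.irrefl _ h]⟩

namespace Piece

variable (c : Piece)

/-- The graph obtained from `G`, with terminals `t k`, by putting the piece `c` around it: the
vertices below `c.p` are added, and the terminals take the part of the vertices `c.p + k`. -/
def extendGraph {W : Type*} (G : SimpleGraph W) (t : Fin 3 → W) : SimpleGraph (Fin c.p ⊕ W) where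
  Adj
    | .inl i, .inl j => (edgeGraph c.edges).Adj i j
    | .inl i, .inr w => ∃ k : Fin 3, w = t k ∧ (edgeGraph c.edges).Adj i (c.p + k)
    | .inr w, .inl i => ∃ k : Fin 3, w = t k ∧ (edgeGraph c.edges).Adj i (c.p + k)
    | .inr w, .inr w' => G.Adj w w'
  symm := ⟨by
    rintro (i | w) (j | w') h
    exacts [SimpleGraph.Adj.symm h, h, h, SimpleGraph.Adj.symm h]⟩
  loopless := ⟨by
    rintro (i | w) h
    exacts [(edgeGraph _).loopless.irrefl _ h, G.loopless.irrefl _ h]⟩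

/-- The terminals of the graph obtained by putting the piece `c` around another graph. -/
def terminal (W : Type*) (k : Fin 3) : Fin c.p ⊕ W := .inl (c.a k)

/-- The map of the base graph into the graph closed up after putting `c` around a graph with
terminals `t k`; the value `z` at the vertex `c.p + 3` is arbitrary. -/
def embed {W : Type*} (t : Fin 3 → W) (z : W) (u : Fin (c.p + 5)) : Option (Fin c.p ⊕ W) :=
  if h : u.1 < c.p then some (.inl ⟨u, h⟩)
  else if u.1 = c.p + 4 then none
  else if h : u.1 - c.p < 3 then some (.inr (t ⟨u - c.p, h⟩)) else some (.inr z)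

/-- A vertex of the base graph below `p`. -/
def inner (i : Fin c.p) : Fin (c.p + 5) := ⟨i, by omega⟩

/-- The neighbours of the marked vertex `y`. -/
def b (k : Fin 3) : Fin (c.p + 5) := ⟨c.p + k, by omega⟩

/-- The marked vertex `p + 3`, to be replaced by the interior of the piece. -/
def y : Fin (c.p + 5) := ⟨c.p + 3, by omega⟩

/-- The marked vertex `p + 4`, through which the piece is joined to its exterior. -/
def x : Fin (c.p + 5) := ⟨c.p + 4, by omega⟩

lemma cases (u : Fin (c.p + 5)) :
    (∃ i, u = c.inner i) ∨ (∃ k, u = c.b k) ∨ u = c.y ∨ u = c.x := by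
  simp only [inner, b, y, x, Fin.ext_iff]
  by_cases h : u.1 < c.p
  · exact Or.inl ⟨⟨u, h⟩, rfl⟩
  · by_cases h' : u.1 < c.p + 3
    · exact Or.inr (Or.inl ⟨⟨u - c.p, by omega⟩, by simp; omega⟩)
    · omega

variable {c} {W : Type*} {G : SimpleGraph W} {t : Fin 3 → W} {z : W}

@[simp] lemma embed_inner (i : Fin c.p) : c.embed t z (c.inner i) = some (.inl i) := by
  simp [embed, inner]

@[simp] lemma embed_b (k : Fin 3) : c.embed t z (c.b k) = some (.inr (t k)) := by
  have := k.2
  simp [embed, b, show k.1 ≠ 4 by omega]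

@[simp] lemma embed_y : c.embed t z c.y = some (.inr z) := by
  simp [embed, y]

@[simp] lemma embed_x : c.embed t z c.x = none := by
  simp [embed, x]

lemma b_inj : Function.Injective c.b := by
  intro i j h
  simpa [b, Fin.ext_iff] using h

lemma b_ne_y (k : Fin 3) : c.b k ≠ c.y := by
  have := k.2
  simp [b, y]
  omega

lemma adj_b_b (i j : Fin 3) : ¬ (baseGraph _ c.edges).Adj (c.b i) (c.b j) := c.b_indep i j

lemma adj_y_iff (u : Fin (c.p + 5)) : (baseGraph _ c.edges).Adj c.y u ↔ ∃ k, u = c.b k :=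
  (c.adj_y u u.2).trans (by simp [b, Fin.ext_iff])

lemma adj_x_iff (u : Fin (c.p + 5)) :
    (baseGraph _ c.edges).Adj c.x u ↔ ∃ k, u = c.inner (c.a k) :=
  (c.adj_x u u.2).trans (by simp [inner, Fin.ext_iff])

lemma embed_injOn (ht : Function.Injective t) : Set.InjOn (c.embed t z) {c.y}ᶜ := by
  intro u hu v hv h
  rcases c.cases u with ⟨i, rfl⟩ | ⟨i, rfl⟩ | rfl | rfl <;>
  rcases c.cases v with ⟨j, rfl⟩ | ⟨j, rfl⟩ | rfl | rfl <;> simp at h hu hv ⊢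
  · rw [h]
  · rw [ht h]

/-- Away from the vertex `c.y`, the embedding preserves and reflects adjacency. -/
lemma embed_adj (ht : Function.Injective t) (hG : ∀ i j, ¬ G.Adj (t i) (t j))
    {u v : Fin (c.p + 5)} (hu : u ≠ c.y) (hv : v ≠ c.y) :
    (closeGraph (c.extendGraph G t) (c.terminal W)).Adj (c.embed t z u) (c.embed t z v) ↔
      (baseGraph _ c.edges).Adj u v := by
  have hxb : ∀ j, ¬ (baseGraph _ c.edges).Adj c.x (c.b j) := by
    intro j h
    obtain ⟨k, hk⟩ := (adj_x_iff _).1 h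
    have := (c.a k).2
    simp [b, inner] at hk
    omega
  have hib : ∀ i j, (baseGraph _ c.edges).Adj (c.inner i) (c.b j) ↔
      (closeGraph (c.extendGraph G t) (c.terminal W)).Adj (some (.inl i)) (some (.inr (t j))) := by
    intro i j
    constructor
    · exact fun h => ⟨j, rfl, h⟩
    · rintro ⟨k, h1, h2⟩
      obtain rfl := ht h1
      exact h2
  have hix : ∀ i, (baseGraph _ c.edges).Adj c.x (c.inner i) ↔
      (closeGraph (c.extendGraph G t) (c.terminal W)).Adj none (some (.inl i)) := by
    intro i
    rw [adj_x_iff]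
    simp [closeGraph, terminal, inner, Fin.ext_iff]
  rcases c.cases u with ⟨i, rfl⟩ | ⟨i, rfl⟩ | rfl | rfl <;>
  rcases c.cases v with ⟨j, rfl⟩ | ⟨j, rfl⟩ | rfl | rfl <;>
  first | exact absurd rfl hu | exact absurd rfl hv | skip
  · rw [embed_inner, embed_inner]; rfl
  · rw [embed_inner, embed_b, hib]
  · rw [embed_inner, embed_x, SimpleGraph.adj_comm, ← hix, SimpleGraph.adj_comm]
  · rw [embed_inner, embed_b, SimpleGraph.adj_comm, ← hib, SimpleGraph.adj_comm]
  · rw [embed_b, embed_b]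
    exact iff_of_false (hG i j) (adj_b_b i j)
  · rw [embed_b, embed_x, SimpleGraph.adj_comm _ _ c.x]
    refine iff_of_false ?_ (hxb i)
    rintro ⟨k, hk⟩
    exact Sum.inr_ne_inl hk
  · rw [embed_inner, embed_x, hix]
  · rw [embed_b, embed_x]
    refine iff_of_false ?_ (hxb j)
    rintro ⟨k, hk⟩
    exact Sum.inr_ne_inl hk
  · exact iff_of_false (SimpleGraph.irrefl _) (SimpleGraph.irrefl _)

/-- Putting a piece around a graph means gluing the base graph to the closed-up graph. -/
lemma isGluing (c : Piece) (ht : Function.Injective t) (hG : ∀ i j, ¬ G.Adj (t i) (t j)) :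
    IsGluing (baseGraph _ c.edges) c.y c.b (closeGraph G t) none (fun k => some (t k))
      (closeGraph (c.extendGraph G t) (c.terminal W)) (c.embed t (t 0)) (Option.map Sum.inr) where
  b_inj := b_inj
  t_inj := (Option.some_injective _).comp ht
  adj_y := adj_y_iff
  adj_x := by
    rintro (_ | w)
    · exact iff_of_false (SimpleGraph.irrefl _) (by simp)
    · simp [closeGraph]
  b_indep := adj_b_b
  t_indep := hG
  φ_inj := embed_injOn ht
  ψ_inj := (Option.map_injective Sum.inr_injective).injOn
  glue k := by simp
  meet u hu w hw h := by
    obtain ⟨w, rfl⟩ := Option.ne_none_iff_exists'.1 hw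
    rcases c.cases u with ⟨i, rfl⟩ | ⟨i, rfl⟩ | rfl | rfl <;> simp at h hu
    exact ⟨i, rfl, by rw [h]⟩
  cover v := by
    rcases v with _ | i | w
    · exact Or.inl ⟨c.x, by simp [x, y], by simp⟩
    · exact Or.inl ⟨c.inner i, by have := i.2; simp [inner, y]; omega, by simp⟩
    · exact Or.inr ⟨some w, by simp, rfl⟩
  adj_φ u hu v hv := embed_adj ht hG hu hv
  adj_ψ w hw w' hw' := by
    obtain ⟨w, rfl⟩ := Option.ne_none_iff_exists'.1 hw
    obtain ⟨w', rfl⟩ := Option.ne_none_iff_exists'.1 hw'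
    rfl
  adj_cases v v' h := by
    have hin : ∀ i, c.inner i ≠ c.y := fun i => by have := i.2; simp [inner, y]; omega
    have hx : c.x ≠ c.y := by simp [x, y]
    rcases v with _ | i | w <;> rcases v' with _ | j | w'
    · exact absurd h (SimpleGraph.irrefl _)
    · exact Or.inl ⟨c.x, c.inner j, hx, hin j, by simp, by simp⟩
    · obtain ⟨k, hk⟩ := h
      exact absurd hk Sum.inr_ne_inl
    · exact Or.inl ⟨c.inner i, c.x, hin i, hx, by simp, by simp⟩
    · exact Or.inl ⟨c.inner i, c.inner j, hin i, hin j, by simp, by simp⟩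
    · obtain ⟨k, rfl, -⟩ := h
      exact Or.inl ⟨c.inner i, c.b k, hin i, b_ne_y k, by simp, by simp⟩
    · obtain ⟨k, hk⟩ := h
      exact absurd hk Sum.inr_ne_inl
    · obtain ⟨k, rfl, -⟩ := h
      exact Or.inl ⟨c.b k, c.inner j, b_ne_y k, hin j, by simp, by simp⟩
    · exact Or.inr ⟨some w, some w', by simp, by simp, rfl, rfl⟩

end Piece

/-- The star with centre `none` and three leaves. -/
def starGraph : SimpleGraph (Option (Fin 3)) := SimpleGraph.fromRel fun u _ => u = none

lemma starGraph_adj_some (i j : Fin 3) : ¬ starGraph.Adj (some i) (some j) := by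
  simp [starGraph, SimpleGraph.fromRel_adj]

/-- Around the star, the piece gives back the base graph. -/
lemma Piece.isGood_star (c : Piece) :
    IsGood (closeGraph (c.extendGraph starGraph some) (c.terminal _)) := by
  have hadj : ∀ u v : Fin (c.p + 5),
      (closeGraph (c.extendGraph starGraph some) (c.terminal _)).Adj
        (c.embed some none u) (c.embed some none v) ↔ (baseGraph _ c.edges).Adj u v := by
    have hy : ∀ v, v ≠ c.y → ((closeGraph (c.extendGraph starGraph some) (c.terminal _)).Adj
        (some (.inr none)) (c.embed some none v) ↔ (baseGraph _ c.edges).Adj c.y v) := by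
      intro v hv
      rw [adj_y_iff]
      rcases c.cases v with ⟨i, rfl⟩ | ⟨i, rfl⟩ | rfl | rfl
      · rw [embed_inner]
        refine iff_of_false ?_ ?_
        · rintro ⟨k, hk, -⟩
          simp at hk
        · rintro ⟨k, hk⟩
          have := i.2
          simp [inner, b] at hk
          omega
      · rw [embed_b]
        refine iff_of_true ?_ ⟨i, rfl⟩
        show starGraph.Adj none (some i)
        simp [starGraph, SimpleGraph.fromRel_adj]
      · exact absurd rfl hv
      · rw [embed_x]
        refine iff_of_false ?_ ?_
        · rintro ⟨k, hk⟩
          simp [terminal] at hk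
        · rintro ⟨k, hk⟩
          have := k.2
          simp [x, b] at hk
          omega
    intro u v
    by_cases hu : u = c.y
    · subst hu
      by_cases hv : v = c.y
      · subst hv
        exact iff_of_false (SimpleGraph.irrefl _) (SimpleGraph.irrefl _)
      · rw [embed_y, hy v hv]
    · by_cases hv : v = c.y
      · subst hv
        rw [embed_y, SimpleGraph.adj_comm, hy u hu, SimpleGraph.adj_comm]
      · exact embed_adj (Option.some_injective _) starGraph_adj_some hu hv
  have hbij : Function.Bijective (c.embed (some : Fin 3 → _) none) := by
    refine (Fintype.bijective_iff_surjective_and_card _).2 ⟨?_, ?_⟩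
    · rintro (_ | i | _ | k)
      exacts [⟨_, embed_x⟩, ⟨_, embed_inner i⟩, ⟨_, embed_y⟩, ⟨_, embed_b k⟩]
    · simp
  exact IsGood.of_iso ⟨Equiv.ofBijective _ hbij, fun {u v} => hadj u v⟩ c.isGood

/-- A finite graph with three terminals. -/
structure Fragment where
  W : Type
  G : SimpleGraph W
  t : Fin 3 → W

/-- The graph in which the pieces of a list are put around each other, the first one outermost,
with a star at the centre. -/
def chain : List Piece → Fragment
  | [] => ⟨Option (Fin 3), starGraph, some⟩
  | c :: l => ⟨Fin c.p ⊕ (chain l).W, c.extendGraph (chain l).G (chain l).t, c.terminal _⟩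

/-- The closed-up graph of a chain of pieces. -/
def chainGraph (l : List Piece) : SimpleGraph (Option (chain l).W) :=
  closeGraph (chain l).G (chain l).t

lemma chain_t_injective (l : List Piece) : Function.Injective (chain l).t := by
  cases l with
  | nil => exact Option.some_injective _
  | cons c l => exact Sum.inl_injective.comp c.a_inj

lemma chain_indep (l : List Piece) (i j : Fin 3) :
    ¬ (chain l).G.Adj ((chain l).t i) ((chain l).t j) := by
  cases l with
  | nil => exact starGraph_adj_some i j
  | cons c l => exact c.a_indep i j

theorem isGood_chainGraph {l : List Piece} (hl : l ≠ []) : IsGood (chainGraph l) := by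
  induction l with
  | nil => exact absurd rfl hl
  | cons c l ih =>
    rcases eq_or_ne l [] with rfl | h
    · exact c.isGood_star
    · exact (c.isGluing (chain_t_injective l) (chain_indep l)).isGood c.isGood (ih h)

instance (l : List Piece) : Finite (chain l).W := by
  induction l with
  | nil => exact inferInstanceAs (Finite (Option (Fin 3)))
  | cons c l ih => exact inferInstanceAs (Finite (Fin c.p ⊕ (chain l).W))

lemma card_chain (l : List Piece) : Nat.card (chain l).W = (l.map Piece.p).sum + 4 := by
  induction l with
  | nil => exact Nat.card_eq_fintype_card (α := Option (Fin 3))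
  | cons c l ih =>
    have : Nat.card (chain (c :: l)).W = c.p + Nat.card (chain l).W :=
      (Nat.card_sum (α := Fin c.p) (β := (chain l).W)).trans (by simp)
    simp only [List.map_cons, List.sum_cons]
    omega

/-! ### Drawings with straight edges -/

/-- The orientation of a triangle in the plane: twice its signed area. -/
def orient (a b c : EuclideanSpace ℝ (Fin 2)) : ℝ :=
  (b 0 - a 0) * (c 1 - a 1) - (b 1 - a 1) * (c 0 - a 0)

lemma orient_lineMap (a b c d : EuclideanSpace ℝ (Fin 2)) (t : ℝ) :
    orient a b (AffineMap.lineMap c d t) = (1 - t) * orient a b c + t * orient a b d := by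
  simp only [orient, AffineMap.lineMap_apply, vsub_eq_sub, vadd_eq_add, PiLp.add_apply,
    PiLp.smul_apply, PiLp.sub_apply, smul_eq_mul]
  ring

lemma orient_self_left (a b : EuclideanSpace ℝ (Fin 2)) : orient a b a = 0 := by
  simp [orient]

lemma orient_self_right (a b : EuclideanSpace ℝ (Fin 2)) : orient a b b = 0 := by
  simp only [orient]; ring

lemma orient_eq_zero_of_mem_segment {a b x : EuclideanSpace ℝ (Fin 2)} (h : x ∈ segment ℝ a b) :
    orient a b x = 0 := by
  rw [segment_eq_image_lineMap] at h
  obtain ⟨t, -, rfl⟩ := h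
  rw [orient_lineMap, orient_self_left, orient_self_right]
  ring

lemma orient_pos_of_mem_segment {a b c d x : EuclideanSpace ℝ (Fin 2)} (hc : 0 < orient a b c)
    (hd : 0 < orient a b d) (h : x ∈ segment ℝ c d) : 0 < orient a b x := by
  rw [segment_eq_image_lineMap] at h
  obtain ⟨t, ⟨h0, h1⟩, rfl⟩ := h
  rw [orient_lineMap]
  rcases h0.eq_or_lt with rfl | h0
  · simpa using hc
  · exact add_pos_of_nonneg_of_pos (mul_nonneg (sub_nonneg.2 h1) hc.le) (mul_pos h0 hd)

lemma orient_swap (a b c : EuclideanSpace ℝ (Fin 2)) : orient b a c = - orient a b c := by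
  simp only [orient]; ring

lemma orient_rotate (a b c : EuclideanSpace ℝ (Fin 2)) : orient b c a = orient a b c := by
  simp only [orient]; ring

lemma mem_segment_symm {a b x : EuclideanSpace ℝ (Fin 2)} (h : x ∈ segment ℝ a b) :
    x ∈ segment ℝ b a := by
  rwa [segment_symm]

lemma eq_of_mem_segment_of_orient_nonneg {a b c d x : EuclideanSpace ℝ (Fin 2)}
    (hc : orient a b c < 0) (hd : orient a b d ≤ 0) (h : x ∈ segment ℝ c d)
    (hx : 0 ≤ orient a b x) : x = d := by
  rw [segment_eq_image_lineMap] at h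
  obtain ⟨t, ⟨h0, h1⟩, rfl⟩ := h
  rw [orient_lineMap] at hx
  have h2 : t = 1 := by
    by_contra hne
    have := mul_neg_of_pos_of_neg (sub_pos.2 (lt_of_le_of_ne h1 hne)) hc
    have := mul_nonpos_of_nonneg_of_nonpos h0 hd
    linarith
  rw [h2, AffineMap.lineMap_apply_one]

lemma eq_of_mem_segment_of_mem_segment {a b c x : EuclideanSpace ℝ (Fin 2)}
    (h : orient a b c ≠ 0) (hb : x ∈ segment ℝ a b) (hc : x ∈ segment ℝ a c) : x = a := by
  have h0 := orient_eq_zero_of_mem_segment hb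
  rw [segment_eq_image_lineMap] at hc
  obtain ⟨t, -, rfl⟩ := hc
  rw [orient_lineMap, orient_self_left, mul_zero, zero_add] at h0
  rw [(mul_eq_zero.1 h0).resolve_right h, AffineMap.lineMap_apply_zero]

lemma convex_orient_nonneg (a b : EuclideanSpace ℝ (Fin 2)) :
    Convex ℝ {x | 0 ≤ orient a b x} := by
  rw [convex_iff_segment_subset]
  intro c hc d hd x hx
  rw [segment_eq_image_lineMap] at hx
  obtain ⟨t, ⟨h0, h1⟩, rfl⟩ := hx
  rw [Set.mem_ofPred_eq, orient_lineMap]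
  exact add_nonneg (mul_nonneg (sub_nonneg.2 h1) hc) (mul_nonneg h0 hd)

lemma convex_orient_pos (a b : EuclideanSpace ℝ (Fin 2)) :
    Convex ℝ {x | 0 < orient a b x} :=
  convex_iff_segment_subset.2 fun _ hc _ hd _ hx => orient_pos_of_mem_segment hc hd hx

/-- A drawing of the subgraph of `G` induced by `S` in which the edges are line segments. -/
structure StraightDrawing {V : Type*} (G : SimpleGraph V) (S : Set V)
    (q : V → EuclideanSpace ℝ (Fin 2)) : Prop where
  inj : Set.InjOn q S
  vertex : ∀ u ∈ S, ∀ v ∈ S, ∀ w ∈ S, G.Adj u v → q w ∈ segment ℝ (q u) (q v) → w = u ∨ w = v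
  edge : ∀ u ∈ S, ∀ v ∈ S, ∀ u' ∈ S, ∀ v' ∈ S, G.Adj u v → G.Adj u' v' → s(u, v) ≠ s(u', v') →
    ∀ x ∈ segment ℝ (q u) (q v), x ∈ segment ℝ (q u') (q v') →
      ∃ w, (w = u ∨ w = v) ∧ (w = u' ∨ w = v') ∧ x = q w

namespace StraightDrawing

variable {V : Type*} {G : SimpleGraph V} {S : Set V} {q : V → EuclideanSpace ℝ (Fin 2)}

/-- In the absence of isolated vertices, it suffices to consider pairs of edges. -/
lemma of_edge (inj : Set.InjOn q S) (cover : ∀ w ∈ S, ∃ z ∈ S, G.Adj w z)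
    (edge : ∀ u ∈ S, ∀ v ∈ S, ∀ u' ∈ S, ∀ v' ∈ S, G.Adj u v → G.Adj u' v' →
      s(u, v) ≠ s(u', v') → ∀ x ∈ segment ℝ (q u) (q v), x ∈ segment ℝ (q u') (q v') →
        ∃ w, (w = u ∨ w = v) ∧ (w = u' ∨ w = v') ∧ x = q w) : StraightDrawing G S q where
  inj := inj
  edge := edge
  vertex u hu v hv w hw huv h := by
    obtain ⟨z, hz, hwz⟩ := cover w hw
    by_cases he : s(u, v) = s(w, z)
    · rcases Sym2.eq_iff.1 he with ⟨rfl, -⟩ | ⟨-, rfl⟩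
      exacts [Or.inl rfl, Or.inr rfl]
    · obtain ⟨w', h1, -, h3⟩ := edge u hu v hv w hw z hz huv hwz he _ h (left_mem_segment ℝ _ _)
      have hw' : w' ∈ S := by rcases h1 with rfl | rfl <;> assumption
      rwa [inj hw hw' h3]

lemma comp_affine (h : StraightDrawing G S q)
    (f : EuclideanSpace ℝ (Fin 2) →ᵃ[ℝ] EuclideanSpace ℝ (Fin 2)) (hf : Function.Injective f) :
    StraightDrawing G S (f ∘ q) where
  inj := hf.comp_injOn h.inj
  vertex u hu v hv w hw huv hx := by
    simp only [Function.comp_apply, ← image_segment] at hx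
    exact h.vertex u hu v hv w hw huv ((Function.Injective.mem_set_image hf).1 hx)
  edge u hu v hv u' hu' v' hv' huv huv' hne x hx hx' := by
    simp only [Function.comp_apply, ← image_segment] at hx hx'
    obtain ⟨x, hx, rfl⟩ := hx
    obtain ⟨w, h1, h2, rfl⟩ := h.edge u hu v hv u' hu' v' hv' huv huv' hne x hx
      ((Function.Injective.mem_set_image hf).1 hx')
    exact ⟨w, h1, h2, rfl⟩

lemma isArcBetween_segment {x y : EuclideanSpace ℝ (Fin 2)} (h : x ≠ y) :
    IsArcBetween (segment ℝ x y) x y := by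
  refine ⟨⟨⟨fun t => AffineMap.lineMap x y (t : ℝ), by fun_prop⟩, by simp, by simp⟩, ?_, ?_⟩
  · intro s t hst
    exact Subtype.ext (AffineMap.lineMap_injective ℝ h hst)
  · rw [segment_eq_image_lineMap]
    ext z
    simp

lemma isPlanarGraph (h : StraightDrawing G Set.univ q) : IsPlanarGraph G := by
  have hinj : Function.Injective q := fun u v => h.inj (Set.mem_univ _) (Set.mem_univ _)
  have hseg : ∀ u v, Sym2.lift ⟨fun u v => segment ℝ (q u) (q v), fun u v => segment_symm ℝ _ _⟩
      s(u, v) = segment ℝ (q u) (q v) := fun u v => rfl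
  refine ⟨q, Sym2.lift ⟨fun u v => segment ℝ (q u) (q v), fun u v => segment_symm ℝ _ _⟩, hinj,
    fun u v huv => ?_, fun e he w hw => ?_, fun e he f hf hef x hx => ?_⟩
  · exact isArcBetween_segment (hinj.ne huv.ne)
  · induction e with | h u v =>
    exact Sym2.mem_iff.2 (h.vertex u trivial v trivial w trivial he hw)
  · induction e with | h u v =>
    induction f with | h u' v' =>
    simpa only [Sym2.mem_iff] using
      h.edge u trivial v trivial u' trivial v' trivial he hf hef x hx.1 hx.2

end StraightDrawing

lemma IsPlanarGraph.of_iso {V W : Type*} {G : SimpleGraph V} {H : SimpleGraph W} (e : G ≃g H)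
    (h : IsPlanarGraph H) : IsPlanarGraph G := by
  obtain ⟨p, A, h1, h2, h3, h4⟩ := h
  have he : ∀ f ∈ G.edgeSet, f.map e ∈ H.edgeSet := by
    intro f hf
    induction f with | h u v => exact e.map_adj_iff.2 hf
  refine ⟨p ∘ e, fun f => A (f.map e), h1.comp e.injective, fun u v huv => ?_,
    fun f hf w hw => ?_, fun f hf f' hf' hne x hx => ?_⟩
  · exact h2 _ _ (e.map_adj_iff.2 huv)
  · obtain ⟨v, hv, hvw⟩ := Sym2.mem_map.1 (h3 _ (he f hf) _ hw)
    rwa [← e.injective hvw]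
  · obtain ⟨w, hw, hw', rfl⟩ := h4 _ (he f hf) _ (he f' hf')
      ((Sym2.map.injective e.injective).ne hne) x hx
    obtain ⟨v, hv, rfl⟩ := Sym2.mem_map.1 hw
    obtain ⟨v', hv', hvv⟩ := Sym2.mem_map.1 hw'
    rw [e.injective hvv] at hv'
    exact ⟨v, hv, hv', rfl⟩

/-- A straight drawing of the part of `B` induced by `X`, with a triangular hole whose corners are
the vertices `b k`: only the corners lie in the closed triangle, and an edge meets the triangle only
in corners that are its ends. -/
structure HoledDrawing {U : Type*} (B : SimpleGraph U) (X : Set U) (b : Fin 3 → U)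
    (q : U → EuclideanSpace ℝ (Fin 2)) : Prop extends StraightDrawing B X q where
  corner_mem : ∀ k, b k ∈ X
  orient_pos : 0 < orient (q (b 0)) (q (b 1)) (q (b 2))
  hole_vertex : ∀ u ∈ X, q u ∈ convexHull ℝ (Set.range (q ∘ b)) → ∃ k, u = b k
  hole_edge : ∀ u ∈ X, ∀ v ∈ X, B.Adj u v → ∀ x ∈ segment ℝ (q u) (q v),
    x ∈ convexHull ℝ (Set.range (q ∘ b)) → ∃ k, (b k = u ∨ b k = v) ∧ x = q (b k)

/-- Two drawings are combined by putting one into the triangular hole of the other. -/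
lemma HoledDrawing.glue {U W V : Type*} {B : SimpleGraph U} {y : U} {b : Fin 3 → U}
    {H : SimpleGraph W} {x : W} {t : Fin 3 → W} {Z : SimpleGraph V} {φ : U → V} {ψ : W → V}
    (h : IsGluing B y b H x t Z φ ψ) {X : Set U} {q : U → EuclideanSpace ℝ (Fin 2)}
    (hq : HoledDrawing B X b q) (hy : y ∉ X) {r : W → EuclideanSpace ℝ (Fin 2)}
    (hr : StraightDrawing H {x}ᶜ r) (hrt : ∀ k, r (t k) = q (b k))
    (hmem : ∀ w ≠ x, r w ∈ convexHull ℝ (Set.range (q ∘ b)))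
    {s : V → EuclideanSpace ℝ (Fin 2)} (hsφ : ∀ u ∈ X, s (φ u) = q u)
    (hsψ : ∀ w ≠ x, s (ψ w) = r w) : StraightDrawing Z (φ '' X ∪ ψ '' {x}ᶜ) s := by
  have hXy : ∀ u ∈ X, u ≠ y := by rintro u hu rfl; exact hy hu
  have hconv := convex_convexHull ℝ (Set.range (q ∘ b))
  -- A vertex of both parts is a corner of the hole.
  have hφS : ∀ u ≠ y, φ u ∈ φ '' X ∪ ψ '' {x}ᶜ → u ∈ X := by
    rintro u hu (⟨u', hu', e⟩ | ⟨w, hw, e⟩)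
    · rwa [← h.φ_inj (hXy u' hu') hu e]
    · obtain ⟨k, rfl, -⟩ := h.meet u hu w hw e.symm
      exact hq.corner_mem k
  have hcase : ∀ u ∈ φ '' X ∪ ψ '' {x}ᶜ, ∀ v ∈ φ '' X ∪ ψ '' {x}ᶜ, Z.Adj u v →
      (∃ a ∈ X, ∃ c ∈ X, B.Adj a c ∧ φ a = u ∧ φ c = v) ∨
      ∃ a ≠ x, ∃ c ≠ x, H.Adj a c ∧ ψ a = u ∧ ψ c = v := by
    intro u hu v hv huv
    rcases h.adj_cases u v huv with ⟨a, c, ha, hc, rfl, rfl⟩ | ⟨a, c, ha, hc, rfl, rfl⟩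
    · exact Or.inl ⟨a, hφS a ha hu, c, hφS c hc hv, (h.adj_φ a ha c hc).1 huv, rfl, rfl⟩
    · exact Or.inr ⟨a, ha, c, hc, (h.adj_ψ a ha c hc).1 huv, rfl, rfl⟩
  have hcorner : ∀ k, φ (b k) = ψ (t k) := h.glue
  have hφq : ∀ u ∈ X, ∀ w ≠ x, q u = r w → ∃ k, u = b k ∧ w = t k := by
    intro u hu w hw e
    obtain ⟨k, rfl⟩ := hq.hole_vertex u hu (e ▸ hmem w hw)
    rw [← hrt] at e
    exact ⟨k, rfl, (hr.inj (h.symm.b_ne k) hw e).symm⟩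
  -- An outer and an inner edge meet at most in a corner of the hole.
  have hmix : ∀ a ∈ X, ∀ c ∈ X, B.Adj a c → ∀ a' ≠ x, ∀ c' ≠ x, H.Adj a' c' →
      ∀ z ∈ segment ℝ (q a) (q c), z ∈ segment ℝ (r a') (r c') →
      ∃ k, (b k = a ∨ b k = c) ∧ (t k = a' ∨ t k = c') ∧ z = q (b k) := by
    intro a ha c hc hac a' ha' c' hc' hac' z hz hz'
    obtain ⟨k, hk, rfl⟩ := hq.hole_edge a ha c hc hac z hz
      (hconv.segment_subset (hmem a' ha') (hmem c' hc') hz')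
    rw [← hrt] at hz'
    exact ⟨k, hk, hr.vertex a' ha' c' hc' (t k) (h.symm.b_ne k) hac' hz', rfl⟩
  refine ⟨?_, ?_, ?_⟩
  · rintro _ (⟨u, hu, rfl⟩ | ⟨w, hw, rfl⟩) _ (⟨u', hu', rfl⟩ | ⟨w', hw', rfl⟩) e
    · rw [hsφ u hu, hsφ u' hu'] at e
      rw [hq.inj hu hu' e]
    · rw [hsφ u hu, hsψ w' hw'] at e
      obtain ⟨k, rfl, rfl⟩ := hφq u hu w' hw' e
      exact hcorner k
    · rw [hsφ u' hu', hsψ w hw] at e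
      obtain ⟨k, rfl, rfl⟩ := hφq u' hu' w hw e.symm
      exact (hcorner k).symm
    · rw [hsψ w hw, hsψ w' hw'] at e
      rw [hr.inj hw hw' e]
  · intro u hu v hv w hw huv hx
    rcases hcase u hu v hv huv with ⟨a, ha, c, hc, hac, rfl, rfl⟩ | ⟨a, ha, c, hc, hac, rfl, rfl⟩
    · rw [hsφ a ha, hsφ c hc] at hx
      rcases hw with ⟨w, hw, rfl⟩ | ⟨w, hw, rfl⟩
      · rw [hsφ w hw] at hx
        exact (hq.vertex a ha c hc w hw hac hx).imp (congrArg φ) (congrArg φ)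
      · rw [hsψ w hw] at hx
        obtain ⟨k, hk, e⟩ := hq.hole_edge a ha c hc hac _ hx (hmem w hw)
        rw [← hrt] at e
        rw [hr.inj hw (h.symm.b_ne k) e, ← hcorner]
        exact hk.imp (congrArg φ) (congrArg φ)
    · rw [hsψ a ha, hsψ c hc] at hx
      rcases hw with ⟨w, hw, rfl⟩ | ⟨w, hw, rfl⟩
      · rw [hsφ w hw] at hx
        obtain ⟨k, rfl⟩ := hq.hole_vertex w hw
          (hconv.segment_subset (hmem a ha) (hmem c hc) hx)
        rw [← hrt] at hx
        rw [hcorner]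
        exact (hr.vertex a ha c hc _ (h.symm.b_ne k) hac hx).imp (congrArg ψ) (congrArg ψ)
      · rw [hsψ w hw] at hx
        exact (hr.vertex a ha c hc w hw hac hx).imp (congrArg ψ) (congrArg ψ)
  · intro u hu v hv u' hu' v' hv' huv huv' hne z hz hz'
    rcases hcase u hu v hv huv with
      ⟨a, ha, c, hc, hac, rfl, rfl⟩ | ⟨a, ha, c, hc, hac, rfl, rfl⟩ <;>
    rcases hcase u' hu' v' hv' huv' with
      ⟨a', ha', c', hc', hac', rfl, rfl⟩ | ⟨a', ha', c', hc', hac', rfl, rfl⟩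
    · rw [hsφ a ha, hsφ c hc] at hz
      rw [hsφ a' ha', hsφ c' hc'] at hz'
      obtain ⟨w, h1, h2, h3⟩ := hq.edge a ha c hc a' ha' c' hc' hac hac'
        (fun e => hne (congrArg (Sym2.map φ) e)) z hz hz'
      have hw : w ∈ X := by rcases h1 with rfl | rfl <;> assumption
      exact ⟨φ w, h1.imp (congrArg φ) (congrArg φ), h2.imp (congrArg φ) (congrArg φ),
        by rw [hsφ w hw, h3]⟩
    · rw [hsφ a ha, hsφ c hc] at hz
      rw [hsψ a' ha', hsψ c' hc'] at hz'
      obtain ⟨k, h1, h2, h3⟩ := hmix a ha c hc hac a' ha' c' hc' hac' z hz hz'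
      refine ⟨φ (b k), h1.imp (congrArg φ) (congrArg φ), ?_, by rw [hsφ _ (hq.corner_mem k), h3]⟩
      rw [hcorner]
      exact h2.imp (congrArg ψ) (congrArg ψ)
    · rw [hsψ a ha, hsψ c hc] at hz
      rw [hsφ a' ha', hsφ c' hc'] at hz'
      obtain ⟨k, h1, h2, h3⟩ := hmix a' ha' c' hc' hac' a ha c hc hac z hz' hz
      refine ⟨φ (b k), ?_, h1.imp (congrArg φ) (congrArg φ), by rw [hsφ _ (hq.corner_mem k), h3]⟩
      rw [hcorner]
      exact h2.imp (congrArg ψ) (congrArg ψ)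
    · rw [hsψ a ha, hsψ c hc] at hz
      rw [hsψ a' ha', hsψ c' hc'] at hz'
      obtain ⟨w, h1, h2, h3⟩ := hr.edge a ha c hc a' ha' c' hc' hac hac'
        (fun e => hne (congrArg (Sym2.map ψ) e)) z hz hz'
      have hw : w ≠ x := by rcases h1 with rfl | rfl <;> assumption
      exact ⟨ψ w, h1.imp (congrArg ψ) (congrArg ψ), h2.imp (congrArg ψ) (congrArg ψ),
        by rw [hsψ w hw, h3]⟩

/-! ### Drawings of chains -/

/-- The corners of the triangle `frame`. -/
def corner : Fin 3 → EuclideanSpace ℝ (Fin 2) := ![!₂[0, 0], !₂[1000, 0], !₂[0, 1000]]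

/-- The triangle in which the fragments are drawn, the terminals being the corners. Its size is that
of the integral grid used for the drawings of the pieces. -/
def frame : Set (EuclideanSpace ℝ (Fin 2)) := {x | 0 ≤ x 0 ∧ 0 ≤ x 1 ∧ x 0 + x 1 ≤ 1000}

lemma convex_frame : Convex ℝ frame := by
  rintro x ⟨h1, h2, h3⟩ y ⟨h4, h5, h6⟩ a b ha hb hab
  simp only [frame, Set.mem_ofPred_eq, PiLp.add_apply, PiLp.smul_apply, smul_eq_mul]
  refine ⟨by positivity, by positivity, ?_⟩
  calc a * x 0 + b * y 0 + (a * x 1 + b * y 1) = a * (x 0 + x 1) + b * (y 0 + y 1) := by ring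
    _ ≤ a * 1000 + b * 1000 := by gcongr
    _ = 1000 := by rw [← add_mul, hab, one_mul]

/-- The frame can be placed in any nondegenerate triangle. -/
lemma exists_affine_frame (c : Fin 3 → EuclideanSpace ℝ (Fin 2))
    (hc : 0 < orient (c 0) (c 1) (c 2)) :
    ∃ f : EuclideanSpace ℝ (Fin 2) →ᵃ[ℝ] EuclideanSpace ℝ (Fin 2), Function.Injective f ∧
      (∀ k, f (corner k) = c k) ∧ ∀ x ∈ frame, f x ∈ convexHull ℝ (Set.range c) := by
  let L : EuclideanSpace ℝ (Fin 2) →ₗ[ℝ] EuclideanSpace ℝ (Fin 2) :=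
    (EuclideanSpace.proj 0 : EuclideanSpace ℝ (Fin 2) →L[ℝ] ℝ).toLinearMap.smulRight
      ((1 / 1000 : ℝ) • (c 1 - c 0)) +
    (EuclideanSpace.proj 1 : EuclideanSpace ℝ (Fin 2) →L[ℝ] ℝ).toLinearMap.smulRight
      ((1 / 1000 : ℝ) • (c 2 - c 0))
  let f : EuclideanSpace ℝ (Fin 2) →ᵃ[ℝ] EuclideanSpace ℝ (Fin 2) :=
    L.toAffineMap + AffineMap.const ℝ _ (c 0)
  have hf : ∀ x, f x = x 0 • ((1 / 1000 : ℝ) • (c 1 - c 0)) +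
      x 1 • ((1 / 1000 : ℝ) • (c 2 - c 0)) + c 0 := fun x => rfl
  refine ⟨f, ?_, ?_, ?_⟩
  · intro x y h
    rw [hf, hf] at h
    have h0 := congrArg (fun z : EuclideanSpace ℝ (Fin 2) => z 0) h
    have h1 := congrArg (fun z : EuclideanSpace ℝ (Fin 2) => z 1) h
    simp only [PiLp.add_apply, PiLp.smul_apply, PiLp.sub_apply, smul_eq_mul] at h0 h1
    simp only [orient] at hc
    -- Cramer's rule
    have e0 : (x 0 - y 0) * ((c 1 0 - c 0 0) * (c 2 1 - c 0 1) -
        (c 1 1 - c 0 1) * (c 2 0 - c 0 0)) = 0 := by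
      linear_combination 1000 * (c 2 1 - c 0 1) * h0 - 1000 * (c 2 0 - c 0 0) * h1
    have e1 : (x 1 - y 1) * ((c 1 0 - c 0 0) * (c 2 1 - c 0 1) -
        (c 1 1 - c 0 1) * (c 2 0 - c 0 0)) = 0 := by
      linear_combination 1000 * (c 1 0 - c 0 0) * h1 - 1000 * (c 1 1 - c 0 1) * h0
    have e0 := sub_eq_zero.1 ((mul_eq_zero.1 e0).resolve_right hc.ne')
    have e1 := sub_eq_zero.1 ((mul_eq_zero.1 e1).resolve_right hc.ne')
    ext i
    fin_cases i
    exacts [e0, e1]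
  · intro k
    rw [hf]
    ext i
    fin_cases k <;> fin_cases i <;> simp [corner]
  · rintro x ⟨h1, h2, h3⟩
    have hx : f x = (1 - (x 0 + x 1) / 1000) • c 0 + (x 0 / 1000) • c 1 + (x 1 / 1000) • c 2 := by
      rw [hf]
      module
    have hsum := (convex_convexHull ℝ (Set.range c)).sum_mem (t := Finset.univ)
      (w := ![1 - (x 0 + x 1) / 1000, x 0 / 1000, x 1 / 1000]) (z := c) (fun i _ => ?_) ?_
      (fun i _ => subset_convexHull ℝ _ (Set.mem_range_self i))
    · simpa [hx, Fin.sum_univ_three] using hsum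
    · fin_cases i <;> simp <;> linarith
    · simp [Fin.sum_univ_three]; ring

lemma corner_mem_frame (k : Fin 3) : corner k ∈ frame := by
  fin_cases k <;> norm_num [corner, frame]

/-- The drawing of the star in the frame. -/
lemma exists_starDrawing : ∃ q : Option (Option (Fin 3)) → EuclideanSpace ℝ (Fin 2),
    StraightDrawing (chainGraph []) {none}ᶜ q ∧ (∀ k, q (some (some k)) = corner k) ∧
      ∀ w, q (some w) ∈ frame := by
  let z : EuclideanSpace ℝ (Fin 2) := !₂[250, 250]
  let r : Option (Fin 3) → EuclideanSpace ℝ (Fin 2) := fun w => w.elim z corner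
  have hor : ∀ i j, i ≠ j → orient z (corner i) (corner j) ≠ 0 := by
    intro i j hij
    fin_cases i <;> fin_cases j <;> first | exact absurd rfl hij | norm_num [orient, corner, z]
  have hr : Function.Injective r := by
    have hz : ∀ k, corner k ≠ z := by
      intro k h
      have := congrArg (fun x : EuclideanSpace ℝ (Fin 2) => x 0) h
      have h1 := congrArg (fun x : EuclideanSpace ℝ (Fin 2) => x 1) h
      fin_cases k <;> simp [corner, z] at this h1
    rintro (_ | i) (_ | j) h
    · rfl
    · exact absurd h.symm (hz j)
    · exact absurd h (hz i)
    · by_contra hij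
      have h : corner i = corner j := h
      refine hor i j (fun e => hij (by rw [e])) ?_
      rw [h, orient_self_right]
  have hadj : ∀ u v : Option (Fin 3), starGraph.Adj u v →
      ∃ k, (u = none ∧ v = some k) ∨ (u = some k ∧ v = none) := by
    rintro (_ | i) (_ | j) h
    · exact absurd h (SimpleGraph.irrefl _)
    · exact ⟨j, Or.inl ⟨rfl, rfl⟩⟩
    · exact ⟨i, Or.inr ⟨rfl, rfl⟩⟩
    · exact absurd h (starGraph_adj_some i j)
  have hstar : ∀ k, starGraph.Adj none (some k) := by
    intro k; simp [starGraph, SimpleGraph.fromRel_adj]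
  refine ⟨fun w => w.elim 0 r, StraightDrawing.of_edge ?_ ?_ ?_, fun k => rfl, ?_⟩
  · rintro (_ | u) hu (_ | v) hv h
    exacts [rfl, absurd rfl hu, absurd rfl hv, congrArg some (hr h)]
  · rintro (_ | _ | k) h
    · exact absurd rfl h
    · exact ⟨some (some 0), by simp, hstar 0⟩
    · exact ⟨some none, by simp, (hstar k).symm⟩
  · have key : ∀ i j, i ≠ j → ∀ x ∈ segment ℝ z (corner i), x ∈ segment ℝ z (corner j) → x = z :=
      fun i j hij x hi hj => eq_of_mem_segment_of_mem_segment (hor i j hij) hi hj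
    rintro (_ | u) hu (_ | v) hv (_ | u') hu' (_ | v') hv' huv huv' hne x hx hx'
    all_goals first | exact absurd rfl hu | exact absurd rfl hv | exact absurd rfl hu' | skip
    · exact absurd rfl hv'
    obtain ⟨i, ⟨rfl, rfl⟩ | ⟨rfl, rfl⟩⟩ := hadj u v huv <;>
    obtain ⟨j, ⟨rfl, rfl⟩ | ⟨rfl, rfl⟩⟩ := hadj u' v' huv' <;>
    · have hij : i ≠ j := by
        rintro rfl
        exact hne (by first | rfl | exact Sym2.eq_swap)
      have hx : x ∈ segment ℝ z (corner i) := by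
        first | exact hx | (rw [segment_symm]; exact hx)
      have hx' : x ∈ segment ℝ z (corner j) := by
        first | exact hx' | (rw [segment_symm]; exact hx')
      exact ⟨some none, by simp, by simp, key i j hij x hx hx'⟩
  · rintro (_ | k)
    · norm_num [frame, r, z]
    · exact corner_mem_frame k

namespace Piece

/-- The piece can be drawn in the frame, the vertices `a k` being the corners, with a triangular
hole between the vertices `p + k`. -/
def HasAnnulus (c : Piece) : Prop :=
  ∃ q, HoledDrawing (baseGraph _ c.edges) {c.y, c.x}ᶜ c.b q ∧
    (∀ k, q (c.inner (c.a k)) = corner k) ∧ ∀ u ∈ ({c.y, c.x}ᶜ : Set _), q u ∈ frame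

/-- The base graph without the vertex `p + 3` can be drawn with a triangular hole between the
vertices `p + k`. -/
def HasHoledDrawing (c : Piece) : Prop :=
  ∃ q, HoledDrawing (baseGraph _ c.edges) {c.y}ᶜ c.b q

/-- Combine drawings of a piece and of a fragment placed in its hole. -/
lemma exists_glue (c : Piece) {W : Type*} {G : SimpleGraph W} {t : Fin 3 → W}
    (ht : Function.Injective t) (hG : ∀ i j, ¬ G.Adj (t i) (t j)) {X : Set (Fin (c.p + 5))}
    (hX : c.y ∉ X) {q : Fin (c.p + 5) → EuclideanSpace ℝ (Fin 2)}
    (hq : HoledDrawing (baseGraph _ c.edges) X c.b q)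
    {r : Option W → EuclideanSpace ℝ (Fin 2)} (hr : StraightDrawing (closeGraph G t) {none}ᶜ r)
    (hrt : ∀ k, r (some (t k)) = corner k) (hrf : ∀ w, r (some w) ∈ frame) :
    ∃ s : Option (Fin c.p ⊕ W) → EuclideanSpace ℝ (Fin 2),
      StraightDrawing (closeGraph (c.extendGraph G t) (c.terminal W))
        (c.embed t (t 0) '' X ∪ Option.map Sum.inr '' {none}ᶜ) s ∧
      (∀ i, s (some (.inl i)) = q (c.inner i)) ∧
      ∀ w, s (some (.inr w)) ∈ convexHull ℝ (Set.range (q ∘ c.b)) := by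
  obtain ⟨f, hf, hfc, hff⟩ := exists_affine_frame (q ∘ c.b) hq.orient_pos
  let s : Option (Fin c.p ⊕ W) → EuclideanSpace ℝ (Fin 2) := fun v => v.elim (q c.x)
    (Sum.elim (fun i => q (c.inner i)) fun w => f (r (some w)))
  refine ⟨s, ?_, fun i => rfl, fun w => hff _ (hrf w)⟩
  refine hq.glue (c.isGluing ht hG) hX (hr.comp_affine f hf) (fun k => ?_) (fun w hw => ?_)
    (fun u hu => ?_) (fun w hw => ?_)
  · rw [Function.comp_apply, hrt, hfc, Function.comp_apply]
  · obtain ⟨w, rfl⟩ := Option.ne_none_iff_exists'.1 hw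
    exact hff _ (hrf w)
  · rcases c.cases u with ⟨i, rfl⟩ | ⟨k, rfl⟩ | rfl | rfl
    · rw [embed_inner]; rfl
    · rw [embed_b]
      show f (r (some (t k))) = q (c.b k)
      rw [hrt, hfc, Function.comp_apply]
    · exact absurd hu hX
    · rw [embed_x]; rfl
  · obtain ⟨w, rfl⟩ := Option.ne_none_iff_exists'.1 hw
    rfl

end Piece

/-- A chain of pieces, without the closing vertex, can be drawn in the frame. -/
lemma exists_chainDrawing {l : List Piece} (hl : ∀ c ∈ l, c.HasAnnulus) :
    ∃ q : Option (chain l).W → EuclideanSpace ℝ (Fin 2),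
      StraightDrawing (chainGraph l) {none}ᶜ q ∧ (∀ k, q (some ((chain l).t k)) = corner k) ∧
        ∀ w, q (some w) ∈ frame := by
  induction l with
  | nil => exact exists_starDrawing
  | cons c l ih =>
    obtain ⟨r, hr, hrt, hrf⟩ := ih fun c hc => hl c (List.mem_cons_of_mem _ hc)
    obtain ⟨q, hq, hqa, hqf⟩ := hl c List.mem_cons_self
    obtain ⟨s, hs, h1, h2⟩ := c.exists_glue (chain_t_injective l) (chain_indep l)
      (by simp) hq hr hrt hrf
    have hin : ∀ i, c.inner i ∈ ({c.y, c.x}ᶜ : Set _) := by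
      intro i
      have := i.2
      simp [Piece.inner, Piece.y, Piece.x]
      omega
    refine ⟨s, ?_, fun k => (h1 _).trans (hqa k), ?_⟩
    · suffices h : ({none}ᶜ : Set (Option (Fin c.p ⊕ (chain l).W))) = _ from h ▸ hs
      ext v
      rcases v with _ | i | w
      · refine iff_of_false (fun h => h rfl) ?_
        rintro (⟨u, hu, e⟩ | ⟨w, hw, e⟩)
        · rcases c.cases u with ⟨i, rfl⟩ | ⟨k, rfl⟩ | rfl | rfl <;> simp at e hu
        · obtain ⟨w, rfl⟩ := Option.ne_none_iff_exists'.1 hw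
          simp at e
      · exact iff_of_true (by simp) (Or.inl ⟨c.inner i, hin i, by simp⟩)
      · exact iff_of_true (by simp) (Or.inr ⟨some w, by simp, rfl⟩)
    · rintro (i | w)
      · exact (h1 i).symm ▸ hqf _ (hin i)
      · refine convexHull_min ?_ convex_frame (h2 w)
        rintro _ ⟨k, rfl⟩
        exact hqf _ (hq.corner_mem k)

/-- The graph of a chain of pieces is planar. -/
theorem isPlanarGraph_chainGraph {c : Piece} {l : List Piece} (hc : c.HasHoledDrawing)
    (hl : ∀ c ∈ l, c.HasAnnulus) : IsPlanarGraph (chainGraph (c :: l)) := by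
  obtain ⟨r, hr, hrt, hrf⟩ := exists_chainDrawing hl
  obtain ⟨q, hq⟩ := hc
  obtain ⟨s, hs, -⟩ := c.exists_glue (chain_t_injective l) (chain_indep l) (by simp) hq hr hrt hrf
  refine StraightDrawing.isPlanarGraph (q := s) ?_
  suffices h : (Set.univ : Set (Option (Fin c.p ⊕ (chain l).W))) = _ from h ▸ hs
  symm
  rw [Set.eq_univ_iff_forall]
  intro v
  exact ((c.isGluing (chain_t_injective l) (chain_indep l)).cover v).imp
    (fun ⟨u, hu, e⟩ => ⟨u, hu, e⟩) (fun ⟨w, hw, e⟩ => ⟨w, hw, e⟩)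

/-! ### Drawings given by tables -/

/-- A point of the integral grid. -/
def gridPoint (a : ℕ × ℕ) : EuclideanSpace ℝ (Fin 2) := !₂[(a.1 : ℝ), (a.2 : ℝ)]

lemma gridPoint_injective : Function.Injective gridPoint := by
  intro a b h
  have h0 := congrArg (fun x : EuclideanSpace ℝ (Fin 2) => x 0) h
  have h1 := congrArg (fun x : EuclideanSpace ℝ (Fin 2) => x 1) h
  simp only [gridPoint, Matrix.cons_val_zero, Matrix.cons_val_one, Nat.cast_inj] at h0 h1
  exact Prod.ext h0 h1

/-- The point `c` lies to the left of the line from `a` to `b`. The arithmetic is spelled out,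
without type class instances, for the sake of evaluation by the kernel. -/
def turnsLeft (a b c : ℕ × ℕ) : Bool :=
  Nat.blt (((a.2.mul b.1).add (b.2.mul c.1)).add (c.2.mul a.1))
    (((a.1.mul b.2).add (b.1.mul c.2)).add (c.1.mul a.2))

lemma turnsLeft_iff {a b c : ℕ × ℕ} :
    turnsLeft a b c = true ↔ 0 < orient (gridPoint a) (gridPoint b) (gridPoint c) := by
  rw [turnsLeft, Nat.blt_eq, ← Nat.cast_lt (α := ℝ), ← sub_pos]
  simp only [Nat.add_eq, Nat.mul_eq]
  have : orient (gridPoint a) (gridPoint b) (gridPoint c) =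
      ((a.1 * b.2 + b.1 * c.2 + c.1 * a.2 : ℕ) : ℝ) -
        ((a.2 * b.1 + b.2 * c.1 + c.2 * a.1 : ℕ) : ℝ) := by
    simp only [orient, gridPoint, Matrix.cons_val_zero, Matrix.cons_val_one]
    push_cast
    ring
  rw [this]

/-- The line through one of the segments `a b` and `c d` has the other segment strictly on one
side. -/
def separated (a b c d : ℕ × ℕ) : Bool :=
  turnsLeft a b c && turnsLeft a b d || turnsLeft b a c && turnsLeft b a d ||
    turnsLeft c d a && turnsLeft c d b || turnsLeft d c a && turnsLeft d c b

lemma separated_sound {a b c d : ℕ × ℕ} (h : separated a b c d = true)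
    {x : EuclideanSpace ℝ (Fin 2)} (hx : x ∈ segment ℝ (gridPoint a) (gridPoint b))
    (hx' : x ∈ segment ℝ (gridPoint c) (gridPoint d)) : False := by
  simp only [separated, Bool.or_eq_true, Bool.and_eq_true, turnsLeft_iff] at h
  rcases h with ((⟨h1, h2⟩ | ⟨h1, h2⟩) | ⟨h1, h2⟩) | ⟨h1, h2⟩
  · exact (orient_pos_of_mem_segment h1 h2 hx').ne' (orient_eq_zero_of_mem_segment hx)
  · exact (orient_pos_of_mem_segment h1 h2 hx').ne'
      (orient_eq_zero_of_mem_segment (mem_segment_symm hx))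
  · exact (orient_pos_of_mem_segment h1 h2 hx).ne' (orient_eq_zero_of_mem_segment hx')
  · exact (orient_pos_of_mem_segment h1 h2 hx).ne'
      (orient_eq_zero_of_mem_segment (mem_segment_symm hx'))

/-- The three points do not lie on a line. -/
def noncollinear (a b c : ℕ × ℕ) : Bool := turnsLeft a b c || turnsLeft b a c

lemma noncollinear_sound {a b c : ℕ × ℕ} (h : noncollinear a b c = true)
    {x : EuclideanSpace ℝ (Fin 2)} (hx : x ∈ segment ℝ (gridPoint a) (gridPoint b))
    (hx' : x ∈ segment ℝ (gridPoint a) (gridPoint c)) : x = gridPoint a := by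
  refine eq_of_mem_segment_of_mem_segment (fun h0 => ?_) hx hx'
  simp only [noncollinear, Bool.or_eq_true, turnsLeft_iff] at h
  rw [orient_swap (gridPoint a), h0] at h
  norm_num at h

/-- The position of the vertex `v` according to the list `L`. -/
def gridPos (L : List (ℕ × ℕ)) (v : ℕ) : ℕ × ℕ := L.getD v (0, 0)

/-- Two edges, drawn as line segments, meet at most in a common end. -/
def edgeTest (L : List (ℕ × ℕ)) (e f : EdgeRec) : Bool :=
  bif Nat.beq e.u f.u then noncollinear (gridPos L e.u) (gridPos L e.v) (gridPos L f.v)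
  else bif Nat.beq e.u f.v then noncollinear (gridPos L e.u) (gridPos L e.v) (gridPos L f.u)
  else bif Nat.beq e.v f.u then noncollinear (gridPos L e.v) (gridPos L e.u) (gridPos L f.v)
  else bif Nat.beq e.v f.v then noncollinear (gridPos L e.v) (gridPos L e.u) (gridPos L f.u)
  else separated (gridPos L e.u) (gridPos L e.v) (gridPos L f.u) (gridPos L f.v)

lemma edgeTest_sound {L : List (ℕ × ℕ)} {e f : EdgeRec} (h : edgeTest L e f = true)
    {x : EuclideanSpace ℝ (Fin 2)}
    (hx : x ∈ segment ℝ (gridPoint (gridPos L e.u)) (gridPoint (gridPos L e.v)))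
    (hx' : x ∈ segment ℝ (gridPoint (gridPos L f.u)) (gridPoint (gridPos L f.v))) :
    ∃ w, (w = e.u ∨ w = e.v) ∧ (w = f.u ∨ w = f.v) ∧ x = gridPoint (gridPos L w) := by
  simp only [edgeTest, cond_eq_ite, Nat.beq_eq] at h
  split_ifs at h with h1 h2 h3 h4
  · exact ⟨e.u, Or.inl rfl, Or.inl h1, noncollinear_sound h hx (h1 ▸ hx')⟩
  · exact ⟨e.u, Or.inl rfl, Or.inr h2,
      noncollinear_sound h hx (h2 ▸ mem_segment_symm hx')⟩
  · exact ⟨e.v, Or.inr rfl, Or.inl h3, noncollinear_sound h (mem_segment_symm hx) (h3 ▸ hx')⟩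
  · exact ⟨e.v, Or.inr rfl, Or.inr h4,
      noncollinear_sound h (mem_segment_symm hx) (h4 ▸ mem_segment_symm hx')⟩
  · exact (separated_sound h hx hx').elim

/-- The vertex `v` lies outside the triangle with the corners `p`, `p + 1`, `p + 2`, on the outer
side of the line through the corners `p + i` and `p + (i + 1)`. -/
def isOutside (p : ℕ) (L : List (ℕ × ℕ)) (i : Fin 3) (v : ℕ) : Bool :=
  turnsLeft (gridPos L (p + (i + 1 : Fin 3))) (gridPos L (p + i)) (gridPos L v)

/-- The edges of `D` between vertices below `m` other than `p + 3`. -/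
def drawnEdges (p m : ℕ) (D : List EdgeRec) : List EdgeRec :=
  D.filter fun e => decide (e.u < m ∧ e.v < m ∧ e.u ≠ p + 3 ∧ e.v ≠ p + 3)

/-- The positions in the list `L` describe a straight drawing of the edges of `D` between the
vertices below `L.length` other than `p + 3`, with a triangular hole whose corners are the vertices
`p`, `p + 1` and `p + 2`. -/
structure IsDrawingTable (p : ℕ) (D : List EdgeRec) (L : List (ℕ × ℕ)) : Prop where
  length : p + 3 ≤ L.length ∧ L.length ≤ p + 5
  nodup : L.Nodup
  cover : ∀ v < L.length, v ≠ p + 3 → ∃ e ∈ drawnEdges p L.length D,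
    (e.u = v ∧ e.v ≠ v) ∨ (e.v = v ∧ e.u ≠ v)
  pairwise : (drawnEdges p L.length D).Pairwise fun e f => edgeTest L e f = true
  hole : turnsLeft (gridPos L p) (gridPos L (p + 1)) (gridPos L (p + 2)) = true
  hole_edge : ∀ e ∈ drawnEdges p L.length D,
    (∃ i : Fin 3, isOutside p L i e.u = true ∧
      (isOutside p L i e.v = true ∨ e.v = p + i ∨ e.v = p + (i + 1 : Fin 3))) ∨
    (∃ i : Fin 3, isOutside p L i e.v = true ∧ (e.u = p + i ∨ e.u = p + (i + 1 : Fin 3))) ∨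
    (∀ k : Fin 3, turnsLeft (gridPos L e.u) (gridPos L e.v) (gridPos L (p + k)) = true) ∨
    ∀ k : Fin 3, turnsLeft (gridPos L e.v) (gridPos L e.u) (gridPos L (p + k)) = true

lemma IsDrawingTable.holedDrawing {c : Piece} {L : List (ℕ × ℕ)}
    (h : IsDrawingTable c.p c.edges L) : HoledDrawing (baseGraph (c.p + 5) c.edges)
      {u | u.1 < L.length ∧ u.1 ≠ c.p + 3} c.b (fun u => gridPoint (gridPos L u)) := by
  set E := drawnEdges c.p L.length c.edges with hE
  set q : ℕ → EuclideanSpace ℝ (Fin 2) := fun u => gridPoint (gridPos L u) with hq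
  set X : Set (Fin (c.p + 5)) := {u | u.1 < L.length ∧ u.1 ≠ c.p + 3} with hX
  have hlen := h.length
  have hinj : ∀ u < L.length, ∀ v < L.length, q u = q v → u = v := by
    intro u hu v hv e
    have e := gridPoint_injective e
    rw [gridPos, gridPos, List.getD_eq_getElem _ _ hu, List.getD_eq_getElem _ _ hv] at e
    exact (h.nodup.getElem_inj_iff).1 e
  have hedge : ∀ u ∈ X, ∀ v ∈ X, (baseGraph (c.p + 5) c.edges).Adj u v →
      ∃ e ∈ E, (e.u = u ∧ e.v = v) ∨ (e.u = v ∧ e.v = u) := by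
    intro u hu v hv huv
    obtain ⟨-, e, he, h1⟩ := edgeGraph_adj.1 huv
    refine ⟨e, List.mem_filter.2 ⟨he, ?_⟩, h1⟩
    have := hu.1; have := hu.2; have := hv.1; have := hv.2
    rw [decide_eq_true_eq]
    rcases h1 with ⟨e1, e2⟩ | ⟨e1, e2⟩ <;> rw [e1, e2] <;> tauto
  have hE' : ∀ e ∈ E, e ∈ c.edges ∧ e.u < L.length ∧ e.v < L.length ∧ e.u ≠ c.p + 3 ∧
      e.v ≠ c.p + 3 := by
    intro e he
    have := List.mem_filter.1 he
    rwa [decide_eq_true_eq] at this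
  have hb : ∀ k, c.b k ∈ X := by
    intro k
    have := k.2
    simp only [hX, Piece.b, Set.mem_ofPred_eq]
    omega
  -- The closed triangle lies to the left of the lines through its sides.
  have hside : ∀ i : Fin 3, convexHull ℝ (Set.range fun k => q (c.b k)) ⊆
      {x | 0 ≤ orient (q (c.p + i)) (q (c.p + (i + 1 : Fin 3))) x} := by
    intro i
    refine convexHull_min ?_ (convex_orient_nonneg _ _)
    have h0 := (turnsLeft_iff.1 h.hole).le
    have h1 := h0
    rw [← orient_rotate] at h1
    have h2 := h1
    rw [← orient_rotate] at h2
    rintro _ ⟨k, rfl⟩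
    rw [Set.mem_ofPred_eq]
    fin_cases i <;> fin_cases k <;>
      first | exact (orient_self_left _ _).ge | exact (orient_self_right _ _).ge | assumption
  have hout : ∀ i : Fin 3, ∀ v, isOutside c.p L i v = true →
      orient (q (c.p + i)) (q (c.p + (i + 1 : Fin 3))) (q v) < 0 := by
    intro i v hv
    rw [isOutside, turnsLeft_iff, orient_swap] at hv
    exact neg_pos.1 hv
  -- An edge with one end strictly beyond a side, and the other end beyond it or a corner
  have hone : ∀ (i : Fin 3) (u v : ℕ) (x), isOutside c.p L i u = true →
      (isOutside c.p L i v = true ∨ v = c.p + i ∨ v = c.p + (i + 1 : Fin 3)) →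
      x ∈ segment ℝ (q u) (q v) → x ∈ convexHull ℝ (Set.range fun k => q (c.b k)) →
      ∃ k : Fin 3, c.p + k = v ∧ x = q v := by
    intro i u v x hu hv hx hx'
    have hle : orient (q (c.p + i)) (q (c.p + (i + 1 : Fin 3))) (q v) ≤ 0 := by
      rcases hv with hv | rfl | rfl
      exacts [(hout i v hv).le, (orient_self_left _ _).le, (orient_self_right _ _).le]
    obtain rfl := eq_of_mem_segment_of_orient_nonneg (hout i u hu) hle hx (hside i hx')
    rcases hv with hv | rfl | rfl
    exacts [absurd (hside i hx') (hout i v hv).not_ge, ⟨i, rfl, rfl⟩, ⟨_, rfl, rfl⟩]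
  have hline : ∀ (u v : ℕ) (x),
      (∀ k : Fin 3, turnsLeft (gridPos L u) (gridPos L v) (gridPos L (c.p + k)) = true) →
      x ∈ segment ℝ (q u) (q v) → x ∉ convexHull ℝ (Set.range fun k => q (c.b k)) := by
    intro u v x huv hx hx'
    have : x ∈ {x | 0 < orient (q u) (q v) x} := by
      refine convexHull_min ?_ (convex_orient_pos _ _) hx'
      rintro _ ⟨k, rfl⟩
      exact turnsLeft_iff.1 (huv k)
    exact (ne_of_gt this) (orient_eq_zero_of_mem_segment hx)
  have hhole : ∀ e ∈ E, ∀ x ∈ segment ℝ (q e.u) (q e.v),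
      x ∈ convexHull ℝ (Set.range fun k => q (c.b k)) →
      ∃ k : Fin 3, (c.p + k = e.u ∨ c.p + k = e.v) ∧ x = q (c.p + k) := by
    intro e he x hx hx'
    rcases h.hole_edge e he with ⟨i, h1, h2⟩ | ⟨i, h1, h2⟩ | h1 | h1
    · obtain ⟨k, hk, rfl⟩ := hone i _ _ x h1 h2 hx hx'
      exact ⟨k, Or.inr hk, by rw [hk]⟩
    · obtain ⟨k, hk, rfl⟩ := hone i _ _ x h1 (Or.inr h2) (mem_segment_symm hx) hx'
      exact ⟨k, Or.inl hk, by rw [hk]⟩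
    · exact absurd hx' (hline _ _ x h1 hx)
    · exact absurd hx' (hline _ _ x h1 (mem_segment_symm hx))
  have hpair : ∀ e ∈ E, ∀ f ∈ E, e ≠ f → ∀ x ∈ segment ℝ (q e.u) (q e.v),
      x ∈ segment ℝ (q f.u) (q f.v) →
      ∃ w, (w = e.u ∨ w = e.v) ∧ (w = f.u ∨ w = f.v) ∧ x = q w := by
    have hp : E.Pairwise fun e f => ∀ x ∈ segment ℝ (q e.u) (q e.v),
        x ∈ segment ℝ (q f.u) (q f.v) →
        ∃ w, (w = e.u ∨ w = e.v) ∧ (w = f.u ∨ w = f.v) ∧ x = q w :=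
      h.pairwise.imp fun hef x hx hx' => edgeTest_sound hef hx hx'
    have : Std.Symm fun e f : EdgeRec => ∀ x ∈ segment ℝ (q e.u) (q e.v),
        x ∈ segment ℝ (q f.u) (q f.v) →
        ∃ w, (w = e.u ∨ w = e.v) ∧ (w = f.u ∨ w = f.v) ∧ x = q w := by
      refine ⟨fun e f hef x hx hx' => ?_⟩
      obtain ⟨w, h1, h2, h3⟩ := hef x hx' hx
      exact ⟨w, h2, h1, h3⟩
    exact fun e he f hf hne => hp.forall he hf hne
  have hholeX : ∀ u ∈ X, ∀ v ∈ X, (baseGraph (c.p + 5) c.edges).Adj u v →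
      ∀ x ∈ segment ℝ (q u) (q v), x ∈ convexHull ℝ (Set.range fun k => q (c.b k)) →
      ∃ k, (c.b k = u ∨ c.b k = v) ∧ x = q (c.b k) := by
    intro u hu v hv huv x hx hx'
    obtain ⟨e, he, ⟨e1, e2⟩ | ⟨e1, e2⟩⟩ := hedge u hu v hv huv
    · obtain ⟨k, hk, h2⟩ := hhole e he x (by rwa [e1, e2]) hx'
      refine ⟨k, ?_, h2⟩
      rw [e1, e2] at hk
      exact hk.imp Fin.ext Fin.ext
    · obtain ⟨k, hk, h2⟩ := hhole e he x (by rw [e1, e2]; exact mem_segment_symm hx) hx'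
      refine ⟨k, ?_, h2⟩
      rw [e1, e2] at hk
      exact hk.symm.imp Fin.ext Fin.ext
  have hcover : ∀ u ∈ X, ∃ v ∈ X, (baseGraph (c.p + 5) c.edges).Adj u v := by
    intro u hu
    obtain ⟨e, he, h1⟩ := h.cover u hu.1 hu.2
    obtain ⟨he, hu', hv', hu3, hv3⟩ := hE' e he
    rcases h1 with ⟨h1, h2⟩ | ⟨h1, h2⟩
    · exact ⟨⟨e.v, by omega⟩, ⟨hv', hv3⟩,
        edgeGraph_adj.2 ⟨fun h => h2 h.symm, e, he, Or.inl ⟨h1, rfl⟩⟩⟩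
    · exact ⟨⟨e.u, by omega⟩, ⟨hu', hu3⟩,
        edgeGraph_adj.2 ⟨fun h => h2 h.symm, e, he, Or.inr ⟨rfl, h1⟩⟩⟩
  refine ⟨StraightDrawing.of_edge ?_ hcover ?_, hb, turnsLeft_iff.1 h.hole, ?_, hholeX⟩
  · exact fun u hu v hv e => Fin.ext (hinj u hu.1 v hv.1 e)
  · intro u hu v hv u' hu' v' hv' huv huv' hne x hx hx'
    obtain ⟨e, he, h1⟩ := hedge u hu v hv huv
    obtain ⟨f, hf, h2⟩ := hedge u' hu' v' hv' huv'
    have hef : e ≠ f := by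
      rintro rfl
      refine hne (Sym2.eq_iff.2 ?_)
      simp only [Fin.ext_iff]
      omega
    have hx : x ∈ segment ℝ (q e.u) (q e.v) := by
      rcases h1 with ⟨e1, e2⟩ | ⟨e1, e2⟩ <;> rw [e1, e2]
      exacts [hx, mem_segment_symm hx]
    have hx' : x ∈ segment ℝ (q f.u) (q f.v) := by
      rcases h2 with ⟨e1, e2⟩ | ⟨e1, e2⟩ <;> rw [e1, e2]
      exacts [hx', mem_segment_symm hx']
    obtain ⟨w, hw, hw', hxw⟩ := hpair e he f hf hef x hx hx'
    obtain ⟨w, rfl⟩ : ∃ w' : Fin (c.p + 5), w'.1 = w := by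
      rcases hw with rfl | rfl
      · rcases h1 with ⟨e1, -⟩ | ⟨e1, -⟩
        exacts [⟨u, e1.symm⟩, ⟨v, e1.symm⟩]
      · rcases h1 with ⟨-, e1⟩ | ⟨-, e1⟩
        exacts [⟨v, e1.symm⟩, ⟨u, e1.symm⟩]
    refine ⟨w, ?_, ?_, hxw⟩ <;> rw [Fin.ext_iff, Fin.ext_iff] <;> omega
  · intro u hu hmem
    obtain ⟨v, hv, huv⟩ := hcover u hu
    obtain ⟨k, -, hk⟩ := hholeX u hu v hv huv _ (left_mem_segment ℝ _ _) hmem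
    exact ⟨k, Fin.ext (hinj u hu.1 _ (hb k).1 hk)⟩

lemma IsDrawingTable.hasHoledDrawing {c : Piece} {L : List (ℕ × ℕ)}
    (h : IsDrawingTable c.p c.edges L) (hlen : L.length = c.p + 5) : c.HasHoledDrawing := by
  have hset : ({c.y}ᶜ : Set (Fin (c.p + 5))) = {u | u.1 < L.length ∧ u.1 ≠ c.p + 3} := by
    ext u
    simp only [Piece.y, Set.mem_compl_iff, Set.mem_singleton_iff, Fin.ext_iff, Set.mem_ofPred_eq]
    omega
  exact ⟨_, hset ▸ h.holedDrawing⟩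

lemma IsDrawingTable.hasAnnulus {c : Piece} {L : List (ℕ × ℕ)}
    (h : IsDrawingTable c.p c.edges L) (hlen : L.length = c.p + 3)
    (ha : ∀ k, gridPos L (c.a k) = ![(0, 0), (1000, 0), (0, 1000)] k)
    (hle : ∀ a ∈ L, a.1 + a.2 ≤ 1000) : c.HasAnnulus := by
  have hset : ({c.y, c.x}ᶜ : Set (Fin (c.p + 5))) = {u | u.1 < L.length ∧ u.1 ≠ c.p + 3} := by
    ext u
    simp only [Piece.y, Piece.x, Set.mem_compl_iff, Set.mem_insert_iff, Set.mem_singleton_iff,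
      Fin.ext_iff, Set.mem_ofPred_eq]
    omega
  refine ⟨_, hset ▸ h.holedDrawing, fun k => ?_, fun u hu => ?_⟩
  · show gridPoint (gridPos L (c.a k)) = corner k
    rw [ha]
    fin_cases k <;> simp [gridPoint, corner]
  · rw [hset] at hu
    have := hle _ (List.getElem_mem hu.1)
    rw [← List.getD_eq_getElem _ (0, 0) hu.1] at this
    refine ⟨Nat.cast_nonneg _, Nat.cast_nonneg _, ?_⟩
    have : ((gridPos L u).1 : ℝ) + (gridPos L u).2 ≤ 1000 := by exact_mod_cast this
    exact this

/-! ### Levels -/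

/-- The function `d` gives the distances from the vertex `r` in the graph `G`. -/
structure IsLevel {V : Type*} (G : SimpleGraph V) (r : V) (d : V → ℕ) : Prop where
  root : d r = 0
  le : ∀ u v, G.Adj u v → d v ≤ d u + 1
  desc : ∀ v ≠ r, ∃ u, G.Adj v u ∧ d v = d u + 1

namespace IsLevel

variable {V W : Type*} {G : SimpleGraph V} {r : V} {d d' : V → ℕ}

protected lemma unique (h : IsLevel G r d) (h' : IsLevel G r d') : d = d' := by
  have key : ∀ {d d' : V → ℕ}, IsLevel G r d → IsLevel G r d' → ∀ m v, d v = m → d' v ≤ m := by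
    intro d d' h h' m
    induction m with
    | zero =>
      intro v hv
      by_cases hr : v = r
      · rw [hr, h'.root]
      · obtain ⟨u, -, hu⟩ := h.desc v hr
        omega
    | succ m ih =>
      intro v hv
      by_cases hr : v = r
      · rw [hr, h'.root]
        exact Nat.zero_le _
      · obtain ⟨u, huv, hu⟩ := h.desc v hr
        exact (h'.le u v huv.symm).trans (Nat.succ_le_succ (ih u (by omega)))
  exact funext fun v => le_antisymm (key h' h _ v rfl) (key h h' _ v rfl)

lemma comp_iso {H : SimpleGraph W} {d : W → ℕ} (e : G ≃g H) (h : IsLevel H (e r) d) :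
    IsLevel G r (d ∘ e) where
  root := h.root
  le u v huv := h.le _ _ (e.map_adj_iff.2 huv)
  desc v hv := by
    obtain ⟨u, hu, h1⟩ := h.desc (e v) (e.injective.ne hv)
    exact ⟨e.symm u, by rwa [← e.map_adj_iff, e.apply_symm_apply], by simpa using h1⟩

/-- An isomorphism of rooted graphs preserves the sizes of the levels. -/
lemma ncard_eq {H : SimpleGraph W} {s : W} {d' : W → ℕ} (h : IsLevel G r d) (h' : IsLevel H s d')
    (e : G ≃g H) (he : e r = s) (m : ℕ) : {v | d v = m}.ncard = {w | d' w = m}.ncard := by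
  subst he
  rw [h.unique (h'.comp_iso e)]
  exact Set.ncard_congr (fun v _ => e v) (fun v hv => hv) (fun u v _ _ huv => e.injective huv)
    (fun w hw => ⟨e.symm w, by simpa using hw, by simp⟩)

end IsLevel

/-- The distances from the closing vertex in the graph of a chain of pieces. -/
def chainLevel : (l : List Piece) → (chain l).W → ℕ
  | [] => fun w : Option (Fin 3) => w.elim 2 fun _ => 1
  | c :: l => Sum.elim (fun i : Fin c.p => c.level i) fun w => chainLevel l w + 7

lemma chainLevel_t (l : List Piece) (k : Fin 3) : chainLevel l ((chain l).t k) = 1 := by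
  cases l with
  | nil => rfl
  | cons c l => exact c.level_a k

lemma isLevel_chainGraph (l : List Piece) :
    IsLevel (chainGraph l) none fun v => v.elim 0 (chainLevel l) := by
  have hclose : ∀ l : List Piece, (∀ w w', (chain l).G.Adj w w' →
      chainLevel l w' ≤ chainLevel l w + 1) → (∀ w, (∃ k, w = (chain l).t k) ∨
        ∃ w', (chain l).G.Adj w w' ∧ chainLevel l w = chainLevel l w' + 1) →
      IsLevel (chainGraph l) none fun v => v.elim 0 (chainLevel l) := by
    intro l h1 h2
    refine ⟨rfl, ?_, ?_⟩
    · rintro (_ | w) (_ | w') h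
      · exact Nat.zero_le _
      · obtain ⟨k, rfl⟩ := h
        exact (chainLevel_t l k).le
      · exact Nat.zero_le _
      · exact h1 w w' h
    · rintro (_ | w) h
      · exact absurd rfl h
      · rcases h2 w with ⟨k, rfl⟩ | ⟨w', h, e⟩
        · exact ⟨none, ⟨k, rfl⟩, chainLevel_t l k⟩
        · exact ⟨some w', h, e⟩
  induction l with
  | nil =>
    refine hclose [] ?_ ?_
    · rintro (_ | i) (_ | j) - <;> simp [chainLevel]
    · rintro (_ | i)
      · refine Or.inr ⟨some 0, ?_, rfl⟩
        simp [chain, starGraph, SimpleGraph.fromRel_adj]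
      · exact Or.inl ⟨i, rfl⟩
  | cons c l ih =>
    have hadj : ∀ u v, (edgeGraph c.edges).Adj u v → u < c.p + 3 → v < c.p + 3 →
        c.level v ≤ c.level u + 1 := by
      intro u v huv hu hv
      obtain ⟨-, e, he, ⟨rfl, rfl⟩ | ⟨rfl, rfl⟩⟩ := edgeGraph_adj.1 huv
      exacts [(c.level_le e he hu hv).2, (c.level_le e he hv hu).1]
    have hdesc : ∀ u < c.p + 3, c.level u ≠ 1 → ∃ v < c.p + 3, (edgeGraph c.edges).Adj u v ∧
        c.level u = c.level v + 1 := by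
      intro u hu h
      obtain ⟨e, he, ⟨h1, h2, h3⟩ | ⟨h1, h2, h3⟩⟩ := c.level_desc u hu h
      · exact ⟨e.v, h2, edgeGraph_adj.2 ⟨fun h => by rw [h] at h3; omega, e, he, Or.inl ⟨h1, rfl⟩⟩,
          h3⟩
      · exact ⟨e.u, h2, edgeGraph_adj.2 ⟨fun h => by rw [h] at h3; omega, e, he, Or.inr ⟨rfl, h1⟩⟩,
          h3⟩
    refine hclose (c :: l) ?_ ?_
    · rintro (i | w) (j | w') h
      · exact hadj i j h (by omega) (by omega)
      · obtain ⟨k, rfl, h⟩ := h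
        have := hadj i (c.p + k) h (by omega) (by omega)
        rw [c.level_b] at this
        simpa [chainLevel, chainLevel_t] using this
      · obtain ⟨k, rfl, h⟩ := h
        have := hadj (c.p + k) j h.symm (by omega) (by omega)
        rw [c.level_b] at this
        simpa [chainLevel, chainLevel_t] using this
      · have : chainLevel l w' ≤ chainLevel l w + 1 := ih.le (some w) (some w') h
        show chainLevel l w' + 7 ≤ chainLevel l w + 7 + 1
        omega
    -- The lower neighbour in the base graph, with the vertices `p + k` replaced by terminals
    · have hlow : ∀ u < c.p + 3, c.level u ≠ 1 → ∀ v : Fin c.p ⊕ (chain l).W,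
          (∀ i : Fin c.p, (edgeGraph c.edges).Adj u i →
            (c.extendGraph (chain l).G (chain l).t).Adj v (.inl i)) →
          (∀ k : Fin 3, (edgeGraph c.edges).Adj u (c.p + k) →
            (c.extendGraph (chain l).G (chain l).t).Adj v (.inr ((chain l).t k))) →
          ∃ w, (chain (c :: l)).G.Adj v w ∧ c.level u = chainLevel (c :: l) w + 1 := by
        intro u hu h v h1 h2
        obtain ⟨u', hu', h3, h4⟩ := hdesc u hu h
        by_cases hp : u' < c.p
        · exact ⟨.inl ⟨u', hp⟩, h1 ⟨u', hp⟩ h3, h4⟩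
        · obtain ⟨k, rfl⟩ : ∃ k : Fin 3, u' = c.p + k := ⟨⟨u' - c.p, by omega⟩, by simp; omega⟩
          refine ⟨.inr ((chain l).t k), h2 k h3, ?_⟩
          rw [h4, c.level_b]
          simp [chainLevel, chainLevel_t]
      rintro (i | w)
      · by_cases hi : c.level i = 1
        · obtain ⟨k, rfl⟩ := c.eq_a i hi
          exact Or.inl ⟨k, rfl⟩
        · exact Or.inr (hlow i (by omega) hi (.inl i) (fun j h => h) (fun k h => ⟨k, rfl, h⟩))
      · right
        by_cases hw : ∃ k, w = (chain l).t k
        · obtain ⟨k, rfl⟩ := hw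
          obtain ⟨w', h1, h2⟩ := hlow (c.p + k) (by omega) (by rw [c.level_b]; decide)
            (.inr ((chain l).t k)) (fun j h => ⟨k, rfl, h.symm⟩)
            (fun j h => absurd h (c.b_indep k j))
          refine ⟨w', h1, ?_⟩
          rw [← h2, c.level_b]
          simp [chainLevel, chainLevel_t]
        · obtain ⟨_ | w', h1, h2⟩ := ih.desc (some w) (by simp)
          · exact absurd h1 hw
          · exact ⟨.inr w', h1, congrArg (· + 7) h2⟩

/-- The number of vertices at distance `m` from the closing vertex of a chain. -/
noncomputable def levelCard (l : List Piece) (m : ℕ) : ℕ := {w | chainLevel l w = m}.ncard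

/-- The number of vertices of a piece at distance `m`, not counting the vertices `p + k`. -/
noncomputable def Piece.levelCard (c : Piece) (m : ℕ) : ℕ := {i : Fin c.p | c.level i = m}.ncard

lemma ncard_sum_elim_eq {α β : Type*} [Finite α] [Finite β] (f : α → ℕ) (g : β → ℕ) (m : ℕ) :
    {v : α ⊕ β | Sum.elim f g v = m}.ncard = {i | f i = m}.ncard + {w | g w = m}.ncard := by
  have hset : {v : α ⊕ β | Sum.elim f g v = m} =
      Sum.inl '' {i | f i = m} ∪ Sum.inr '' {w | g w = m} := by
    ext (i | w) <;> simp
  rw [hset, Set.ncard_union_eq _ (Set.toFinite _) (Set.toFinite _),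
    Set.ncard_image_of_injective _ Sum.inl_injective,
    Set.ncard_image_of_injective _ Sum.inr_injective]
  rw [Set.disjoint_left]
  rintro _ ⟨i, -, rfl⟩ ⟨w, -, h⟩
  exact Sum.inr_ne_inl h

lemma levelCard_cons (c : Piece) (l : List Piece) (m : ℕ) :
    levelCard (c :: l) m = c.levelCard m + {w | chainLevel l w + 7 = m}.ncard :=
  ncard_sum_elim_eq _ _ m

lemma levelCard_eq_of_iso {l l' : List Piece} (e : chainGraph l ≃g chainGraph l')
    (he : e none = none) (m : ℕ) : levelCard l (m + 1) = levelCard l' (m + 1) := by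
  have key : ∀ l : List Piece, {v : Option (chain l).W | v.elim 0 (chainLevel l) = m + 1}.ncard =
      levelCard l (m + 1) := by
    intro l
    rw [levelCard, ← Set.ncard_image_of_injective {w | chainLevel l w = m + 1}
      (Option.some_injective _)]
    refine congrArg Set.ncard (Set.ext ?_)
    rintro (_ | w) <;> simp
  rw [← key, ← key]
  exact (isLevel_chainGraph l).ncard_eq (isLevel_chainGraph l') e he _

/-- If two pieces have different numbers of vertices at distance 2 from the root, then chains of
these two pieces can be decoded from the sizes of the levels. -/
lemma eq_of_levelCard_eq {f : Bool → Piece} (hf : (f false).levelCard 2 ≠ (f true).levelCard 2) :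
    ∀ {l l' : List Bool}, l.length = l'.length →
      (∀ m, levelCard (l.map f) (m + 1) = levelCard (l'.map f) (m + 1)) → l = l'
  | [], [], _, _ => rfl
  | b :: l, b' :: l', hlen, h => by
    have hb : b = b' := by
      have h2 := h 1
      have h0 : ∀ l : List Piece, {w | chainLevel l w + 7 = 1 + 1} = ∅ := by
        intro l
        ext w
        simp
      simp only [List.map_cons, levelCard_cons, h0, Set.ncard_empty] at h2
      cases b <;> cases b' <;> first | rfl | exact absurd h2 (by simpa using hf) |
        exact absurd h2 (by simpa using hf.symm)
    subst hb
    congr 1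
    refine eq_of_levelCard_eq hf (by simpa using hlen) fun m => ?_
    have := h (m + 7)
    simp only [List.map_cons, levelCard_cons] at this
    have h7 : ∀ l : List Piece, {w | chainLevel l w + 7 = m + 7 + 1} =
        {w | chainLevel l w = m + 1} := by
      intro l
      ext w
      simp only [Set.mem_ofPred_eq]
      omega
    rw [h7, h7] at this
    exact Nat.add_left_cancel this

/-! ### Counting isomorphism classes -/

lemma numGraphsUpToIso_mono {n : ℕ} {P Q : SimpleGraph (Fin n) → Prop} (h : ∀ G, P G → Q G) :
    numGraphsUpToIso n P ≤ numGraphsUpToIso n Q :=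
  Set.ncard_le_ncard (Set.image_mono h) (Set.toFinite _)

/-- Graphs that are pairwise non-isomorphic as rooted graphs represent at least as many isomorphism
classes as their number divided by the order, the number of choices for the root. -/
lemma card_le_numGraphsUpToIso_mul {ι : Type*} [Finite ι] {n : ℕ}
    {P : SimpleGraph (Fin n) → Prop} (H : ι → SimpleGraph (Fin n)) (root : ι → Fin n)
    (hP : ∀ i, P (H i)) (hiso : ∀ i j (e : H i ≃g H j), e (root i) = root j → i = j) :
    Nat.card ι ≤ numGraphsUpToIso n P * n := by
  let C : Set (Quotient (graphIsoSetoid n)) := Quotient.mk (graphIsoSetoid n) '' {G | P G}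
  have hout : ∀ i, Nonempty (H i ≃g (Quotient.mk (graphIsoSetoid n) (H i)).out) := fun i =>
    (graphIsoSetoid n).symm (Quotient.mk_out (s := graphIsoSetoid n) (H i))
  let e : ∀ i, H i ≃g (Quotient.mk (graphIsoSetoid n) (H i)).out := fun i => (hout i).some
  let F : ι → C × Fin n := fun i => (⟨Quotient.mk _ (H i), H i, hP i, rfl⟩, e i (root i))
  have hF : Function.Injective F := by
    intro i j hij
    have h1 : Quotient.mk (graphIsoSetoid n) (H i) = Quotient.mk (graphIsoSetoid n) (H j) :=
      congrArg (fun z => z.1.1) hij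
    have h2 : e i (root i) = e j (root j) := congrArg Prod.snd hij
    have key : ∀ q : Quotient (graphIsoSetoid n), Quotient.mk (graphIsoSetoid n) (H i) = q →
        ∀ f : H j ≃g q.out, e i (root i) = f (root j) → i = j := by
      rintro _ rfl f hf
      refine hiso i j ((e i).trans f.symm) ?_
      show f.symm (e i (root i)) = root j
      rw [hf, f.symm_apply_apply]
    exact key _ h1 (e j) h2
  calc Nat.card ι ≤ Nat.card (C × Fin n) := Nat.card_le_card_of_injective F hF
    _ = numGraphsUpToIso n P * n := by
      rw [Nat.card_prod, Nat.card_coe_set_eq, Nat.card_fin]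
      rfl

/-- Distinct words of the same length over two pieces yield graphs that are pairwise non-isomorphic
as rooted graphs. The additional first piece is the one with a drawing that leaves room for the
closing vertex. -/
lemma card_words_le {f : Bool → Piece} (hf : (f false).levelCard 2 ≠ (f true).levelCard 2)
    (h0 : (f false).HasHoledDrawing) (h : ∀ b, (f b).HasAnnulus) {ι : Type*} [Finite ι]
    {w : ι → List Bool} (hw : Function.Injective w) {m n : ℕ} (hlen : ∀ i, (w i).length = m)
    (hn : ∀ i, (f false).p + ((w i).map fun b => (f b).p).sum + 5 = n) :
    Nat.card ι ≤ numGraphsUpToIso n (fun G => IsPlanarGraph G ∧ IsHypohamiltonian G ∧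
      IsK2Hamiltonian G) * n := by
  let l : ι → List Piece := fun i => (false :: w i).map f
  have hcard : ∀ i, Nat.card (Option (chain (l i)).W) = n := by
    intro i
    rw [Finite.card_option, card_chain, ← hn i]
    simp only [l, List.map_cons, List.sum_cons, List.map_map]
    rfl
  let σ : ∀ i, Option (chain (l i)).W ≃ Fin n := fun i => Finite.equivFinOfCardEq (hcard i)
  let H : ι → SimpleGraph (Fin n) := fun i => (chainGraph (l i)).comap (σ i).symm
  let τ : ∀ i, H i ≃g chainGraph (l i) := fun i => SimpleGraph.Iso.comap (σ i).symm _
  refine card_le_numGraphsUpToIso_mul H (fun i => σ i none) (fun i => ?_) (fun i j e he => ?_)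
  · have hgood : IsGood (H i) := (isGood_chainGraph (by simp [l])).of_iso (τ i).symm
    refine ⟨IsPlanarGraph.of_iso (τ i) (isPlanarGraph_chainGraph h0 ?_), hgood.isHypohamiltonian,
      hgood.isK2Hamiltonian⟩
    intro c hc
    obtain ⟨b, -, rfl⟩ := List.mem_map.1 hc
    exact h b
  · have hτ : ∀ i, τ i (σ i none) = none := fun i => (σ i).symm_apply_apply none
    have hτ' : ∀ i, (τ i).symm none = σ i none := fun i => rfl
    refine hw (List.cons_injective (a := false) ?_)
    refine eq_of_levelCard_eq hf (by simp [hlen]) fun m =>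
      levelCard_eq_of_iso (((τ i).symm.trans e).trans (τ j)) ?_ m
    show τ j (e ((τ i).symm none)) = none
    rw [hτ', he, hτ]

/-! ### Counting words -/

/-- The word in which every letter `b` of `s` is replaced by `b` and its negation, followed by `i`
times `false` and `j` times `true`. The numbers of letters of either kind depend only on the length
of `s`. -/
def paddedWord (s : List Bool) (i j : ℕ) : List Bool :=
  s.flatMap (fun b => [b, !b]) ++ (List.replicate i false ++ List.replicate j true)

lemma length_paddedWord (s : List Bool) (i j : ℕ) :
    (paddedWord s i j).length = 2 * s.length + (i + j) := by
  induction s with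
  | nil => simp [paddedWord]
  | cons b s ih =>
    simp only [paddedWord, List.flatMap_cons, List.append_assoc, List.length_append] at ih ⊢
    simp only [List.length_cons, List.length_nil]
    omega

lemma sum_paddedWord (g : Bool → ℕ) (s : List Bool) (i j : ℕ) :
    ((paddedWord s i j).map g).sum = s.length * (g false + g true) + i * g false + j * g true := by
  induction s with
  | nil => simp [paddedWord]
  | cons b s ih =>
    have : ((paddedWord (b :: s) i j).map g).sum =
        g b + g (!b) + ((paddedWord s i j).map g).sum := by
      simp [paddedWord, add_assoc]
    rw [this, ih, List.length_cons]
    cases b <;> simp <;> ring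

lemma paddedWord_injective {s s' : List Bool} (hlen : s.length = s'.length) {i j : ℕ}
    (h : paddedWord s i j = paddedWord s' i j) : s = s' := by
  have h := List.append_cancel_right h
  induction s generalizing s' with
  | nil => exact (List.length_eq_zero_iff.1 hlen.symm).symm
  | cons b s ih =>
    cases s' with
    | nil => simp at hlen
    | cons b' s' =>
      simp only [List.flatMap_cons, List.cons_append, List.cons.injEq, List.nil_append] at h
      rw [h.1, ih (by simpa using hlen) (by simpa [paddedWord] using h.2.2) h.2.2]

/-- Two planar pieces with 88 and 91 vertices that are distinguished by their levels yield
exponentially many isomorphism classes. -/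
theorem two_pow_le_numGraphsUpToIso_mul {f : Bool → Piece}
    (hf : (f false).levelCard 2 ≠ (f true).levelCard 2)
    (h0 : (f false).HasHoledDrawing) (h : ∀ b, (f b).HasAnnulus)
    (hp : (f false).p = 88) (hp' : (f true).p = 91) {n : ℕ} (hn : 20000 ≤ n) :
    2 ^ (n / 400) ≤ numGraphsUpToIso n (fun G => IsPlanarGraph G ∧ IsHypohamiltonian G ∧
      IsK2Hamiltonian G) * n := by
  set k := n / 400 with hk
  -- The part of the order left to `i` and `j` is at least `88 * 91`, and `59` is the inverse of `91`
  -- modulo `88`.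
  obtain ⟨i, j, hij⟩ : ∃ i j, 88 + (k * (88 + 91) + i * 88 + j * 91) + 5 = n := by
    refine ⟨(n - 93 - 179 * k - 91 * (59 * (n - 93 - 179 * k) % 88)) / 88,
      59 * (n - 93 - 179 * k) % 88, ?_⟩
    omega
  have := card_words_le hf h0 h (ι := List.Vector Bool k) (w := fun s => paddedWord s.1 i j)
    (fun s s' e => Subtype.ext (paddedWord_injective (s.2.trans s'.2.symm) e))
    (m := 2 * k + (i + j)) (n := n) (fun s => by rw [length_paddedWord, s.2]) (fun s => by
      rw [sum_paddedWord (fun b => (f b).p), s.2, hp, hp', hij])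
  rwa [Nat.card_eq_fintype_card, card_vector, Fintype.card_bool] at this

/-- A sequence that is at least `2 ^ (n / 400) / n` grows exponentially. -/
lemma exists_pow_le_of_two_pow_le {a : ℕ → ℕ} {N : ℕ}
    (h : ∀ n ≥ N, 2 ^ (n / 400) ≤ a n * n) : ∃ c : ℝ, 1 < c ∧ ∀ᶠ n : ℕ in atTop, c ^ n ≤ a n := by
  obtain ⟨c, hc, hc2⟩ : ∃ c : ℝ, 1 < c ∧ c ^ 800 = 2 := by
    refine ⟨2 ^ (1 / 800 : ℝ), Real.one_lt_rpow (by norm_num) (by norm_num), ?_⟩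
    rw [← Real.rpow_natCast, ← Real.rpow_mul (by norm_num)]
    norm_num
  have hlim := tendsto_pow_const_div_const_pow_of_one_lt 1 hc
  refine ⟨c, hc, ?_⟩
  filter_upwards [eventually_ge_atTop N, eventually_gt_atTop 0,
    hlim.eventually (gt_mem_nhds (show (0 : ℝ) < 1 / 2 by norm_num))] with n hn hpos hsmall
  have hn0 : (0 : ℝ) < n := by exact_mod_cast hpos
  have hcn : 0 < c ^ n := by positivity
  have h2n : 2 * n ≤ c ^ n := by
    rw [pow_one, div_lt_iff₀ hcn] at hsmall
    linarith
  have hk : (2 : ℝ) ^ (n / 400) ≤ a n * n := by exact_mod_cast h n hn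
  have h1 : c ^ n * c ^ n ≤ 2 * 2 ^ (n / 400) := by
    rw [← pow_succ', ← hc2, ← pow_mul, ← pow_add]
    exact pow_le_pow_right₀ hc.le (by omega)
  refine le_of_mul_le_mul_right ?_ hn0
  have : c ^ n * (2 * n) ≤ c ^ n * c ^ n := by gcongr
  linarith

/-! ### The two base graphs -/

/-- The edges of the base graph `A`. -/
def edgesA : List EdgeRec := [
  ⟨0, 1, 46, 47⟩, ⟨0, 2, 47, 53⟩, ⟨1, 3, 1, 46⟩, ⟨1, 4, 1, 47⟩, ⟨2, 5, 42, 53⟩, ⟨2, 6, 42, 47⟩,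
  ⟨3, 7, 1, 52⟩, ⟨3, 8, 46, 52⟩, ⟨4, 9, 1, 41⟩, ⟨5, 10, 36, 53⟩, ⟨5, 11, 36, 42⟩,
  ⟨6, 12, 41, 42⟩, ⟨7, 13, 1, 48⟩, ⟨7, 14, 48, 52⟩, ⟨8, 15, 50, 52⟩, ⟨8, 16, 46, 50⟩,
  ⟨9, 17, 31, 41⟩, ⟨9, 18, 1, 31⟩, ⟨10, 19, 26, 36⟩, ⟨10, 20, 26, 51⟩, ⟨11, 21, 35, 36⟩,
  ⟨13, 22, 1, 11⟩, ⟨13, 23, 11, 48⟩, ⟨14, 24, 48, 49⟩, ⟨15, 25, 49, 50⟩, ⟨16, 26, 45, 46⟩,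
  ⟨16, 27, 45, 50⟩, ⟨17, 28, 31, 35⟩, ⟨18, 29, 1, 23⟩, ⟨18, 30, 23, 31⟩, ⟨19, 31, 27, 30⟩,
  ⟨19, 32, 26, 27⟩, ⟨20, 33, 29, 51⟩, ⟨20, 34, 20, 26⟩, ⟨20, 35, 20, 29⟩, ⟨22, 36, 0, 11⟩,
  ⟨23, 37, 11, 43⟩, ⟨24, 38, 43, 49⟩, ⟨26, 39, 40, 46⟩, ⟨26, 40, 40, 45⟩, ⟨27, 41, 44, 45⟩,
  ⟨28, 42, 25, 30⟩, ⟨29, 43, 0, 23⟩, ⟨30, 44, 23, 25⟩, ⟨31, 45, 13, 27⟩, ⟨31, 46, 13, 24⟩,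
  ⟨32, 47, 19, 27⟩, ⟨33, 48, 29, 39⟩, ⟨33, 49, 39, 51⟩, ⟨34, 50, 19, 20⟩, ⟨35, 51, 15, 29⟩,
  ⟨35, 52, 15, 20⟩, ⟨37, 53, 7, 43⟩, ⟨38, 54, 37, 44⟩, ⟨39, 55, 39, 40⟩, ⟨40, 56, 38, 40⟩,
  ⟨42, 57, 24, 25⟩, ⟨43, 58, 0, 18⟩, ⟨45, 59, 9, 13⟩, ⟨45, 60, 9, 21⟩, ⟨46, 61, 14, 24⟩,
  ⟨46, 62, 13, 14⟩, ⟨47, 63, 19, 21⟩, ⟨48, 64, 29, 34⟩, ⟨51, 65, 4, 29⟩, ⟨51, 66, 4, 15⟩,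
  ⟨52, 67, 15, 16⟩, ⟨53, 68, 32, 37⟩, ⟨53, 69, 7, 32⟩, ⟨54, 70, 37, 38⟩, ⟨56, 71, 33, 34⟩,
  ⟨58, 72, 0, 14⟩, ⟨59, 73, 8, 9⟩, ⟨60, 74, 9, 10⟩, ⟨60, 75, 10, 21⟩, ⟨64, 76, 28, 29⟩,
  ⟨65, 77, 17, 29⟩, ⟨65, 78, 4, 17⟩, ⟨68, 79, 32, 33⟩, ⟨69, 80, 12, 22⟩, ⟨69, 81, 22, 32⟩,
  ⟨69, 82, 7, 12⟩, ⟨72, 83, 0, 8⟩, ⟨78, 84, 6, 17⟩, ⟨78, 85, 4, 6⟩, ⟨82, 86, 3, 12⟩,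
  ⟨83, 87, 0, 4⟩, ⟨36, 88, 0, 5⟩, ⟨37, 89, 5, 7⟩, ⟨85, 90, 2, 6⟩, ⟨88, 91, 2, 5⟩,
  ⟨0, 92, 46, 53⟩, ⟨22, 29, 0, 1⟩, ⟨87, 88, 0, 2⟩, ⟨90, 91, 2, 3⟩, ⟨85, 87, 2, 4⟩,
  ⟨89, 91, 3, 5⟩, ⟨86, 90, 3, 6⟩, ⟨82, 89, 3, 7⟩, ⟨73, 83, 4, 8⟩, ⟨73, 74, 4, 9⟩,
  ⟨66, 74, 4, 10⟩, ⟨36, 37, 5, 11⟩, ⟨84, 86, 6, 12⟩, ⟨59, 62, 8, 13⟩, ⟨62, 72, 8, 14⟩,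
  ⟨66, 67, 10, 15⟩, ⟨67, 75, 10, 16⟩, ⟨80, 84, 12, 17⟩, ⟨58, 61, 14, 18⟩, ⟨50, 63, 16, 19⟩,
  ⟨50, 52, 16, 20⟩, ⟨63, 75, 16, 21⟩, ⟨77, 80, 17, 22⟩, ⟨43, 44, 18, 23⟩, ⟨57, 61, 18, 24⟩,
  ⟨44, 57, 18, 25⟩, ⟨32, 34, 19, 26⟩, ⟨45, 47, 21, 27⟩, ⟨76, 81, 22, 28⟩, ⟨76, 77, 22, 29⟩,
  ⟨31, 42, 24, 30⟩, ⟨28, 30, 25, 31⟩, ⟨79, 81, 28, 32⟩, ⟨71, 79, 28, 33⟩, ⟨64, 71, 28, 34⟩,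
  ⟨21, 28, 30, 35⟩, ⟨19, 21, 30, 36⟩, ⟨68, 70, 33, 37⟩, ⟨56, 70, 33, 38⟩, ⟨48, 55, 34, 39⟩,
  ⟨55, 56, 34, 40⟩, ⟨12, 17, 35, 41⟩, ⟨11, 12, 35, 42⟩, ⟨38, 53, 37, 43⟩, ⟨41, 54, 38, 44⟩,
  ⟨40, 41, 38, 45⟩, ⟨39, 49, 39, 46⟩, ⟨4, 6, 41, 47⟩, ⟨23, 24, 43, 48⟩, ⟨25, 38, 44, 49⟩,
  ⟨25, 27, 44, 50⟩, ⟨49, 92, 46, 51⟩, ⟨14, 15, 49, 52⟩, ⟨10, 92, 51, 53⟩]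

/-- The neighbours in the base graph `A`, coded as for `nbr`. -/
def nbrTableA : ℕ :=
  22833742883968973062670985833194722303687150807800601224283604284794992489453921576648096872598413701404514766560934262834537701314267388839742854003288133783216530391121197847459922307010994272129791590802159748434222673290994057741597395865014864632314873560107044587184771404890311113845609295653445297309070786875126215292632832404070609813166112872075192003544181822121200690366234579617682287276847224956128728575757374301791036540931402891127040356895401845209304575175870631869133909023500421549261124993147889280339807263126931033633332435848686759127286334950889652302299145221705819177579433365472109641650567491051291088529544711900046783214249569841417286110098829720087592717052109832408822905873371498466676583361108189175717855845110980596538696544312545893510742273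

/-- Codes of cycles that avoid exactly one vertex of `A`. -/
def vertexCyclesA : List ℕ := [
  64381176431325318878602949487393847811344719326560953090,
  52229083347963449854767928277947783017563693287828310659,
  4378498158122175725850574174679299483404786876453757701,
  61571181822409493116424134861137219532066153464784573704,
  3855951857955260682436026324084761342566895922140727937,
  895819595257854990014187114570285990986641705257961464578,
  1569498871141154977852413970727222807030865899957413489412,
  307314072691571804774600659671737648453264082534941938317,
  825298438984307840433863297490271024401351057137631840899,
  841785286821830206940157448353086645608456182223493181956,
  1827959087033096021563846024834351106244289718235411728988,
  838474621307343167420813305650296051280634443677276866837,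
  1805328128813079686165375936523615204954407753069541664902,
  30957217890903270482649375102191977362522874016858689686,
  789239061910512967663381638764987315070818775140561390215,
  210462643848397382768665926997159032460796795907035310606,
  1778512456458795479042640364538918422389404625984557730952,
  834180543082010526948501919226116546556746097432569106956,
  2076220182552259206657514259404965842611297391075375949086,
  296330054045325149631653723372279590233150177106568303776,
  294522422552517080170896582643259328954255220564013831330,
  1031398170759020847452862060118572456956445712146634911755,
  1031800812268119837253222885791946932850514094339662816013,
  466124289600499581445369885326328752731430389980114616856,
  4231326581276677392886115247138689939426649481941832215,
  299220506421117680067777403811369012785433218876266719259,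
  50265743474248397947606477336112636530816250022932632080,
  63329246758357423767220177349888039835445018673938219024,
  2074427289419902031050220173950359759313641173005158391825,
  230133689468474912697005566160251735086919755655919176726,
  2035229662130681607603529790810389616980858501902863745682,
  2875883715504120035370909134823484405314901045466628096810,
  1582321784022380809510513661561553810703960293474693391650,
  375091440071136317201715643684484188372626312710606440624,
  2667308750863141839940985735779713285448605739001768848672,
  314030384389528242648850295740529562820345600272178631347,
  1029853870335549204520299350877468008029461750634692911254,
  123828665054373284914299099855402684197844530484981280804,
  838733321306650368166952873291820603547045033776027349017,
  2222169622521507386025607178438298201758142304314126780977,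
  1827170207933379903308461047584746217048052972783878057257,
  1570524581219027629632251737523927053961324496295787004059,
  2091145971494311337210880873308186063112878300838894076217,
  1293498076878606439979260996272464507614693263957130097821,
  1767419355963139142718347247186930542049016408972714366251,
  210210986060342070881188869263732861458873308580730643643,
  1306896289896990532102094331307544126474836773139241817278,
  2406863315866896967180351758559316552466450577414584095904,
  1250517608373599785818369356596003556223601036367043482401,
  2367466236868923400012730141639435658205822074703408613980,
  1582393244238695701979855354812690675990586706384013776034,
  1129196155641657604544539990456124124751015292465272982722,
  2366959600078152811075157307382713698219792517384627112611,
  505755160252562806203220532212532102616397137801607160004,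
  2040050884196025022467827346137222577927081256146985889094,
  1000387582031184160964388820488897385618846964191262460071,
  1891100791277791509845096106687575948867906962858770466984,
  788170673265764880985966456632819098774570465871547911229,
  75435478242699897114941224739761573589022828483139777224,
  1942881158187669009405327478916400219097080029566915974473,
  1295779710864791833437350563352055801916868922448307634378,
  2582746858388823786319653976037795714374892480429598192430,
  75311736755791712705856635207901108440293915571576930888,
  813296632842213437619693763639057544199748351293211161135,
  1052889191527838139638701552736935949332322110615262137676,
  1376394744025841518907267722430547037320697693053299860275,
  79370998278908303832919023407982624716662044212966118451,
  1785801041652325864615020708564831470370784917976213955906,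
  2026271587642615384246253959747113067779737494485485159119,
  1450055080575721827547813173188387546930269081020115725010,
  1601683135266630102823592711880465450822263006843492115268,
  2091857653692400583129272380865429328250946161505100104527,
  2014109327678845760556829126721121499339899663788282481338,
  313519566198383972910034953400966100577768573158233246291,
  2689774101667993378097879149059298943955518355138963442492,
  2109999816149721833283976341913519292241506153466657294531,
  1679876012758085872716622747138212929821989511787496638801,
  804019568831487927106743095664243199779122485624692736336,
  1306887606682563980100555666511962834350502578009371968853,
  1589827591125454683476201091269181404216504419759457044689,
  818077303023108952741207989543903810398128130496052019540,
  2280548697174107732573448466117955313203848304655496913487,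
  2362672295658924724507752417802804381157928670931138675033,
  1287423651603031027997635326331230956875148714447156720855,
  918399662550966019543191618534765852923408850114405728976,
  1290757203555504278940977711499122848574095234718204461143,
  2487546314177114915293480582620367077883032022577379054930,
  522312412848665637005451595877421439384875237540820615253,
  910508064987488324881399338324965489387836213068567728676,
  2092331073997944706900994306523030801238674674445876199771,
  1977944702486385108465753959585294021899078580851032762581,
  1991605426125091157927298804840905275017687012920383017178,
  1766588002608834908466866367377825134098947396088743939249]

/-- Codes of cycles that avoid exactly the ends of one edge of `A`. -/
def edgeCyclesA : List ℕ := [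
  295489020789618974001347085381122531879511971573446028036,
  76940603357910857550274025730814573237249623317976143109,
  61304690200620204570327109221183423519965662874782846087,
  122870026765675540299748759268882092889704836077686764672,
  306571204075635896938170148753774912636995844497830601483,
  15450696447508780668746447868928171242116128411601605381,
  1736984149693549863425939368038784911015087447663497729,
  3145491805281452470936330655468604836706201324321645328,
  19540582783478450389512787641402027353662949858932438162,
  257849530748758528021381784024534472068799009122870975243,
  326649079778940669013137121792005439265602614385856564885,
  129723373154954297111885577690532164200094737458786934801,
  50312054304871255885040898967275333159140598902507490446,
  127401600265569382965087942685952202961621118813913958552,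
  66000213060408184999785139734803138099622092567315237520,
  307711537900018903415111509326451664676203449216529900315,
  215537182984202818376420170159039826342879162072196917764,
  522197918778030778888538656444679232284437955149471687454,
  252878659613991304147654521950786403420386282493268481285,
  16217711544230187248557871025580269341876795635820835491,
  465896616082381186961654483833108823388958843402282381580,
  323374521710427372339027108893141840859324341515079787293,
  245705738523154373393037266465729124868257002405793641735,
  197312099795846731971821059896895478229639661745648786703,
  3384137417040934765133166171365971019872003439947231240,
  13273654763919786245647057852342482998653037534354344104,
  15803890682693855410373034140948725260689085262782714650,
  208500450338590810539702456833271128108027972074184462860,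
  1178682266937346246581401377697363651011177008471566507,
  198201818102267528483701058495705346336200100709286630173,
  49862071528560330989772658392309450857176358716065862816,
  200578477030906978926239108981372694335711802443062972949,
  314161791248475013154661205445013890921784329247267018032,
  665948912827600927994839682775626914345979549232107498784,
  343801698461598262732477176072556079588276781496744334114,
  53739890679807757346437544281320782557024667341035981837,
  197052563397413949389771854211361802197743176144728544397,
  2042473386742265812708247713833762065432072809617764375,
  78157813552629790583488331509891845061599582464301498384,
  13845308073249893667224475765768953524078959669804320784,
  200764820148588953441858706970709935100645772507461005337,
  318777083071055747208399761014039253914181450315352834193,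
  478978488323976370677964383390873803245865625535453678394,
  250294829553016962241726669310798556720440580854017884217,
  555579219622946820495845277209856349768244823988687438639,
  327119144392936470820664312008823515395871152878213224638,
  515122352501430534364293938671245852376098504276938801471,
  491548225576793910744242166848459868472182511807870538929,
  589715695137269629555238803305281130495819107816847485020,
  528005812387504699786864174796757787691846892745968092479,
  69263485825505796747362025980399060280791786983188040513,
  523035955520472519525356246769254762709976050357120837827,
  33061399164977379849030932850989773523022023232947147300,
  469141629112439312289230085111337355442351848680797634729,
  318767988439577053258603668331740872987017472421498207514,
  252863728687402103975662017651602785780005322387025641527,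
  226429333985801386193521732545733638527827582529486981676,
  18828942123202183640606073348874549974212421633190310600,
  69365165977280276202150176356344099489233227408758047548,
  518270899770067929144765513136442572355916127872817976139,
  443179503219257058762825890672300845478867484953980265017,
  503617219696568420578108994379316803643436249752834982715,
  482282925741766102484164748827610984210229623406390978738,
  197383701136022077769768135939150143596140445001826772257,
  611182870748607086058533496321987943832135625347117257507,
  325782541931198270818145391473481422665106247523522057290,
  589559580164940855588334002968448859233510202431140205731,
  445433633774557604400932139427009359980530224942673578319,
  362752578337356893789343806592523916281701282761635173586,
  224015714761610423064441672932704333755813148361974917161,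
  446243592556378529307634451911079576908471733577514308776,
  447694189694114403937937864355418682864996822621214676139,
  228919706585117149236782359694966970683640012412371151050,
  467921753578586435745272583076972681875703566949595349321,
  326429410364761126547011183782176496295888899349951447754,
  262953632008159036198899022859875017274424035870301705293,
  71803600482444023614008671464183410049084317114984223795,
  262375585269726142270981530370366660064194411421520502989,
  397450928110178822883677261093051983727510966887841859793,
  372659816004393601815021679584303260882763410814371267282,
  518494259254275824020608815365060327733996470415236870863,
  509674494015897625169747691283693094580546244313754194641,
  476541234503579684154391912151931941308874076888565828297,
  351639083281117614037796772877089929438198139155968508112,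
  522025825956766062645205049450284480876310722682850249050,
  497996372988520057282084210085785607300681042969554355034,
  449404815195098132863983989048380100589432781002450436680,
  521164200844423849859504937946827864562179205514676679895,
  760341133774771874681926012618188858957089584346854593746,
  464657794434171888599191279335511659408851731295297422542,
  666283491477639847631972446070552096939239006546057269977,
  249719751031489034986541315452908587661764050372353411633,
  198103831155010661823781193332198553939949016027264404260,
  322594991195644575151882722694974215778270805998087229988,
  276810030750691736215788968134517767634876356597523747413,
  520007054796239663254999967983991129775520617623218957011,
  480106120558867978474974426102683984783843737975342010970,
  518762208845726215242345361221206939452763793992570708699,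
  517991472687477402705586287066984438231170197518162340699,
  510338676841875744288662728162686923084480528312500413128,
  56206669704407915480194650094832077767981438935658334291,
  591767144702220982844462508701781331254365228349922551100,
  578257855683893696271369595458532734622802737227504814425,
  617327117996379819908854817978451770781209808347177424210,
  512734368288384943634253505393219619074779717434701122376,
  705982084228559421239105055289229096697397950062237131950,
  525340738823303298686787781028085732482089899571889263179,
  644946416271750743332148076345033217223525588346783048380,
  280747227228324261765137672732160530007811418914575930445,
  644858592518374225142849853881436502658016011053427078446,
  307470134713854189656241781173535838143586494793999802927,
  508793365966006038444271051137767507808207881141788626239,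
  315745311721714719354452412769416250035751394543547392579,
  262506466824864407461995040302070994047724026483696664660,
  247170703489288745115970146501825252606328961556950454329,
  677554810168565308802593217583259578855168387008883602222,
  208638949471410327147816257447314819377114354643259629885,
  312683826503485213481165947647087900337924623119163793586,
  611960153432772229070578996654023176715510931501825545376,
  449982277186159608164874544778049577445084928534603506880,
  228009848652753455609861920777609182836518476400025731408,
  130652166788447946412030269242261033138012727115556980014,
  314410030209830119810729716868337187664485895818441706282,
  394349644452284179073345667986397434256783749001691269316,
  83264366262124397515268180119788013435463528927852503616,
  522892340870846386764752129797325744336432529398014413647,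
  294555296931675987208347457237784664085266247642825966890,
  54300729822777631985826081914384471029599685066563409056,
  505755079126951089769581863815061168483457730060597928655,
  213502945207700382626329713353511292104744848331027317303,
  211880720831107534122405355425907141345618026383532048551,
  324938068737726544769647516831455355951177587266224425512,
  49166368834830857097835978656418336921143831307471368203,
  111188476738584848676184578160829117359645091074838975505,
  509603901013408198169531597230358368468520410578753344822,
  517988408865303946319958862360456108920610555149746866331,
  15804982972698724771703745978377948335517921102898138138,
  197386174261792284308931266385237196475722389846921925281,
  211789968110447299207026010114584683009490422876066361612,
  209833408328780063898370097646066633464931715744409012750,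
  73686254740261020670354100589195115362389253239886127286,
  411679523061936835864717842144476509563737978931629477008,
  1152809179643651725036484226425107872734573576903078528,
  307375080753104140004460231421534479116617876529912381593,
  771306320185638474699262843143422252045402153165212160]

lemma isPlaneTable_A : IsPlaneTable 93 54 edgesA where
  pos := by decide
  length := by decide +kernel
  bound := by decide +kernel
  tree := by decide +kernel
  dual := by decide +kernel
  face := by decide +kernel

lemma isTwoSidedTable_A : IsTwoSidedTable 93 54 edgesA
    4961502638867960342507298423 6537039281527020 11406440191092480
    ![92, 2, 137, 47, 64, 86] ![0, 1, 46, 39, 29, 4] where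
  cut_inj := by decide +kernel
  ring_inj := by decide +kernel
  cut_lt := by decide +kernel
  ring_lt := by decide +kernel
  mem_cut := by decide +kernel
  mem_ring := by decide +kernel
  cut_faces := by decide +kernel
  inner := by decide +kernel
  length_inner := by decide +kernel
  length_ring := by decide +kernel
  euler_side := by decide +kernel

lemma isCycleTable_A : IsCycleTable 93 edgesA nbrTableA vertexCyclesA edgeCyclesA where
  five_le := by decide
  nbr_adj := by decide +kernel
  ne := by decide +kernel
  lt := by decide +kernel
  vertex := by decide +kernel
  edge := by decide +kernel

lemma isGood_A : IsGood (baseGraph 93 edgesA) :=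
  isGood_baseGraph isPlaneTable_A isTwoSidedTable_A isCycleTable_A

/-- The edges of the base graph `B`. -/
def edgesB : List EdgeRec := [
  ⟨0, 1, 49, 51⟩, ⟨0, 2, 49, 50⟩, ⟨1, 3, 39, 49⟩, ⟨1, 4, 39, 51⟩, ⟨2, 5, 40, 49⟩, ⟨2, 6, 40, 50⟩,
  ⟨3, 7, 39, 41⟩, ⟨4, 8, 34, 39⟩, ⟨4, 9, 34, 51⟩, ⟨5, 10, 40, 41⟩, ⟨6, 11, 29, 50⟩,
  ⟨6, 12, 29, 40⟩, ⟨7, 13, 35, 41⟩, ⟨8, 14, 34, 35⟩, ⟨9, 15, 25, 51⟩, ⟨9, 16, 25, 34⟩,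
  ⟨11, 17, 50, 55⟩, ⟨11, 18, 29, 55⟩, ⟨12, 19, 28, 36⟩, ⟨12, 20, 28, 29⟩, ⟨13, 21, 35, 36⟩,
  ⟨14, 22, 26, 27⟩, ⟨15, 23, 1, 51⟩, ⟨15, 24, 1, 25⟩, ⟨16, 25, 25, 26⟩, ⟨17, 26, 54, 55⟩,
  ⟨17, 27, 50, 54⟩, ⟨18, 28, 21, 55⟩, ⟨19, 29, 18, 27⟩, ⟨19, 30, 18, 28⟩, ⟨20, 31, 19, 28⟩,
  ⟨20, 32, 19, 21⟩, ⟨22, 33, 17, 26⟩, ⟨23, 34, 1, 52⟩, ⟨23, 35, 51, 52⟩, ⟨24, 36, 1, 16⟩,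
  ⟨26, 37, 53, 54⟩, ⟨27, 38, 47, 54⟩, ⟨27, 39, 47, 50⟩, ⟨28, 40, 21, 53⟩, ⟨29, 41, 9, 18⟩,
  ⟨29, 42, 9, 17⟩, ⟨30, 43, 18, 20⟩, ⟨31, 44, 19, 20⟩, ⟨32, 45, 11, 21⟩, ⟨32, 46, 11, 19⟩,
  ⟨33, 47, 16, 17⟩, ⟨34, 48, 31, 52⟩, ⟨34, 49, 1, 31⟩, ⟨35, 50, 44, 52⟩, ⟨35, 51, 44, 51⟩,
  ⟨36, 52, 1, 8⟩, ⟨37, 53, 48, 53⟩, ⟨38, 54, 47, 48⟩, ⟨39, 55, 42, 50⟩, ⟨39, 56, 32, 47⟩,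
  ⟨39, 57, 32, 42⟩, ⟨40, 58, 21, 46⟩, ⟨41, 59, 4, 9⟩, ⟨42, 60, 8, 9⟩, ⟨43, 61, 10, 20⟩,
  ⟨45, 62, 0, 21⟩, ⟨46, 63, 11, 12⟩, ⟨48, 64, 31, 45⟩, ⟨49, 65, 7, 31⟩, ⟨49, 66, 1, 7⟩,
  ⟨50, 67, 44, 45⟩, ⟨51, 68, 43, 44⟩, ⟨52, 69, 1, 3⟩, ⟨53, 70, 46, 48⟩, ⟨55, 71, 42, 43⟩,
  ⟨56, 72, 32, 38⟩, ⟨57, 73, 30, 42⟩, ⟨57, 74, 30, 32⟩, ⟨58, 75, 33, 46⟩, ⟨58, 76, 14, 33⟩,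
  ⟨58, 77, 14, 21⟩, ⟨61, 78, 10, 12⟩, ⟨62, 79, 0, 13⟩, ⟨64, 80, 22, 45⟩, ⟨65, 81, 7, 22⟩,
  ⟨66, 82, 0, 7⟩, ⟨72, 83, 23, 33⟩, ⟨74, 84, 23, 30⟩, ⟨76, 85, 14, 24⟩, ⟨77, 86, 13, 14⟩,
  ⟨79, 87, 2, 13⟩, ⟨81, 88, 2, 15⟩, ⟨83, 89, 23, 24⟩, ⟨85, 90, 6, 24⟩, ⟨41, 91, 4, 10⟩,
  ⟨59, 92, 3, 4⟩, ⟨45, 93, 0, 11⟩, ⟨91, 94, 4, 5⟩, ⟨0, 95, 50, 51⟩, ⟨66, 69, 0, 1⟩,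
  ⟨79, 82, 0, 2⟩, ⟨69, 92, 0, 3⟩, ⟨92, 94, 0, 4⟩, ⟨93, 94, 0, 5⟩, ⟨87, 88, 2, 6⟩, ⟨81, 82, 2, 7⟩,
  ⟨52, 60, 3, 8⟩, ⟨59, 60, 3, 9⟩, ⟨78, 91, 5, 10⟩, ⟨63, 93, 5, 11⟩, ⟨63, 78, 5, 12⟩,
  ⟨86, 87, 6, 13⟩, ⟨85, 86, 6, 14⟩, ⟨88, 90, 6, 15⟩, ⟨36, 47, 8, 16⟩, ⟨42, 47, 8, 17⟩,
  ⟨41, 43, 10, 18⟩, ⟨44, 46, 12, 19⟩, ⟨44, 61, 12, 20⟩, ⟨62, 77, 13, 21⟩, ⟨81, 84, 15, 22⟩,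
  ⟨84, 89, 15, 23⟩, ⟨89, 90, 15, 24⟩, ⟨24, 25, 16, 25⟩, ⟨25, 33, 16, 26⟩, ⟨22, 29, 17, 27⟩,
  ⟨30, 31, 20, 28⟩, ⟨18, 20, 21, 29⟩, ⟨80, 84, 22, 30⟩, ⟨64, 65, 22, 31⟩, ⟨72, 74, 23, 32⟩,
  ⟨76, 83, 24, 33⟩, ⟨14, 16, 26, 34⟩, ⟨14, 21, 27, 35⟩, ⟨19, 21, 27, 36⟩, ⟨73, 80, 30, 37⟩,
  ⟨72, 75, 33, 38⟩, ⟨7, 8, 35, 39⟩, ⟨10, 12, 36, 40⟩, ⟨10, 13, 36, 41⟩, ⟨71, 73, 37, 42⟩,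
  ⟨68, 71, 37, 43⟩, ⟨67, 68, 37, 44⟩, ⟨67, 80, 37, 45⟩, ⟨70, 75, 38, 46⟩, ⟨54, 56, 38, 47⟩,
  ⟨54, 70, 38, 48⟩, ⟨3, 5, 41, 49⟩, ⟨55, 95, 43, 50⟩, ⟨51, 95, 43, 51⟩, ⟨48, 50, 45, 52⟩,
  ⟨40, 53, 46, 53⟩, ⟨37, 38, 48, 54⟩, ⟨26, 28, 53, 55⟩]

/-- The neighbours in the base graph `B`, coded as for `nbr`. -/
def nbrTableB : ℕ :=
  498547180093155806679420796422827712085710422269266460040514128294666158961150919446423844462742945972257261750785568690647183139937681041030117327675523233320359041662749926739865659401722203148967901298669382730982431863136502865309969573410070562961329707673485239217871887605034925915370524242130008482216786862877760969940757475750144473874283783651012459903041435327272889376838011247572304913263962646699658109958943004632475635262332823515370842795608444981052581693427095571414303414261833446956073040618135727860927602779498552783211912457984001964162121112574306694808674934101880042749380405524604431044907666751033693736349784613270154882354339467354126727477793593887103573194372792579985120459482455769013104156714712852306119479556350271513019372556075815137279428496349914296951265589444865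

/-- Codes of cycles that avoid exactly one vertex of `B`. -/
def vertexCyclesB : List ℕ := [
  15748810643052741878092468782556836323180149779229659310850,
  53799805417686925790087373458068125450585444466969868419843,
  18846681134795608522406247962964833239442397930237311014021,
  3170737604904671853046145179359405074895797125290476601479,
  77394371945533768019575919224569988969239720475540638985,
  12566783002054096338712364364814042386662302116035237729283,
  56767158030751945873413963923549921317468209903012423058050,
  66322073733278911448654604301358642195651796208530456398851,
  32398490201426307323765224892820848936799534304257167380487,
  12753507700837196679422356905915490902956065699672476404228,
  50307674156968622276221736215406139078822753500475180662917,
  3342661909395565377468245587559934061549480847399006839441,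
  113064659570599583693000341667001892876857709467727511172230,
  75338443517117386528839924879330110603856283093389255327754,
  50511293336918411698733976739830839025217486980833476859016,
  18074523769708735365459330665892262892301113896913069966488,
  80089465884083503838405553181633979813860383991795963448601,
  82828398510375149214171520072586734215700514370538005807898,
  75546679632490593980661782877782280600250383423616372492939,
  119266142459657036924662815744177361863386675138814253074965,
  3447089608377598633172140179244264659963299141261797250336,
  113187370428657884452752190896743422118815226681067241277581,
  133408765403578289481974520277497717973896407229383912489761,
  4371878593708007509298574088848578304293025207820537250467,
  76552863565971026350232582255876875010244452487109658331791,
  20401071772242721546142076596516112649583010231516889668129,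
  20609455427727032306191027343168222680049066979999929685157,
  3434814152991652720977399872894185643800342919897683795985,
  8288030434855306588762537847311547363416173581985521598632,
  171492382319421675238523691797606966787194760602552992662294,
  52262611920859485701534234192603610053253717136989966664491,
  54840640348093840645815453299792312226446303017374874894636,
  34181602650794978775442229879019975215892988266776459629229,
  171321556470676490421687500748121612814234999699717847395990,
  3517334916355067012162935866839846493867601171777803264689,
  55439750440262299402021674967447996463504076286635000255639,
  83577069526531879034067990808310926263641978004095531307544,
  50512885262018039673597927491560027548450909991261527166106,
  67802393720282623431609585994426316508919384268083535282358,
  11430596926806299476867463986351359763066221802528594477753,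
  128685195906936453388525167680464851389507455896236407959708,
  146389053755443694795599997591557693071044128692466643850539,
  135820557227594713674380829096765477624366621388276239125679,
  176557497497533213970516488325041874090275027255259043288222,
  140183701464760193743714949070317441553501393262600629867679,
  163217363547597141562529020221757078171456004846428163822880,
  81483566336860575220345381109475941663313085876103247857855,
  184065178752675703227079484709115162216393415791993600377642,
  54925610172008216683985398661965105655238921463024918991666,
  19682282149317414154069772571689405285972761765748342281410,
  18850656801741595572300134245600936641270882321416733116963,
  119322142180254209149568722201078511744859361227931692910687,
  117913011519108709346775154746016549399780864034796177413284,
  8055995815751979460613101166351414078317469770565912900136,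
  63584996710580883839259807625822914415295928927086690116166,
  100512025439033407266959904988217316590094743776358362720479,
  83430027098945820467187870126582742237186761978518091034678,
  27181565938371356715282215058448498182601818069544460113610,
  130556367881418845876325853372937709984404112596262312741067,
  83490442823103832326596784217001446232017424519344689416412,
  108022867688654623074585267061383608501608095794715161695547,
  75553883750748772023321867285561771923527189424523393053227,
  29162367236415957645352991404514372898556441868853364411437,
  92899884470123273674570827474463879826755711268880450357838,
  54447011225694401522799727724235085727409306680664163405872,
  3477356274726387438647360712002816488930531837009098494513,
  80296834702823780199953722099112579448960626894094128709842,
  70622232420981916205624398766877486329989951886509043886148,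
  70826027723457991440859810624671249094548990967244765933895,
  131897833677395225384104786545054271332229202737480197474652,
  115801698284696010656850568013869323524477554028719223474251,
  117899971370143514907843262633665171107937137943023537392713,
  19651412750229177351937167924120369466479709643808650046026,
  176621080935207604700067329595235729345505915210460528190265,
  176594490458073106921081544648735761238294690333186434548409,
  121227486020382398035556933176605278573026876533022965199558,
  79380044315845530877463434293812079011397387759138726251349,
  82518638161194589488464559898202770410688600756951820831958,
  181693445430960151132689134303767857378735678194926974280539,
  95923123240477488345997244472510580081339124528883412848702,
  57724061058768305659380876642042470055236468010073974649408,
  79323770389497356197086143617254178217488958577160716353601,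
  17820319393263978354091930341753970174425514730730230919759,
  108606091329879073625157777551359843490738935998551489323852,
  136751764503630627926372322277075504161902783658870262280793,
  107674095517517968017723400314634003654956471343756846740684,
  33440254203726176835625847971449554913673481396350332973653,
  180792522927111510942911063465267129867349615373686372338008,
  146060685107636290694939306864774698259541373607863354790490,
  184107956580686657825347326980071335854641440388329345561811,
  182546284495049687150534700450732279407428513487295191462489,
  71140481603018708731034630864964492748640904366320682999886,
  126383690987705297674159989257237579883802625991848684948062,
  130645558122931575257984837193129181208345762062377494416094,
  130721870806205333244310838367225799356672036393194372235996,
  101660888081111275283098066693705232245361054329089559823539]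

/-- Codes of cycles that avoid exactly the ends of one edge of `B`. -/
def edgeCyclesB : List ℕ := [
  3384830690988342113453689221363012788165870197323248751362,
  3432841659285908143383960574449937508434984222404619488001,
  6590563718820886375707826761532187326443309569580491494016,
  13420279959338490251535595877302303807499558982350007317251,
  3936233989158001753689094310672637762488237897125829324803,
  224176592763532906137957682998709903958864353289075176075,
  3152074742044517227464288207757654463431066479258869121165,
  1092877458022918091931245133592774904411850461479864111881,
  1685820121576009423651542718559179220615242640793235934337,
  32170230653536660391087024844674439700938766751315440698637,
  23061964675013853775080712310189737472700048558206811196690,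
  29035439498862633221766130557010080271937192253351879570698,
  12570007598888093144992525331806082770242477771765662925322,
  786005853748484979892590563380988502074257154736240545799,
  3249660096125493627502427225916175278568453343855134165508,
  19727267557431356427657200601111730078904856516456277026969,
  19623915671810869181387456229631337467467739312341442546970,
  405790041361895936080687388663259784622352657711927439516,
  14339196383815301032249415542634866227674625112453659570186,
  846732440274320512405380424922511108389470587384393703442,
  20596811920691629498205785806737224725675444966729035756042,
  6014569393497125234799846960006855101354990054174589526177,
  789621768600371851535330297140289684910441438213041342473,
  31487731117487979721792379296816791503226520660117769999625,
  25917617463020009037876289460650825941120444028823631385737,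
  507699029320695336047403454148466708976543064300377112604,
  19628969937845139648904788681008417564798970283629711510795,
  2072007741005604840440422141530166925863017613592727912616,
  25160839821984881567537590751133353072409587212570159876117,
  25195118667207687324643231746499916090362576029293799409685,
  45981199936657597004268187361050998393972282747072100838686,
  20212630197362240236828880946044850659211974442561614283566,
  13685240977446616764075091128973566619511085362271377762329,
  13804738542311389694290093380307775168481739660531329831695,
  13389085561792575885279501005812746088842175762997278200591,
  23459444939718833344854291802736611180001175227466200547887,
  3942564152036103627496418606779046139193541685878226452661,
  29243283650407218233712694342195045518012302545221732565797,
  4825892485594573293844879176564719729917999983822952024248,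
  32389679581553937035771395963628128265495641789123892937525,
  8356698289885702692218714404295742346565602782107996784827,
  45178211190254585862491938000326110670941506262781491727638,
  35045927124194355216081115838295869934785525124759215166751,
  34261241061946573984626712234078139135476756576716818797885,
  33477683160037321815018802681020991577314327180676159588573,
  3447089549312270997188299749472370882384278168077035146029,
  43363572653036801056120049640318393679722691548346595759402,
  263872098688465754008170602897489410886092317436950138903,
  3266017503340848556793323864734443366584850464320355762352,
  1833141045890158109939279459733992911064272226826405806128,
  12572812117347604671958273156165366180224074254674261494423,
  13455425463828858908018060374000890043511846483041037584943,
  16067454188442195637013800917657875882959093040833647260826,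
  28247758880591269970528742718445679845281050314610369893669,
  29355196027641692485403487321410844276280602664737854075207,
  8111894855609932483346927380059053364134777362942903139129,
  3647370539453921598336208884315736735561982393911187112120,
  29934302109275270456419837747129956393500069248176255869131,
  29477283093711813791418479981997878664256977175120271936347,
  34065077149391233856873970965109750345042951818399317636271,
  17784915036458110274414403180873156065251625752323755749710,
  20857569617598736407829417405597147867903145078021186290511,
  41000435381683582085843524693202191962403879953048952935584,
  4909092877796468509139896278046915367544102884434405804082,
  15709727592031005648631633238116173703635127005714704520354,
  7507244420742534192218565334349869784372119909452458229953,
  20402473111122542213091455091903802077870844639989683982660,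
  20719399774580242951176807188036983849443510415955229605955,
  3517288777740445350141268773253632352722884607229162424898,
  2039944997788465115114364681989295910109249783973079023656,
  26358952872754473203304586640249650697865772607309447514719,
  5010182960361010807905941611398994661512054281466727811146,
  11213665982271354394723840127582497988424097909122866646218,
  33213213456348900151900695427858982493106143762769648028361,
  33152094894479442932701451339228132281078016635852304714920,
  28463473766701418545543474048577476193738820056529618982056,
  25962227377570360767530314860205759089452860079007614142667,
  13827372045423609602995267627793613092380796336904757686828,
  20070739118495938482086839338971382548512268772032325353554,
  16678656664957822764663351314707672306262845062977735164483,
  21683547681072657714798975382545120297024052702041160026328,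
  33347360649742679223827009415718627730051553313271811967301,
  45638548298668790356420312792127751714997803004269530087769,
  38184809510377746533606498206322791217006974109153380738233,
  34237878411279363351653015974426467011289905369486686030554,
  1111361638704523910193345380630050792322040798974336380990,
  13481671011458773098444033410145306747843880956657757326398,
  30222599057427833709788397170320126111673569501712190015703,
  27122804239662628691915416780544289598743130095965574835532,
  45179146060042668317558468038220487420441795840150545310424,
  33169386084914445398793317199530630075134617332482184459470,
  32925095096659841467493988493998559390097719352123514374238,
  34404528646335494266406177369071717943089950687013920082111,
  32595273288364638532442878194127119808167074722783781127374,
  18441317012968601852951193233620440558437820129833129090,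
  20057601214657336456252387443149390131424989091054891630802,
  31597961542133792466817353206817737231562833276435964667074,
  28760835933037938517062797179861936223933187441535941681851,
  28524028419507556270353250194779065797213880510332428554973,
  38108854257716232798361537280972236553717876689730143331035,
  17791140805384865209182340534291769854963003262712209027663,
  26007411909400852443386759983769151815236222079799310984386,
  20738718581161665401417588337427295727923727039113736497349,
  41270410217380571597715523055396267305834915655399789384362,
  20919058759482927504578921714918957623902296916606784972863,
  32565832859721491645553290917208307090940040509295186980174,
  32614618767464711110877158183595642677527233073514914587325,
  39676609410955941763930941290239753016034440049192438631629,
  26122452884394975277023555236852833393144122356614163903692,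
  46102554354220139761519183268252522489123355270064493376089,
  46026989084680090339543900327238289549506087331625466090282,
  28314897249363661938282260410408038692215987254954465174049,
  46011717973368866929742303774699224459391458421764487730334,
  25162361607914205607785359986293361967370412445298295362719,
  23230776716331889822311237122101036972647291056881903935694,
  20109853240291266079748046343657568796683810467251415982294,
  32664056761178807374574768995569125453411866489922976425304,
  42500368582414582086883307683919242393744230587644965827795,
  45932975070882007841022783390039820990737571219345241049816,
  13341986060515092530865143545706456558677759523168801076367,
  42775321773858848028144731223335775943412385367216498421398,
  32639090100362457572285976522806332902378857705193341277473,
  21773901017021912960509586544894103905786227435538087233836,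
  23792295583844969700944478585491901340595206867126573573407,
  13783379510329303840036382179932399468789576523725606259401,
  12609161828841409449736624723165892565987139905326420590768,
  25615400369948839994700188858754473516940579965842274681016,
  9101686802892395580820091858790733665176846689359343470805,
  3559629489402490116536048766977980782230285965614647817,
  18881622019470453672197877538336219854763050717595932328726,
  32170231374543960850740153142567689003991741795891476627597,
  14439670647856434535763909915941552050870674143745785541184,
  11408790313804656843188330778826172626346658395951383501011,
  26144656827603599159150820986666149275193998565793618635524,
  12606766570173288951482065926444376194292713415977424079877,
  20806214627715660502873913538729025444880009336965909652117,
  17487506142235487435558958653010051134383604050733812257860,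
  19642487445349932740713752516636298813831646609343483301955,
  18112799202195519593942462298692284142658863672341748157511,
  17465576430456145070508428727637867769566364171623708706116,
  30015505829806188564428845396977788287113354429296228514998,
  19028297919334540688687161592168994599056189269010008724646,
  33360575349622687775206113443985893517028424085474055375947,
  7184842013011478152737435061817258364289065487603600228487,
  32469174799831311562191290824829279536626697769556731827379,
  2029361082172458772658197542203182799713821982863797248,
  19733243616235505358826956027511762124369955833173358444739,
  31386686858623563669895534782622093249591984428307089542300,
  12622424249882759032447340424160608775916525284358533152922,
  834472475944673932024650655068117456199577481097608776721]

lemma isPlaneTable_B : IsPlaneTable 96 56 edgesB where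
  pos := by decide
  length := by decide +kernel
  bound := by decide +kernel
  tree := by decide +kernel
  dual := by decide +kernel
  face := by decide +kernel

lemma isTwoSidedTable_B : IsTwoSidedTable 96 56 edgesB
    37138504013575502526953684991 32084177750909124 566919545429816
    ![95, 61, 27, 16, 94, 22] ![1, 0, 21, 55, 50, 51] where
  cut_inj := by decide +kernel
  ring_inj := by decide +kernel
  cut_lt := by decide +kernel
  ring_lt := by decide +kernel
  mem_cut := by decide +kernel
  mem_ring := by decide +kernel
  cut_faces := by decide +kernel
  inner := by decide +kernel
  length_inner := by decide +kernel
  length_ring := by decide +kernel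
  euler_side := by decide +kernel

lemma isCycleTable_B : IsCycleTable 96 edgesB nbrTableB vertexCyclesB edgeCyclesB where
  five_le := by decide
  nbr_adj := by decide +kernel
  ne := by decide +kernel
  lt := by decide +kernel
  vertex := by decide +kernel
  edge := by decide +kernel

lemma isGood_B : IsGood (baseGraph 96 edgesB) :=
  isGood_baseGraph isPlaneTable_B isTwoSidedTable_B isCycleTable_B

/-! ### The two pieces -/

/-- The vertices of a drawing of `A` in the frame, without the two marked vertices. -/
def annulusA : List (ℕ × ℕ) := [
  (0, 0), (136, 199), (47, 344), (281, 256), (127, 340), (47, 642), (94, 390), (324, 303),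
  (382, 265), (151, 431), (0, 1000), (93, 582), (108, 487), (327, 351), (365, 304), (391, 287),
  (475, 253), (138, 488), (188, 466), (124, 723), (289, 632), (124, 617), (299, 400), (358, 348),
  (381, 321), (424, 291), (581, 221), (462, 273), (154, 546), (235, 456), (179, 510), (179, 616),
  (195, 660), (625, 306), (244, 635), (286, 587), (335, 395), (366, 371), (420, 313), (733, 153),
  (534, 257), (487, 275), (175, 570), (217, 501), (196, 519), (216, 598), (202, 575), (216, 622),
  (586, 287), (1000, 0), (248, 613), (303, 535), (265, 594), (411, 344), (464, 295), (618, 238),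
  (536, 275), (192, 546), (219, 527), (230, 568), (238, 585), (204, 549), (223, 558), (236, 609),
  (514, 317), (352, 457), (273, 560), (261, 582), (454, 323), (405, 370), (485, 298), (506, 306),
  (237, 532), (250, 548), (254, 564), (245, 592), (451, 357), (398, 403), (354, 434), (467, 327),
  (391, 395), (441, 351), (377, 391), (268, 511), (371, 411), (341, 433), (366, 405), (316, 453),
  (340, 414), (358, 397), (351, 412)]

/-- The vertices of a drawing of `B` in the frame, without the two marked vertices. -/
def annulusB : List (ℕ × ℕ) := [
  (0, 0), (115, 102), (101, 135), (145, 147), (199, 160), (141, 162), (162, 244), (181, 176),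
  (205, 183), (278, 195), (176, 203), (189, 347), (196, 249), (191, 200), (235, 212), (368, 214),
  (266, 211), (195, 445), (209, 353), (225, 248), (221, 299), (217, 220), (253, 233), (509, 219),
  (316, 230), (285, 225), (209, 445), (189, 542), (217, 413), (252, 253), (236, 271), (233, 287),
  (245, 308), (273, 235), (466, 281), (693, 161), (297, 249), (214, 476), (206, 514), (164, 669),
  (234, 442), (259, 274), (270, 256), (248, 277), (244, 290), (265, 327), (249, 298), (280, 247),
  (488, 301), (401, 322), (570, 265), (1000, 0), (293, 272), (226, 469), (216, 523), (0, 1000),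
  (212, 565), (257, 568), (259, 443), (271, 278), (278, 269), (250, 286), (283, 371), (257, 297),
  (427, 358), (391, 357), (346, 328), (529, 332), (614, 316), (306, 297), (230, 490), (313, 616),
  (255, 502), (325, 533), (282, 503), (248, 478), (277, 444), (278, 408), (257, 291), (307, 378),
  (404, 415), (344, 391), (332, 366), (279, 462), (334, 438), (291, 426), (292, 411), (306, 398),
  (318, 404), (306, 441), (305, 424), (265, 289), (277, 292), (266, 301)]

/-- The vertices of a drawing of `A` with a hole in place of the vertex 91; the position listed for
91 itself plays no role. -/
def holedA : List (ℕ × ℕ) := [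
  (56, 142), (44, 183), (49, 120), (110, 200), (4, 127), (60, 106), (31, 114), (172, 170),
  (124, 165), (9, 59), (75, 104), (55, 94), (41, 93), (200, 107), (155, 150), (139, 151),
  (124, 145), (37, 72), (57, 10), (77, 88), (90, 101), (65, 82), (181, 42), (169, 111),
  (155, 129), (136, 138), (119, 132), (130, 138), (61, 65), (125, 3), (68, 39), (83, 75),
  (85, 89), (98, 112), (89, 94), (96, 96), (158, 75), (152, 97), (141, 126), (109, 123),
  (123, 128), (128, 130), (76, 65), (102, 33), (85, 42), (91, 81), (90, 68), (89, 86),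
  (110, 114), (94, 119), (92, 92), (105, 94), (95, 92), (139, 110), (133, 125), (114, 119),
  (122, 120), (84, 55), (98, 53), (96, 77), (94, 84), (91, 59), (96, 70), (92, 88), (119, 112),
  (118, 96), (100, 89), (96, 90), (132, 114), (133, 104), (129, 120), (123, 115), (101, 67),
  (101, 79), (99, 84), (94, 87), (123, 107), (123, 101), (125, 94), (127, 112), (128, 101),
  (128, 108), (136, 97), (110, 76), (129, 96), (129, 89), (134, 95), (126, 84), (140, 85),
  (141, 93), (136, 90), (139, 89), (75, 122)]

/-- The distances from the last vertex of `A`. -/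
def levelsA : List ℕ := [
  1, 2, 2, 3, 3, 2, 3, 4, 4, 4, 1, 3, 4, 5, 5, 5, 4, 5, 5, 2, 2, 3, 6, 6, 6, 6, 3, 5, 4, 6, 5, 3,
  3, 2, 3, 3, 7, 7, 7, 2, 4, 5, 4, 7, 6, 4, 4, 4, 3, 1, 4, 4, 4, 7, 6, 3, 4, 5, 6, 5, 5, 5, 5, 5,
  4, 5, 5, 5, 6, 7, 5, 5, 6, 6, 6, 6, 5, 6, 6, 6, 7, 6, 8, 7, 7, 7, 8, 8, 8, 8, 8]

/-- The distances from the last vertex of `B`. -/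
def levelsB : List ℕ := [
  1, 2, 2, 3, 3, 3, 3, 4, 4, 4, 4, 4, 4, 5, 5, 4, 5, 4, 5, 5, 5, 6, 6, 3, 5, 6, 5, 3, 6, 6, 6, 6,
  6, 7, 4, 2, 6, 5, 4, 2, 7, 7, 7, 7, 7, 7, 7, 7, 4, 5, 3, 1, 7, 6, 4, 1, 3, 3, 6, 8, 8, 8, 8, 8,
  5, 6, 6, 3, 2, 7, 5, 2, 4, 3, 4, 5, 6, 7, 9, 8, 4, 6, 7, 5, 5, 7, 8, 8, 7, 6, 7, 8, 8, 8]

/-- The piece made from `A`. -/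
def pieceA : Piece where
  p := 88
  edges := edgesA
  a := ![0, 49, 10]
  a_inj := by decide
  a_indep := by decide +kernel
  b_indep := by decide +kernel
  adj_y := by decide +kernel
  adj_x := by decide +kernel
  isGood := isGood_A
  level u := levelsA.getD u 0
  level_a := by decide +kernel
  level_b := by decide +kernel
  eq_a := by decide +kernel
  level_le := by decide +kernel
  level_desc := by decide +kernel

/-- The piece made from `B`. -/
def pieceB : Piece where
  p := 91
  edges := edgesB
  a := ![0, 51, 55]
  a_inj := by decide
  a_indep := by decide +kernel
  b_indep := by decide +kernel
  adj_y := by decide +kernel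
  adj_x := by decide +kernel
  isGood := isGood_B
  level u := levelsB.getD u 0
  level_a := by decide +kernel
  level_b := by decide +kernel
  eq_a := by decide +kernel
  level_le := by decide +kernel
  level_desc := by decide +kernel

lemma isDrawingTable_annulusA : IsDrawingTable 88 edgesA annulusA where
  length := by decide +kernel
  nodup := by decide +kernel
  cover := by decide +kernel
  pairwise := by decide +kernel
  hole := by decide +kernel
  hole_edge := by decide +kernel

lemma isDrawingTable_annulusB : IsDrawingTable 91 edgesB annulusB where
  length := by decide +kernel
  nodup := by decide +kernel
  cover := by decide +kernel
  pairwise := by decide +kernel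
  hole := by decide +kernel
  hole_edge := by decide +kernel

lemma isDrawingTable_holedA : IsDrawingTable 88 edgesA holedA where
  length := by decide +kernel
  nodup := by decide +kernel
  cover := by decide +kernel
  pairwise := by decide +kernel
  hole := by decide +kernel
  hole_edge := by decide +kernel

lemma hasAnnulus_A : pieceA.HasAnnulus :=
  IsDrawingTable.hasAnnulus (c := pieceA) isDrawingTable_annulusA (by decide +kernel)
    (by decide +kernel) (by decide +kernel)

lemma hasAnnulus_B : pieceB.HasAnnulus :=
  IsDrawingTable.hasAnnulus (c := pieceB) isDrawingTable_annulusB (by decide +kernel)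
    (by decide +kernel) (by decide +kernel)

lemma hasHoledDrawing_A : pieceA.HasHoledDrawing :=
  IsDrawingTable.hasHoledDrawing (c := pieceA) isDrawingTable_holedA (by decide +kernel)

lemma levelCard_A : pieceA.levelCard 2 = 7 := by
  rw [Piece.levelCard, Set.ncard_eq_toFinset_card']
  decide +kernel

lemma levelCard_B : pieceB.levelCard 2 = 6 := by
  rw [Piece.levelCard, Set.ncard_eq_toFinset_card']
  decide +kernel

/-- The two pieces, indexed by the letters of a word. -/
def piece (b : Bool) : Piece := bif b then pieceB else pieceA

/-- The number of planar hypohamiltonian `K₂`-hamiltonian graphs of order `n`, and hence the number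
of hypohamiltonian graphs of order `n`, grows at least exponentially in `n`. -/
theorem mainTheorem4 :
    ∃ c : ℝ, 1 < c ∧
      (∀ᶠ n : ℕ in atTop, c ^ n ≤ (numGraphsUpToIso n fun G =>
        IsPlanarGraph G ∧ IsHypohamiltonian G ∧ IsK2Hamiltonian G : ℝ)) ∧
      (∀ᶠ n : ℕ in atTop, c ^ n ≤ (numGraphsUpToIso n fun G =>
        IsHypohamiltonian G : ℝ)) := by
  have hpiece : (piece false).levelCard 2 ≠ (piece true).levelCard 2 := by
    show pieceA.levelCard 2 ≠ pieceB.levelCard 2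
    rw [levelCard_A, levelCard_B]
    decide
  obtain ⟨c, hc, h⟩ := exists_pow_le_of_two_pow_le (N := 20000)
    (a := fun n => numGraphsUpToIso n fun G => IsPlanarGraph G ∧ IsHypohamiltonian G ∧
      IsK2Hamiltonian G)
    fun n hn => two_pow_le_numGraphsUpToIso_mul hpiece hasHoledDrawing_A
      (Bool.rec hasAnnulus_A hasAnnulus_B) rfl rfl hn
  refine ⟨c, hc, h, h.mono fun n hn => hn.trans ?_⟩
  exact Nat.cast_le.2 (numGraphsUpToIso_mono fun G hG => hG.2.1)
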